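/- Let $L$ be the shift $(L\psi)(n)=\psi(n+1)$ on $\ell^2(\mathbb Z)$, let $S=\begin{pmatrix}L&0\\0&L^*\end{pmatrix}$ on $\mathcal H=\ell^2(\mathbb Z;\mathbb C^2)=\ell^2(\mathbb Z)\oplus\ell^2(\mathbb Z)$, let $C=\begin{pmatrix}a&b\\c&d\end{pmatrix}$ be a unitary matrix with $0<|a|\le 1$, acting on $\mathcal H$ pointwise, and let $U=SC$ be the time evolution operator of the one-dimensional homogeneous quantum walk. A symmetric operator $T$ (densely defined, $T\subset T^*$) on $\mathcal H$ is a *strong time operator* of $U$ if $U^*TU=T+1$ as an equality of operators, domains included; it is a *time operator* of $U$ if there is a subspace $\mathcal D\ne\{0\}$ with $\mathcal D\subset D(TU)\cap D(T)$ on which $TU-UT=U$. The deficiency indices are $d_\pm(T)=\dim\ker(T^*\mp i)$, and $\sigma(T)$ is the complement of the set of $z\in\mathbb C$ for which $T-z$ is a bijection of $D(T)$ onto $\mathcal H$ with bounded inverse. Construction of $T$. Let $\mathcal K_1=L^2([0,2\pi],dk/2\pi)$, let $\mathcal K=\mathcal K_1\oplus\mathcal K_1$, and let $\mathscr F:\mathcal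 H\to\mathcal K$ be the unitary Fourier transform, with $(\mathscr F\psi)(k)=\sum_x e^{-ixk}\psi(x)$ for $\psi$ of finite support. Let $P=-i\,d/dk$ on $\mathcal K_1$ with domain the absolutely continuous $f$ on $[0,2\pi]$ with $f'\in\mathcal K_1$ and $f(0)=f(2\pi)$. Choose analytic $2\pi$-periodic functions $\lambda_1,\lambda_2:\mathbb R\to\mathbb C$ and a Borel $2\pi$-periodic function $W$ from $\mathbb R$ to the unitary $2\times2$ matrices such that, for every $k\in\mathbb R$, $$W(k)^{-1}\begin{pmatrix}e^{ik}a&e^{ik}b\\e^{-ik}c&e^{-ik}d\end{pmatrix}W(k)=\begin{pmatrix}\lambda_1(k)&0\\0&\lambda_2(k)\end{pmatrix}.$$ Put $\hat T_j=\frac i2\left(\frac{\lambda_j(k)}{\lambda_j'(k)}P+P\frac{\lambda_j(k)}{\lambda_j'(k)}\right)$ on its natural domain and $T=\mathscr F^{-1}W(\hat T_1\oplus\hat T_2)W^{-1}\mathscr F$. **Theorem.** Such a choice of $\lambda_1,\lambda_2,W$ exists, and for every such choice $T$ is a strong time operator of $U$. Moreover: 1. If $0<|a|<1$, then $d_+(T)=d_-(T)=4$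 and $\sigma(T)=\sigma(\overline T)=\mathbb C$, where $\overline T$ is the closure of $T$. In particular, $T$ has self-adjoint extensions; all of them are time operators of $U$, but none of them is a strong time operator of $U$. 2. If $|a|=1$, then $T$ is self-adjoint (so it is a self-adjoint strong time operator of $U$) and $\sigma(T)=\mathbb Z$. -/

import Mathlib

open MeasureTheory
open scoped ENNReal

noncomputable section

namespace QuantumWalk

/-! ### Unbounded operators on a complex Hilbert space

An operator `A` with domain `D(A)` is a `LinearPMap`; `A ≤ B` means that `B` extends `A`, and
`A.adjoint` is the Hilbert space adjoint.  `IsSelfAdjoint A` means `A.adjoint = A`. -/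

section Operators

variable {H K : Type*} [NormedAddCommGroup H] [InnerProductSpace ℂ H] [CompleteSpace H]
  [NormedAddCommGroup K] [InnerProductSpace ℂ K] [CompleteSpace K]

/-- A densely defined operator `T` with `T ⊆ T*`. -/
def IsSymmetric (T : H →ₗ.[ℂ] H) : Prop :=
  Dense (T.domain : Set H) ∧ T ≤ T.adjoint

/-- The product `A B` on its natural domain `{x ∈ D(B) | B x ∈ D(A)}`. -/
def natComp (A B : H →ₗ.[ℂ] H) : H →ₗ.[ℂ] H where
  domain := (A.domain.comap B.toFun).map B.domain.subtype
  toFun :=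
    { toFun := fun x =>
        A ⟨B ⟨x.1, by obtain ⟨y, -, hy⟩ := x.2; rw [← hy]; exact y.2⟩, by
          obtain ⟨x, y, hy, rfl⟩ := x; exact hy⟩
      map_add' := by
        rintro ⟨x, hx⟩ ⟨y, hy⟩
        rw [← LinearPMap.map_add]
        congr 1
        apply Subtype.ext
        exact LinearPMap.map_add B ⟨x, _⟩ ⟨y, _⟩
      map_smul' := by
        rintro c ⟨x, hx⟩
        rw [RingHom.id_apply, ← LinearPMap.map_smul]
        congr 1
        apply Subtype.ext
        exact LinearPMap.map_smul B c ⟨x, _⟩ }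

/-- The operator `V⁻¹ A V` on its natural domain, for a unitary operator `V`. -/
def unitaryConj (V : H ≃ₗᵢ[ℂ] K) (A : K →ₗ.[ℂ] K) : H →ₗ.[ℂ] H where
  domain := A.domain.comap V.toLinearEquiv.toLinearMap
  toFun :=
    { toFun := fun x => V.symm (A ⟨V x.1, x.2⟩)
      map_add' := by
        rintro ⟨x, hx⟩ ⟨y, hy⟩
        rw [← map_add, ← LinearPMap.map_add]
        congr 2
        exact Subtype.ext (map_add V x y)
      map_smul' := by
        rintro c ⟨x, hx⟩
        rw [RingHom.id_apply, ← map_smul, ← LinearPMap.map_smul]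
        congr 2
        exact Subtype.ext (map_smul V c x) }

/-- The resolvent set: those `z` for which `T - z` is a bijection of `D(T)` onto `H` with bounded
inverse. -/
def resolventSet (T : H →ₗ.[ℂ] H) : Set ℂ :=
  {z | ∃ R : H →L[ℂ] H,
    (∀ y : H, ∃ h : R y ∈ T.domain, T ⟨R y, h⟩ - z • R y = y) ∧
    (∀ x : T.domain, R (T x - z • (x : H)) = x)}

/-- The spectrum `σ(T)`. -/
def spectrum (T : H →ₗ.[ℂ] H) : Set ℂ := (resolventSet T)ᶜ

/-- `ker (T* - z)`. -/
def defectSpace (T : H →ₗ.[ℂ] H) (z : ℂ) : Submodule ℂ H :=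
  (LinearMap.ker (T.adjoint.toFun - z • T.adjoint.domain.subtype)).map T.adjoint.domain.subtype

/-- The deficiency index `d₊(T) = dim ker (T* - i)`. -/
def deficiencyPlus (T : H →ₗ.[ℂ] H) : Cardinal := Module.rank ℂ (defectSpace T Complex.I)

/-- The deficiency index `d₋(T) = dim ker (T* + i)`. -/
def deficiencyMinus (T : H →ₗ.[ℂ] H) : Cardinal := Module.rank ℂ (defectSpace T (-Complex.I))

/-- `T` is a time operator of the unitary operator `U`: it is symmetric and there is a subspace
`𝒟 ≠ {0}` contained in `D(TU) ∩ D(T)` on which `TU - UT = U`. -/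
def IsTimeOperator (U : H ≃ₗᵢ[ℂ] H) (T : H →ₗ.[ℂ] H) : Prop :=
  IsSymmetric T ∧ ∃ D : Submodule ℂ H, D ≠ ⊥ ∧
    ∀ x ∈ D, ∃ (hU : U x ∈ T.domain) (hx : x ∈ T.domain),
      T ⟨U x, hU⟩ - U (T ⟨x, hx⟩) = U x

/-- `T` is a strong time operator of the unitary operator `U`: it is symmetric and
`U* T U = T + 1` as an equality of operators (equality of domains included). -/
def IsStrongTimeOperator (U : H ≃ₗᵢ[ℂ] H) (T : H →ₗ.[ℂ] H) : Prop :=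
  IsSymmetric T ∧ unitaryConj U T = T + (LinearMap.id : H →ₗ[ℂ] H).toPMap ⊤

end Operators

/-! ### The Hilbert spaces and the quantum walk -/

/-- `ℂ²`. -/
abbrev C2 : Type := EuclideanSpace ℂ (Fin 2)

/-- `ℓ²(ℤ; ℂ²)`. -/
abbrev PosSpace : Type := lp (fun _ : ℤ => C2) 2

/-- The measure `dk / 2π` on `[0, 2π]`. -/
def μ : Measure ℝ :=
  ENNReal.ofReal (2 * Real.pi)⁻¹ • volume.restrict (Set.Icc 0 (2 * Real.pi))

/-- `L²([0, 2π], dk/2π)`. -/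
abbrev MomSpace1 : Type := Lp ℂ 2 μ

/-- `L²([0, 2π], dk/2π; ℂ²)`. -/
abbrev MomSpace : Type := Lp C2 2 μ

/-- The action of a unitary `2 × 2` matrix on `ℂ²`. -/
def matIso (M : Matrix.unitaryGroup (Fin 2) ℂ) : C2 ≃ₗᵢ[ℂ] C2 :=
  Unitary.linearIsometryEquiv
    ⟨Matrix.toEuclideanCLM (n := Fin 2) (𝕜 := ℂ) M, by
      rw [Unitary.mem_iff, ← map_star, ← map_mul, ← map_mul]
      simp [Unitary.mem_iff.mp M.2]⟩

theorem matIso_apply (M : Matrix.unitaryGroup (Fin 2) ℂ) (v : C2) (i : Fin 2) :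
    matIso M v i = ∑ j, (M : Matrix (Fin 2) (Fin 2) ℂ) i j * v j := by
  change (Matrix.toEuclideanCLM (n := Fin 2) (𝕜 := ℂ) (M : Matrix (Fin 2) (Fin 2) ℂ) v) i = _
  rw [Matrix.ofLp_toEuclideanCLM]
  rfl

theorem matIso_symm_apply (M : Matrix.unitaryGroup (Fin 2) ℂ) (v : C2) :
    (matIso M).symm v = matIso M⁻¹ v := by
  rw [LinearIsometryEquiv.symm_apply_eq]
  ext i
  simp only [matIso_apply, Finset.mul_sum, ← mul_assoc]
  rw [Finset.sum_comm]
  simp only [← Finset.sum_mul, ← Matrix.mul_apply]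
  have : (M : Matrix (Fin 2) (Fin 2) ℂ) * ((M⁻¹ : Matrix.unitaryGroup (Fin 2) ℂ) :
      Matrix (Fin 2) (Fin 2) ℂ) = 1 := by
    rw [← Submonoid.coe_mul, mul_inv_cancel, Submonoid.coe_one]
  rw [this]
  simp [Matrix.one_apply]

theorem memℓp_of_norm_eq {f g : ℤ → C2} (hf : Memℓp f 2) (h : ∀ x, ‖g x‖ = ‖f x‖) :
    Memℓp g 2 := by
  rw [memℓp_gen_iff (by norm_num)] at hf ⊢
  simpa only [h] using hf

/-- The coin operator on `ℓ²(ℤ; ℂ²)`: `(C ψ)(x) = C (ψ(x))`. -/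
def coin (C : Matrix.unitaryGroup (Fin 2) ℂ) : PosSpace ≃ₗᵢ[ℂ] PosSpace where
  toFun ψ := ⟨fun x => matIso C (ψ x), memℓp_of_norm_eq (lp.memℓp ψ) (fun x => by simp)⟩
  invFun ψ := ⟨fun x => (matIso C).symm (ψ x),
    memℓp_of_norm_eq (lp.memℓp ψ) (fun x => by simp)⟩
  map_add' ψ φ := by ext1; funext x; exact map_add (matIso C) _ _
  map_smul' c ψ := by ext1; funext x; exact map_smul (matIso C) _ _
  left_inv ψ := by ext1; funext x; exact (matIso C).symm_apply_apply _
  right_inv ψ := by ext1; funext x; exact (matIso C).apply_symm_apply _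
  norm_map' ψ := by
    have h : (0 : ℝ) < (2 : ℝ≥0∞).toReal := by norm_num
    rw [lp.norm_eq_tsum_rpow h, lp.norm_eq_tsum_rpow h]
    simp

theorem hasSum_shift (s : ℤ) (ψ : PosSpace) :
    HasSum (fun x => ‖(!₂[ψ (x + s) 0, ψ (x - s) 1] : C2)‖ ^ (2 : ℝ≥0∞).toReal)
      (‖ψ‖ ^ (2 : ℝ≥0∞).toReal) := by
  have h : (0 : ℝ) < (2 : ℝ≥0∞).toReal := by norm_num
  have hψ := lp.hasSum_norm h ψ
  have key : ∀ v : C2, ‖v‖ ^ (2 : ℝ≥0∞).toReal = ‖v 0‖ ^ 2 + ‖v 1‖ ^ 2 := by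
    intro v
    rw [ENNReal.toReal_ofNat, Real.rpow_ofNat, EuclideanSpace.norm_sq_eq, Fin.sum_univ_two]
  simp only [key] at hψ ⊢
  have h0 : Summable fun x => ‖ψ x 0‖ ^ 2 :=
    Summable.of_nonneg_of_le (fun _ => by positivity)
      (fun x => le_add_of_nonneg_right (by positivity)) hψ.summable
  have h1 : Summable fun x => ‖ψ x 1‖ ^ 2 :=
    Summable.of_nonneg_of_le (fun _ => by positivity)
      (fun x => le_add_of_nonneg_left (by positivity)) hψ.summable
  have e := hψ.unique (h0.hasSum.add h1.hasSum)
  rw [e]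
  exact ((Equiv.addRight s).hasSum_iff.2 h0.hasSum).add ((Equiv.subRight s).hasSum_iff.2 h1.hasSum)

/-- The shift operator on `ℓ²(ℤ; ℂ²)`: `(S ψ)(x) = (ψ₀(x + s), ψ₁(x - s))`; the walk uses
`s = 1`. -/
def shift (s : ℤ) : PosSpace ≃ₗᵢ[ℂ] PosSpace where
  toFun ψ := ⟨fun x => !₂[ψ (x + s) 0, ψ (x - s) 1],
    (memℓp_gen_iff (by norm_num)).2 (hasSum_shift s ψ).summable⟩
  invFun ψ := ⟨fun x => !₂[ψ (x + -s) 0, ψ (x - -s) 1],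
    (memℓp_gen_iff (by norm_num)).2 (hasSum_shift (-s) ψ).summable⟩
  map_add' ψ φ := by
    ext1; funext x
    change (!₂[(ψ (x + s) + φ (x + s)) 0, (ψ (x - s) + φ (x - s)) 1] : C2) =
      !₂[ψ (x + s) 0, ψ (x - s) 1] + !₂[φ (x + s) 0, φ (x - s) 1]
    ext i; fin_cases i <;> simp
  map_smul' c ψ := by
    ext1; funext x; ext i; fin_cases i <;> simp
  left_inv ψ := by
    ext1; funext x; ext i; fin_cases i <;> simp
  right_inv ψ := by
    ext1; funext x; ext i; fin_cases i <;> simp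
  norm_map' ψ := by
    have h : (0 : ℝ) < (2 : ℝ≥0∞).toReal := by norm_num
    refine (Real.rpow_left_inj (norm_nonneg _) (norm_nonneg _) h.ne').1 ?_
    rw [lp.norm_rpow_eq_tsum h]
    exact (hasSum_shift s ψ).tsum_eq

/-- The time evolution operator `U = S C`. -/
def evolution (C : Matrix.unitaryGroup (Fin 2) ℂ) : PosSpace ≃ₗᵢ[ℂ] PosSpace :=
  (coin C).trans (shift 1)

/-! ### The Fourier transform -/

instance : IsProbabilityMeasure μ := by
  constructor
  rw [μ, Measure.smul_apply, Measure.restrict_apply_univ, Real.volume_Icc, smul_eq_mul,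
    sub_zero, ← ENNReal.ofReal_mul (by positivity), inv_mul_cancel₀ (by positivity),
    ENNReal.ofReal_one]

theorem norm_wave (x : ℤ) (k : ℝ) : ‖Complex.exp (-Complex.I * x * k)‖ = 1 := by
  rw [Complex.norm_exp]; simp

theorem memLp_wave (x : ℤ) (v : C2) :
    MemLp (fun k : ℝ => Complex.exp (-Complex.I * x * k) • v) 2 μ := by
  refine MemLp.of_bound (Continuous.aestronglyMeasurable (by fun_prop)) ‖v‖ ?_
  exact Filter.Eventually.of_forall fun k => by rw [norm_smul, norm_wave, one_mul]

/-- The plane wave `k ↦ e^{-ixk} v`. -/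
def wave (x : ℤ) : C2 →ₗᵢ[ℂ] MomSpace where
  toFun v := (memLp_wave x v).toLp
  map_add' v w := by
    rw [← MemLp.toLp_add]
    exact MemLp.toLp_congr _ _ (Filter.Eventually.of_forall fun k => smul_add _ _ _)
  map_smul' c v := by
    rw [RingHom.id_apply, ← MemLp.toLp_const_smul]
    exact MemLp.toLp_congr _ _ (Filter.Eventually.of_forall fun k => smul_comm _ _ _)
  norm_map' v := by
    change ‖(memLp_wave x v).toLp‖ = ‖v‖
    rw [Lp.norm_toLp, eLpNorm_congr_norm_ae (g := fun _ => v)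
      (Filter.Eventually.of_forall fun k => by rw [norm_smul, norm_wave, one_mul]),
      eLpNorm_const _ (by norm_num) (IsProbabilityMeasure.ne_zero μ)]
    simp

theorem inner_wave (x : ℤ) (v : C2) (f : MomSpace) :
    inner ℂ (wave x v) f = ∫ k, Complex.exp (Complex.I * x * k) * inner ℂ v (f k) ∂μ := by
  rw [L2.inner_def]
  refine integral_congr_ae ?_
  filter_upwards [(memLp_wave x v).coeFn_toLp] with k hk
  change inner ℂ (((memLp_wave x v).toLp : MomSpace) k) (f k) = _
  rw [hk, inner_smul_left, ← Complex.exp_conj]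
  simp

theorem integral_μ (f : ℝ → ℂ) :
    ∫ k, f k ∂μ = ((2 * Real.pi)⁻¹ : ℝ) • ∫ k in 0..(2 * Real.pi), f k := by
  rw [μ, integral_smul_measure, ENNReal.toReal_ofReal (by positivity),
    intervalIntegral.integral_of_le (by positivity), integral_Icc_eq_integral_Ioc]

theorem orthogonalFamily_wave : OrthogonalFamily ℂ (fun _ : ℤ => C2) wave := by
  intro x y hxy v w
  rw [inner_wave]
  have : ∀ᵐ k : ℝ ∂μ, Complex.exp (Complex.I * x * k) * inner ℂ v (wave y w k) =
      inner ℂ v w * Complex.exp (Complex.I * ((x - y : ℤ) : ℂ) * k) := by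
    filter_upwards [(memLp_wave y w).coeFn_toLp] with k hk
    change _ * inner ℂ v (((memLp_wave y w).toLp : MomSpace) k) = _
    rw [hk, inner_smul_right, ← mul_assoc, ← Complex.exp_add, mul_comm]
    congr 2
    push_cast
    ring
  rw [integral_congr_ae this, integral_μ, intervalIntegral.integral_const_mul]
  have hne : Complex.I * ((x - y : ℤ) : ℂ) ≠ 0 :=
    mul_ne_zero Complex.I_ne_zero (Int.cast_ne_zero.2 (sub_ne_zero.2 hxy))
  rw [integral_exp_mul_complex hne]
  have h1 : Complex.exp (Complex.I * ((x - y : ℤ) : ℂ) * ((2 * Real.pi : ℝ) : ℂ)) = 1 := by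
    rw [Complex.exp_eq_one_iff]
    exact ⟨x - y, by push_cast; ring⟩
  rw [h1]
  simp

theorem ae_restrict_of_ae_μ {p : ℝ → Prop} :
    (∀ᵐ k ∂μ, p k) ↔ ∀ᵐ k ∂volume.restrict (Set.Icc 0 (2 * Real.pi)), p k := by
  rw [μ, Measure.ae_ennreal_smul_measure_iff]
  simp [Real.pi_pos]

theorem volume_restrict_eq :
    volume.restrict (Set.Ioc 0 (2 * Real.pi)) = ENNReal.ofReal (2 * Real.pi) • μ := by
  rw [μ, smul_smul, ← ENNReal.ofReal_mul (by positivity), mul_inv_cancel₀ (by positivity),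
    ENNReal.ofReal_one, one_smul, Measure.restrict_congr_set Ioc_ae_eq_Icc]

theorem isHilbertSum_wave : IsHilbertSum ℂ (fun _ : ℤ => C2) wave := by
  refine IsHilbertSum.mk orthogonalFamily_wave ?_
  rw [← Submodule.orthogonal_orthogonal_eq_closure, top_le_iff, Submodule.orthogonal_eq_top_iff,
    eq_bot_iff]
  intro f hf
  have h2π : (0 : ℝ) < 2 * Real.pi := by positivity
  have h0 : ∀ x v, inner ℂ (wave x v) f = 0 := fun x v =>
    (Submodule.mem_orthogonal _ _).1 hf _
      (Submodule.mem_iSup_of_mem x ⟨v, rfl⟩)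
  have hc : ∀ j : Fin 2, ∀ᵐ k ∂volume.restrict (Set.Ioc 0 (2 * Real.pi)), f k j = 0 := by
    intro j
    have hm : MemLp (fun k => f k j) 2 (volume.restrict (Set.Ioc 0 (2 * Real.pi))) := by
      rw [volume_restrict_eq]
      refine MemLp.smul_measure ?_ ENNReal.ofReal_ne_top
      have hp := (EuclideanSpace.proj j : C2 →L[ℂ] ℂ).comp_memLp' (Lp.memLp f)
      exact hp
    have hz : ∀ n : ℤ, fourierCoeffOn h2π (fun k => f k j) n = 0 := by
      intro n
      rw [fourierCoeffOn_eq_integral]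
      have h1 := h0 (-n) (EuclideanSpace.single j 1)
      rw [inner_wave, integral_μ, smul_eq_zero] at h1
      have h2 := h1.resolve_left (by positivity)
      have h3 : (∫ k in 0..(2 * Real.pi), _root_.fourier (-n) (k : AddCircle (2 * Real.pi - 0)) •
          f k j) = 0 := by
        rw [← h2]
        refine intervalIntegral.integral_congr fun k _ => ?_
        simp only [fourier_coe_apply, EuclideanSpace.inner_single_left, map_one, one_mul,
          smul_eq_mul]
        congr 2
        push_cast
        have : (Real.pi : ℂ) ≠ 0 := by exact_mod_cast Real.pi_ne_zero
        rw [sub_zero]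
        field_simp
      rw [h3, smul_zero]
    have hs := hasSum_sq_fourierCoeffOn h2π hm
    simp only [hz, norm_zero] at hs
    have e : (2 * Real.pi - 0)⁻¹ • ∫ k in 0..(2 * Real.pi), ‖f k j‖ ^ 2 = 0 :=
      hs.unique (by simp)
    rw [smul_eq_zero, intervalIntegral.integral_of_le h2π.le] at e
    have e' := e.resolve_left (by rw [sub_zero]; positivity)
    rw [integral_eq_zero_iff_of_nonneg (fun _ => by positivity)
      ((memLp_two_iff_integrable_sq_norm hm.1).1 hm)] at e'
    filter_upwards [e'] with k hk
    simpa using hk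
  rw [Submodule.mem_bot]
  refine Lp.ext ?_
  have hc' : ∀ j : Fin 2, ∀ᵐ k ∂μ, f k j = 0 := fun j => by
    rw [ae_restrict_of_ae_μ, ← Measure.restrict_congr_set Ioc_ae_eq_Icc]
    exact hc j
  filter_upwards [hc' 0, hc' 1, Lp.coeFn_zero C2 2 μ] with k hk₀ hk₁ hk₂
  rw [hk₂]
  ext j
  fin_cases j
  · exact hk₀
  · exact hk₁

/-- The Fourier transform, the unitary operator with
`(ℱ ψ)(k) = ∑ₓ e^{-ixk} ψ(x)` for `ψ` of finite support. -/
def fourier : PosSpace ≃ₗᵢ[ℂ] MomSpace :=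
  isHilbertSum_wave.linearIsometryEquiv.symm

/-! ### Operators in momentum space -/

/-- The graph of `P f = -i f'` on the absolutely continuous `2π`-periodic functions on `[0, 2π]`
with square integrable derivative: `(f, h)` belongs to it iff `f` has an absolutely continuous
representative `g` with `g(0) = g(2π)` and `g' = i h` almost everywhere. -/
def graphP : Submodule ℂ (MomSpace1 × MomSpace1) where
  carrier := {p | ∃ g : ℝ → ℂ, AbsolutelyContinuousOnInterval g 0 (2 * Real.pi) ∧
    g 0 = g (2 * Real.pi) ∧ p.1 =ᵐ[μ] g ∧
    ∀ᵐ k ∂μ, HasDerivAt g (Complex.I * p.2 k) k}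
  zero_mem' := by
    refine ⟨0, ?_, rfl, Lp.coeFn_zero ℂ 2 μ, ?_⟩
    · exact (contDiffOn_const (c := (0 : ℂ)) (n := 1) (𝕜 := ℝ)
        (s := Set.uIcc 0 (2 * Real.pi))).absolutelyContinuousOnInterval
    · filter_upwards [Lp.coeFn_zero ℂ 2 μ] with k hk
      change HasDerivAt _ (Complex.I * (0 : MomSpace1) k) k
      rw [hk, Pi.zero_apply, mul_zero]
      exact hasDerivAt_const k 0
  add_mem' := by
    rintro ⟨f₁, h₁⟩ ⟨f₂, h₂⟩ ⟨g₁, ha₁, hb₁, hc₁, hd₁⟩ ⟨g₂, ha₂, hb₂, hc₂, hd₂⟩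
    refine ⟨g₁ + g₂, ha₁.add ha₂, by simp [hb₁, hb₂],
      (Lp.coeFn_add f₁ f₂).trans (hc₁.add hc₂), ?_⟩
    filter_upwards [Lp.coeFn_add h₁ h₂, hd₁, hd₂] with k hk hk₁ hk₂
    change HasDerivAt _ (Complex.I * (h₁ + h₂ : MomSpace1) k) k
    rw [hk, Pi.add_apply, mul_add]
    exact hk₁.add hk₂
  smul_mem' := by
    rintro c ⟨f, h⟩ ⟨g, ha, hb, hc, hd⟩
    refine ⟨c • g, ha.const_smul c, by simp [hb],
      (Lp.coeFn_smul c f).trans (hc.const_smul c), ?_⟩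
    filter_upwards [Lp.coeFn_smul c h, hd] with k hk hk₁
    change HasDerivAt _ (Complex.I * (c • h : MomSpace1) k) k
    rw [hk, Pi.smul_apply, mul_smul_comm]
    exact hk₁.const_smul c

/-- The graph is that of an operator: its second components are determined by the first. -/
theorem graphP_single_valued : ∀ p ∈ graphP, p.1 = 0 → p.2 = 0 := by
  rintro ⟨f, h⟩ ⟨g, ha, -, hc, hd⟩ (rfl : f = 0)
  have h2π : (0 : ℝ) < 2 * Real.pi := by positivity
  have hg : g =ᵐ[volume.restrict (Set.Icc 0 (2 * Real.pi))] 0 :=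
    ae_restrict_of_ae_μ.1 (hc.symm.trans (Lp.coeFn_zero ℂ 2 μ))
  have hcont := ha.continuousOn
  rw [Set.uIcc_of_le h2π.le] at hcont
  have h0 := Measure.eqOn_Icc_of_ae_eq volume h2π.ne hg hcont continuousOn_const
  have hI : ∀ᵐ k ∂μ, k ∈ Set.Ioo 0 (2 * Real.pi) := by
    rw [ae_restrict_of_ae_μ, restrict_Ioo_eq_restrict_Icc.symm]
    exact ae_restrict_mem measurableSet_Ioo
  refine Lp.ext ?_
  filter_upwards [hI, hd, Lp.coeFn_zero ℂ 2 μ] with k hk hk₁ hk₂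
  have e : g =ᶠ[nhds k] fun _ => 0 :=
    Filter.eventually_of_mem (Icc_mem_nhds hk.1 hk.2) h0
  have := hk₁.unique ((hasDerivAt_const k (0 : ℂ)).congr_of_eventuallyEq e)
  rw [hk₂]
  simpa using this

/-- The self-adjoint operator `P f = -i f'` with periodic boundary condition on
`L²([0, 2π], dk/2π)`. -/
def opP : MomSpace1 →ₗ.[ℂ] MomSpace1 := graphP.toLinearPMap

/-- Multiplication by the function `φ` on its natural domain. -/
def mulOp (φ : ℝ → ℂ) : MomSpace1 →ₗ.[ℂ] MomSpace1 where
  domain :=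
    { carrier := {f | MemLp (fun k => φ k * f k) 2 μ}
      zero_mem' := by
        refine (MemLp.zero (ε := ℂ)).ae_eq ?_
        filter_upwards [Lp.coeFn_zero ℂ 2 μ] with k hk
        simp
      add_mem' := by
        intro f g hf hg
        refine (hf.add hg).ae_eq ?_
        filter_upwards [Lp.coeFn_add f g] with k hk
        simp only [hk, Pi.add_apply, mul_add]
      smul_mem' := by
        intro c f hf
        refine (hf.const_smul c).ae_eq ?_
        filter_upwards [Lp.coeFn_smul c f] with k hk
        simp [hk, mul_left_comm] }
  toFun :=
    { toFun := fun f => MemLp.toLp (fun k => φ k * f.1 k) f.2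
      map_add' := by
        rintro ⟨f, hf⟩ ⟨g, hg⟩
        rw [← MemLp.toLp_add]
        refine MemLp.toLp_congr _ _ ?_
        filter_upwards [Lp.coeFn_add f g] with k hk
        change φ k * (f + g : MomSpace1) k = φ k * f k + φ k * g k
        rw [hk, Pi.add_apply, mul_add]
      map_smul' := by
        rintro c ⟨f, hf⟩
        rw [RingHom.id_apply, ← MemLp.toLp_const_smul]
        refine MemLp.toLp_congr _ _ ?_
        filter_upwards [Lp.coeFn_smul c f] with k hk
        simp [hk, mul_left_comm] }

/-- `T̂ = (i/2) ((l/l') P + P (l/l'))` on its natural domain. -/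
def timeOp1 (l : ℝ → ℂ) : MomSpace1 →ₗ.[ℂ] MomSpace1 :=
  (Complex.I / 2) •
    (natComp (mulOp fun k => l k / deriv l k) opP + natComp opP (mulOp fun k => l k / deriv l k))

/-- The `j`-th component of an element of `L²([0, 2π], dk/2π; ℂ²)`. -/
def component (j : Fin 2) : MomSpace →L[ℂ] MomSpace1 :=
  (EuclideanSpace.proj j : C2 →L[ℂ] ℂ).compLpL 2 μ

/-- The inclusion of the `j`-th summand of `L² ⊕ L² = L²([0, 2π], dk/2π; ℂ²)`. -/
def inclusion (j : Fin 2) : MomSpace1 →L[ℂ] MomSpace :=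
  (ContinuousLinearMap.toSpanSingleton ℂ (EuclideanSpace.single j 1 : C2)).compLpL 2 μ

/-- The diagonal operator `A₀ ⊕ A₁` on `L² ⊕ L² = L²([0, 2π], dk/2π; ℂ²)`. -/
def diagOp (A : Fin 2 → MomSpace1 →ₗ.[ℂ] MomSpace1) : MomSpace →ₗ.[ℂ] MomSpace where
  domain := ⨅ j, (A j).domain.comap (component j).toLinearMap
  toFun :=
    { toFun := fun f =>
        ∑ j, inclusion j (A j ⟨component j f.1, (Submodule.mem_iInf _).1 f.2 j⟩)
      map_add' := by
        rintro ⟨f, hf⟩ ⟨g, hg⟩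
        rw [← Finset.sum_add_distrib]
        refine Finset.sum_congr rfl fun j _ => ?_
        rw [← map_add, ← LinearPMap.map_add]
        congr 2
        exact Subtype.ext (map_add (component j) f g)
      map_smul' := by
        rintro c ⟨f, hf⟩
        rw [RingHom.id_apply, Finset.smul_sum]
        refine Finset.sum_congr rfl fun j _ => ?_
        rw [← map_smul, ← LinearPMap.map_smul]
        congr 2
        exact Subtype.ext (map_smul (component j) c f) }

theorem aestronglyMeasurable_matIso {M : ℝ → Matrix.unitaryGroup (Fin 2) ℂ}
    (hM : ∀ i j, Measurable fun k => (M k : Matrix (Fin 2) (Fin 2) ℂ) i j)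
    {f : ℝ → C2} (hf : AEStronglyMeasurable f μ) :
    AEStronglyMeasurable (fun k => matIso (M k) (f k)) μ := by
  have hj : ∀ j, AEStronglyMeasurable (fun k => f k j) μ := fun j =>
    (EuclideanSpace.proj j : C2 →L[ℂ] ℂ).continuous.comp_aestronglyMeasurable hf
  have e : (fun k => matIso (M k) (f k)) = fun k =>
      ∑ i : Fin 2, (∑ j : Fin 2, (M k : Matrix (Fin 2) (Fin 2) ℂ) i j * f k j) •
        (EuclideanSpace.single i 1 : C2) := by
    funext k
    ext l
    rw [matIso_apply]
    fin_cases l <;> simp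
  rw [e]
  refine Finset.aestronglyMeasurable_fun_sum _ fun i _ => AEStronglyMeasurable.smul_const ?_ _
  exact Finset.aestronglyMeasurable_fun_sum _ fun j _ =>
    (hM i j).aestronglyMeasurable.mul (hj j)

theorem memLp_matIso {M : ℝ → Matrix.unitaryGroup (Fin 2) ℂ}
    (hM : ∀ i j, Measurable fun k => (M k : Matrix (Fin 2) (Fin 2) ℂ) i j) (f : MomSpace) :
    MemLp (fun k => matIso (M k) (f k)) 2 μ :=
  (memLp_congr_norm (aestronglyMeasurable_matIso hM (Lp.aestronglyMeasurable f))
    (Lp.aestronglyMeasurable f) (Filter.Eventually.of_forall fun k => by simp)).2 (Lp.memLp f)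

/-- Pointwise multiplication by a measurable field of unitary matrices, as an isometry. -/
def mulMatIsometry (M : ℝ → Matrix.unitaryGroup (Fin 2) ℂ)
    (hM : ∀ i j, Measurable fun k => (M k : Matrix (Fin 2) (Fin 2) ℂ) i j) :
    MomSpace →ₗᵢ[ℂ] MomSpace where
  toFun f := MemLp.toLp (fun k => matIso (M k) (f k)) (memLp_matIso hM f)
  map_add' f g := by
    rw [← MemLp.toLp_add]
    refine MemLp.toLp_congr _ _ ?_
    filter_upwards [Lp.coeFn_add f g] with k hk
    simp only [hk, Pi.add_apply, map_add]
  map_smul' c f := by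
    rw [RingHom.id_apply, ← MemLp.toLp_const_smul]
    refine MemLp.toLp_congr _ _ ?_
    filter_upwards [Lp.coeFn_smul c f] with k hk
    simp [hk]
  norm_map' f := by
    refine (Lp.norm_toLp _ (memLp_matIso hM f)).trans ?_
    rw [Lp.norm_def]
    congr 1
    exact eLpNorm_congr_norm_ae (Filter.Eventually.of_forall fun k => by simp)

/-- Pointwise multiplication by a measurable field of unitary matrices, `(M f)(k) = M(k) f(k)`,
as a unitary operator on `L²([0, 2π], dk/2π; ℂ²)`. -/
def mulMat (M : ℝ → Matrix.unitaryGroup (Fin 2) ℂ)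
    (hM : ∀ i j, Measurable fun k => (M k : Matrix (Fin 2) (Fin 2) ℂ) i j) :
    MomSpace ≃ₗᵢ[ℂ] MomSpace :=
  LinearIsometryEquiv.ofSurjective (mulMatIsometry M hM) (by
    have hM' : ∀ i j, Measurable fun k =>
        ((M k)⁻¹ : Matrix.unitaryGroup (Fin 2) ℂ).1 i j := fun i j =>
      Complex.continuous_conj.measurable.comp (hM j i)
    intro f
    refine ⟨(memLp_matIso hM' f).toLp, Lp.ext ?_⟩
    refine (MemLp.coeFn_toLp (memLp_matIso hM _)).trans ?_
    filter_upwards [(memLp_matIso hM' f).coeFn_toLp] with k hk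
    rw [hk, ← matIso_symm_apply, LinearIsometryEquiv.apply_symm_apply])

/-! ### Diagonalization and the strong time operator -/

/-- The matrix `Û(k)` with rows `(e^{ik} a, e^{ik} b)` and `(e^{-ik} c, e^{-ik} d)`. -/
def symbol (C : Matrix.unitaryGroup (Fin 2) ℂ) (k : ℝ) : Matrix (Fin 2) (Fin 2) ℂ :=
  Matrix.diagonal ![Complex.exp (Complex.I * k), Complex.exp (-Complex.I * k)] *
    (C : Matrix (Fin 2) (Fin 2) ℂ)

/-- A choice of the eigenvalues and normalized eigenvectors of `Û(k)`: analytic `2π`-periodic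
functions `λ₀, λ₁` and a Borel `2π`-periodic unitary matrix `W(k)`, whose columns are the
eigenvectors, with `W(k)⁻¹ Û(k) W(k) = diag(λ₀(k), λ₁(k))` for every real `k`. -/
structure Diagonalization (C : Matrix.unitaryGroup (Fin 2) ℂ) where
  eigenvalue : Fin 2 → ℝ → ℂ
  W : ℝ → Matrix.unitaryGroup (Fin 2) ℂ
  analytic : ∀ j, AnalyticOnNhd ℝ (eigenvalue j) Set.univ
  periodic : ∀ j, Function.Periodic (eigenvalue j) (2 * Real.pi)
  measurable : ∀ i j, Measurable fun k => (W k : Matrix (Fin 2) (Fin 2) ℂ) i j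
  periodic_W : Function.Periodic W (2 * Real.pi)
  diagonalizes : ∀ k, ((W k)⁻¹ : Matrix.unitaryGroup (Fin 2) ℂ) * symbol C k * (W k) =
    Matrix.diagonal fun j => eigenvalue j k

/-- The operator `T = ℱ⁻¹ W (T̂₀ ⊕ T̂₁) W⁻¹ ℱ`. -/
def timeOperator {C : Matrix.unitaryGroup (Fin 2) ℂ} (Δ : Diagonalization C) :
    PosSpace →ₗ.[ℂ] PosSpace :=
  unitaryConj (fourier.trans (mulMat Δ.W Δ.measurable).symm)
    (diagOp fun j => timeOp1 (Δ.eigenvalue j))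

end QuantumWalk

end

/-!
The symbol `Û(k)` of the walk has determinant `det C` and trace `2 m |a| cos (k + θ)`, where
`m ^ 2 = det C`.  Its eigenvalues are therefore unimodular functions `λ_j = m e^{i t_j}` with
`cos t_j = |a| cos (k + θ)`, and with the group velocity `ω = t_j'` one has `λ_j' = i ω λ_j`.
Hence `λ_j / λ_j' = -i / ω`, and the operator of the channel `j` is `T̂_j = (1/2) (ω⁻¹ P + P ω⁻¹)`
(`graph_timeOp1`): formally it is `-i d/dt` on half densities, `t = t_j(k)`.  The rule
`P (λ f) = λ P f + ω λ f` gives `T̂_j λ_j = λ_j T̂_j + λ_j`, with equality of domains because the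
same rule applies to `λ_j⁻¹`.  Since `W⁻¹ ℱ` turns the walk into multiplication by `λ_0`, `λ_1`,
this is the relation `U* T U = T + 1` (`isStrongTimeOperator_timeOperator`).

*Case `|a| < 1`.* The velocity `ω = ± |a| sin (k + θ) / (1 - |a|² cos² (k + θ))^{1/2}` has two
simple zeros on the circle and cuts it into two arcs.  A vector of `ker (T̂_j* - z)` solves a
first order linear differential equation on each arc, with solution `|ω|^{1/2} e^{izt}`.  The
solution is bounded, so it is square integrable, and it vanishes at the zeros of `ω`, so that
integration by parts against elements of the domain leaves no boundary term.  Thus the defect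
space of a channel has one dimension for each arc, for every complex `z` (`IsTwoArc.defectEquiv`),
and that of `T` has dimension four.  A nonzero defect vector at `conj z` is orthogonal to the
range of `T - z` and of its closure, whence the spectra; equal deficiency indices give
self-adjoint extensions by von Neumann's construction
(`QuantumWalk.exists_isSelfAdjoint_extension`).  The relation `T U - U T = U` persists on `D(T)`
for any extension.

No self-adjoint extension `S` is a strong time operator, because the points `± m` lie in a gap of
the spectrum of `U` (`not_isSelfAdjoint_of_gap`).  With `B = (U - m)⁻¹`, a self-adjoint `S`
satisfying `U* S U = S + 1` would have a domain invariant under `B` (`exists_mem_graph_of_gap`);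
the commutator of `S` with the Cayley transform `A = i (U + m) (U - m)⁻¹` of `U` is then definite,
and the expectation of the bounded operator `A` would grow linearly along the powers of the Cayley
transform of `S` (`cayley_expectation`).

*Case `|a| = 1`.* Then `λ_j = m e^{± i (k + θ)}`, analyticity excluding a change of sign where the
two curves cross.  The velocity is `± 1` and `T̂_j = ± P` is self-adjoint with the integers as its
spectrum.
-/

noncomputable section

namespace QuantumWalk

/-! ### Symmetric operators and their defect spaces -/

section Abstract

variable {H : Type*} [NormedAddCommGroup H] [InnerProductSpace ℂ H]

/-- A linear relation `G ⊆ H × H` that is symmetric: for `(x, y), (x', y') ∈ G` one has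
`⟪y, x'⟫ = ⟪x, y'⟫`. -/
def IsSymmRel (G : Submodule ℂ (H × H)) : Prop :=
  ∀ p ∈ G, ∀ q ∈ G, inner ℂ p.2 q.1 = inner ℂ p.1 q.2

/-- The defect space of a linear relation `G`, the vectors `v` with `(v, z v) ∈ G*`; this is
`ker (T* - z)` when `G` is the graph of a densely defined operator `T`. -/
def defectRel (G : Submodule ℂ (H × H)) (z : ℂ) : Submodule ℂ H where
  carrier := {v | ∀ p ∈ G, inner ℂ v p.2 = inner ℂ (z • v) p.1}
  zero_mem' p _ := by simp
  add_mem' {v w} hv hw p hp := by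
    rw [inner_add_left, hv p hp, hw p hp, smul_add, inner_add_left]
  smul_mem' c v hv p hp := by
    rw [inner_smul_left, hv p hp, smul_comm, inner_smul_left _ _ c]

theorem mem_defectRel {G : Submodule ℂ (H × H)} {z : ℂ} {v : H} :
    v ∈ defectRel G z ↔ ∀ p ∈ G, inner ℂ v p.2 = inner ℂ (z • v) p.1 := Iff.rfl

theorem defectRel_topologicalClosure (G : Submodule ℂ (H × H)) (z : ℂ) :
    defectRel G.topologicalClosure z = defectRel G z := by
  ext v
  refine ⟨fun h p hp => h p (G.le_topologicalClosure hp), fun h p hp => ?_⟩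
  have hc : IsClosed {p : H × H | inner ℂ v p.2 = inner ℂ (z • v) p.1} :=
    isClosed_eq (by fun_prop) (by fun_prop)
  exact closure_minimal h hc hp

theorem IsSymmRel.topologicalClosure {G : Submodule ℂ (H × H)} (hG : IsSymmRel G) :
    IsSymmRel G.topologicalClosure := by
  have h1 : ∀ p ∈ G, ∀ q ∈ G.topologicalClosure, inner ℂ p.2 q.1 = inner ℂ p.1 q.2 := by
    intro p hp q hq
    have hc : IsClosed {q : H × H | inner ℂ p.2 q.1 = inner ℂ p.1 q.2} :=
      isClosed_eq (by fun_prop) (by fun_prop)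
    exact closure_minimal (fun q hq => hG p hp q hq) hc hq
  intro p hp q hq
  have hc : IsClosed {p : H × H | inner ℂ p.2 q.1 = inner ℂ p.1 q.2} :=
    isClosed_eq (by fun_prop) (by fun_prop)
  exact closure_minimal (fun p hp => h1 p hp q hq) hc hp

/-- For a symmetric relation `‖y - iτ x‖² = ‖y‖² + τ² ‖x‖²`. -/
theorem IsSymmRel.norm_sub_sq {G : Submodule ℂ (H × H)} (hG : IsSymmRel G) (τ : ℝ)
    {p : H × H} (hp : p ∈ G) :
    ‖p.2 - ((τ : ℂ) * Complex.I) • p.1‖ ^ 2 = ‖p.2‖ ^ 2 + τ ^ 2 * ‖p.1‖ ^ 2 := by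
  have h := hG p hp p hp
  have him : (inner ℂ p.2 p.1).im = 0 := by
    rw [← inner_conj_symm p.1 p.2] at h
    have := congrArg Complex.im h
    rw [Complex.conj_im] at this
    linarith
  rw [_root_.norm_sub_sq (𝕜 := ℂ), inner_smul_right, norm_smul]
  simp [him, mul_pow]

/-- A nonzero element of the defect space at `conj z` is orthogonal to the range of `T - z`. -/
theorem mem_spectrum_of_defectRel_ne_bot {T : H →ₗ.[ℂ] H} {z : ℂ}
    (h : defectRel T.graph (starRingEnd ℂ z) ≠ ⊥) : z ∈ spectrum T := by
  rintro ⟨R, hR, -⟩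
  obtain ⟨v, hv, hv0⟩ := Submodule.exists_mem_ne_zero_of_ne_bot h
  obtain ⟨h1, h2⟩ := hR v
  have h3 := hv _ (T.mem_graph ⟨R v, h1⟩)
  rw [inner_smul_left, Complex.conj_conj] at h3
  have h4 : inner ℂ v v = (0 : ℂ) := by
    refine (congrArg (inner ℂ v) h2).symm.trans ?_
    rw [inner_sub_right, inner_smul_right]
    exact sub_eq_zero.2 h3
  exact hv0 (inner_self_eq_zero.1 h4)

variable [CompleteSpace H]

theorem mem_defectSpace_iff {T : H →ₗ.[ℂ] H} (hT : Dense (T.domain : Set H)) {z : ℂ} {v : H} :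
    v ∈ defectSpace T z ↔ v ∈ defectRel T.graph z := by
  have key : v ∈ defectRel T.graph z ↔ (v, z • v) ∈ T.adjoint.graph := by
    rw [LinearPMap.adjoint_graph_eq_graph_adjoint hT, Submodule.mem_adjoint_iff, mem_defectRel]
    simp only [Prod.forall, sub_eq_zero]
    refine forall_congr' fun a => forall_congr' fun b => imp_congr_right fun _ => ?_
    rw [← inner_conj_symm, ← inner_conj_symm (z • v), (starRingEnd ℂ).injective.eq_iff]
  rw [key, defectSpace, LinearPMap.mem_graph_iff]
  simp only [Submodule.mem_map, LinearMap.mem_ker]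
  constructor
  · rintro ⟨y, hy, rfl⟩
    exact ⟨y, rfl, sub_eq_zero.1 hy⟩
  · rintro ⟨y, hy, hy'⟩
    refine ⟨y, ?_, hy⟩
    simp only [LinearMap.sub_apply, LinearMap.smul_apply, Submodule.subtype_apply, hy]
    exact sub_eq_zero.2 hy'

theorem isSymmetric_of_isSymmRel {T : H →ₗ.[ℂ] H} (hT : Dense (T.domain : Set H))
    (h : IsSymmRel T.graph) : IsSymmetric T := by
  refine ⟨hT, LinearPMap.IsFormalAdjoint.le_adjoint hT fun x y => ?_⟩
  exact h _ (T.mem_graph x) _ (T.mem_graph y)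

theorem _root_.IsSelfAdjoint.isSymmRel {T : H →ₗ.[ℂ] H} (hT : IsSelfAdjoint T) :
    IsSymmRel T.graph := by
  intro p hp q hq
  have hp' : p ∈ T.adjoint.graph := by rwa [LinearPMap.isSelfAdjoint_def.1 hT]
  rw [LinearPMap.adjoint_graph_eq_graph_adjoint hT.dense_domain, Submodule.mem_adjoint_iff] at hp'
  have := sub_eq_zero.1 (hp' q.1 q.2 hq)
  rw [← inner_conj_symm, ← this, inner_conj_symm]

/-- A closed symmetric relation `G`: the sum of the range of `G - iτ` and its orthogonal complement,
a defect space, is everything, because that range is closed. -/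
theorem IsSymmRel.exists_add_defectRel {G : Submodule ℂ (H × H)} (hG : IsSymmRel G)
    (hc : IsClosed (G : Set (H × H))) {τ : ℝ} (hτ : τ ≠ 0) (y : H) :
    ∃ p ∈ G, ∃ v ∈ defectRel G (-((τ : ℂ) * Complex.I)),
      y = p.2 - ((τ : ℂ) * Complex.I) • p.1 + v := by
  set A : G →L[ℂ] H := (ContinuousLinearMap.snd ℂ H H -
    ((τ : ℂ) * Complex.I) • ContinuousLinearMap.fst ℂ H H).comp G.subtypeL with hA
  have hAp : ∀ p : G, A p = p.1.2 - ((τ : ℂ) * Complex.I) • p.1.1 := fun p => rfl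
  have : CompleteSpace G := hc.completeSpace_coe
  have hanti : AntilipschitzWith (max 1 |τ|⁻¹).toNNReal A := by
    refine ContinuousLinearMap.antilipschitz_of_bound A fun p => ?_
    have h := hG.norm_sub_sq τ p.2
    rw [← hAp] at h
    rw [Real.coe_toNNReal _ (by positivity)]
    have h2 : ‖p.1.2‖ ≤ ‖A p‖ := by
      refine abs_le_of_sq_le_sq' ?_ (norm_nonneg _) |>.2
      nlinarith [sq_nonneg (τ * ‖p.1.1‖)]
    have h1 : |τ| * ‖p.1.1‖ ≤ ‖A p‖ := by
      refine abs_le_of_sq_le_sq' ?_ (norm_nonneg _) |>.2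
      rw [mul_pow, sq_abs]
      nlinarith [sq_nonneg (‖p.1.2‖)]
    change max ‖p.1.1‖ ‖p.1.2‖ ≤ _
    refine max_le ?_ ?_
    · calc ‖p.1.1‖ = |τ|⁻¹ * (|τ| * ‖p.1.1‖) := by
            rw [inv_mul_cancel_left₀ (abs_ne_zero.2 hτ)]
        _ ≤ |τ|⁻¹ * ‖A p‖ := by gcongr
        _ ≤ _ := by gcongr; exact le_max_right _ _
    · calc ‖p.1.2‖ ≤ 1 * ‖A p‖ := by simpa using h2
        _ ≤ _ := by gcongr; exact le_max_left _ _
  have hcl : IsClosed (Set.range A) := hanti.isClosed_range A.uniformContinuous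
  have hcl' : IsClosed ((LinearMap.range A.toLinearMap : Submodule ℂ H) : Set H) := hcl
  have : CompleteSpace (LinearMap.range A.toLinearMap) := hcl'.completeSpace_coe
  obtain ⟨u, ⟨p, rfl⟩, v, hv, rfl⟩ :=
    (LinearMap.range A.toLinearMap).exists_add_mem_mem_orthogonal y
  refine ⟨p.1, p.2, v, fun q hq => ?_, rfl⟩
  have h := (Submodule.mem_orthogonal' _ _).1 hv (A ⟨q, hq⟩) ⟨⟨q, hq⟩, rfl⟩
  rw [hAp, inner_sub_right, inner_smul_right, sub_eq_zero] at h
  rw [h, inner_smul_left]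
  simp

/-- A symmetric operator `T` such that `T - i` and `T + i` are onto is self-adjoint. -/
theorem isSelfAdjoint_of_surjective {T : H →ₗ.[ℂ] H} (hs : IsSymmRel T.graph)
    (hp : ∀ y, ∃ p ∈ T.graph, p.2 - Complex.I • p.1 = y)
    (hm : ∀ y, ∃ p ∈ T.graph, p.2 + Complex.I • p.1 = y) : IsSelfAdjoint T := by
  have hd : Dense (T.domain : Set H) := by
    rw [Submodule.dense_iff_topologicalClosure_eq_top, Submodule.topologicalClosure_eq_top_iff,
      Submodule.eq_bot_iff]
    intro v hv
    obtain ⟨p, hp, rfl⟩ := hp v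
    have h0 := (Submodule.mem_orthogonal _ _).1 hv p.1 (LinearPMap.mem_domain_of_mem_graph hp)
    have h1 := hs.norm_sub_sq 1 hp
    have h2 := hs p hp p hp
    have him : (inner ℂ p.1 p.2).im = 0 := by
      rw [← inner_conj_symm p.2 p.1] at h2
      have := congrArg Complex.im h2
      rw [Complex.conj_im] at this
      linarith
    rw [inner_sub_right, inner_smul_right, inner_self_eq_norm_sq_to_K] at h0
    have h3 := congrArg Complex.im h0
    simp only [Complex.sub_im, him, Complex.mul_im, Complex.I_re, Complex.I_im] at h3
    have h4 : p.1 = 0 := by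
      rw [← norm_eq_zero, ← sq_eq_zero_iff]
      have h6 : (((‖p.1‖ : ℝ) : ℂ) ^ 2).re = ‖p.1‖ ^ 2 := by
        rw [← Complex.ofReal_pow, Complex.ofReal_re]
      rw [← h6]
      simpa using h3
    have h5 : p.2 = 0 := T.graph_fst_eq_zero_snd (x := p.1) hp h4
    rw [h4, h5]
    simp
  rw [LinearPMap.isSelfAdjoint_def]
  refine LinearPMap.eq_of_eq_graph ?_
  rw [LinearPMap.adjoint_graph_eq_graph_adjoint hd]
  refine le_antisymm (fun x hx => ?_) (fun x hx => ?_)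
  · obtain ⟨p, hpm, hpe⟩ := hp (x.2 - Complex.I • x.1)
    have hpa : p ∈ T.graph.adjoint := by
      rw [Submodule.mem_adjoint_iff]
      exact fun a b hab => sub_eq_zero.2 (hs _ hab _ hpm)
    have hd := Submodule.sub_mem _ hx hpa
    have hu : x.2 - p.2 = Complex.I • (x.1 - p.1) := by
      rw [smul_sub]
      have : x.2 - p.2 = (x.2 - Complex.I • x.1) - (p.2 - Complex.I • p.1) +
          (Complex.I • x.1 - Complex.I • p.1) := by abel
      rw [this, hpe, sub_self, zero_add]
    obtain ⟨q, hqm, hqe⟩ := hm (x.1 - p.1)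
    have h1 := (Submodule.mem_adjoint_iff _ _).1 hd q.1 q.2 hqm
    rw [Prod.fst_sub, Prod.snd_sub, hu, inner_smul_right, sub_eq_zero] at h1
    have h2 : inner ℂ (x.1 - p.1) (x.1 - p.1) = (0 : ℂ) := by
      refine (congrArg (fun w => inner ℂ w (x.1 - p.1)) hqe).symm.trans ?_
      rw [inner_add_left, inner_smul_left, h1]
      simp
    have h3 := inner_self_eq_zero.1 h2
    have h4 : x = p := by
      refine Prod.ext (sub_eq_zero.1 h3) (sub_eq_zero.1 ?_)
      rw [hu, h3, smul_zero]
    rwa [h4]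
  · rw [Submodule.mem_adjoint_iff]
    exact fun a b hab => sub_eq_zero.2 (hs _ hab _ hx)

/-- The range of `T - iτ` is everything since the defect space at `-iτ` consists of eigenvectors of
`T` for a nonreal eigenvalue. -/
theorem _root_.IsSelfAdjoint.surjective_sub {T : H →ₗ.[ℂ] H} (hT : IsSelfAdjoint T) {τ : ℝ}
    (hτ : τ ≠ 0) (y : H) : ∃ p ∈ T.graph, p.2 - ((τ : ℂ) * Complex.I) • p.1 = y := by
  have hs := hT.isSymmRel
  obtain ⟨p, hp, v, hv, rfl⟩ := hs.exists_add_defectRel hT.isClosed hτ y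
  have hvg : (v, -((τ : ℂ) * Complex.I) • v) ∈ T.graph := by
    rw [← LinearPMap.isSelfAdjoint_def.1 hT,
      LinearPMap.adjoint_graph_eq_graph_adjoint hT.dense_domain, Submodule.mem_adjoint_iff]
    intro a b hab
    have := hv _ hab
    rw [← inner_conj_symm, this, inner_conj_symm, sub_self]
  have h1 := hs.norm_sub_sq (-τ) hvg
  have h0 : v = 0 := by
    rw [← norm_eq_zero, ← sq_eq_zero_iff]
    simp only [neg_smul, Complex.ofReal_neg, neg_mul, norm_neg, norm_smul, norm_mul,
      Complex.norm_real, Complex.norm_I, sub_self, norm_zero] at h1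
    have : 0 < τ ^ 2 := by positivity
    rw [mul_one, mul_pow, Real.norm_eq_abs, sq_abs] at h1
    nlinarith [sq_nonneg ‖v‖]
  exact ⟨p, hp, by rw [h0, add_zero]⟩

/-- For a self-adjoint `T`, surjectivity of `T - z` is enough for `z` to be in the resolvent set:
injectivity follows since `ker (T - z)` is zero or orthogonal to the range, and boundedness of the
inverse is the closed graph theorem. -/
theorem _root_.IsSelfAdjoint.mem_resolventSet {T : H →ₗ.[ℂ] H} (hT : IsSelfAdjoint T) {z : ℂ}
    (h : ∀ y, ∃ p ∈ T.graph, p.2 - z • p.1 = y) : z ∈ resolventSet T := by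
  have hs := hT.isSymmRel
  have hinj : ∀ x, (x, z • x) ∈ T.graph → x = 0 := by
    intro x hx
    have h1 := hs _ hx _ hx
    simp only [inner_smul_left, inner_smul_right] at h1
    rw [← sub_eq_zero, ← sub_mul, mul_eq_zero] at h1
    rcases h1 with h1 | h1
    · obtain ⟨p, hp, hpe⟩ := h x
      have h2 := hs _ hx _ hp
      simp only [inner_smul_left] at h2
      rw [sub_eq_zero.1 h1] at h2
      rw [← inner_self_eq_zero (𝕜 := ℂ)]
      refine (congrArg (inner ℂ x) hpe).symm.trans ?_
      rw [inner_sub_right, inner_smul_right, h2, sub_self]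
    · exact inner_self_eq_zero.1 h1
  choose p hpm hpe using h
  have huniq : ∀ q ∈ T.graph, p (q.2 - z • q.1) = q := by
    intro q hq
    set r := p (q.2 - z • q.1) with hr
    have h1 := Submodule.sub_mem _ (hpm (q.2 - z • q.1)) hq
    rw [← hr] at h1
    have h2 : r.2 - z • r.1 = q.2 - z • q.1 := hpe _
    have h3 : r.2 - q.2 = z • (r.1 - q.1) := by
      rw [smul_sub]
      exact sub_eq_sub_iff_sub_eq_sub.1 h2
    have h4 : r.1 - q.1 = 0 := hinj _ (by rw [← h3]; exact h1)
    refine Prod.ext (sub_eq_zero.1 h4) (sub_eq_zero.1 ?_)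
    rw [h3, h4, smul_zero]
  let R : H →ₗ[ℂ] H :=
    { toFun := fun y => (p y).1
      map_add' := fun y y' => by
        have := huniq _ (Submodule.add_mem _ (hpm y) (hpm y'))
        have e : (p y + p y').2 - z • (p y + p y').1 = y + y' := by
          conv_rhs => rw [← hpe y, ← hpe y']
          rw [Prod.fst_add, Prod.snd_add, smul_add]
          abel
        rw [e] at this
        rw [this, Prod.fst_add]
      map_smul' := fun c y => by
        have := huniq _ (Submodule.smul_mem _ c (hpm y))
        have e : (c • p y).2 - z • (c • p y).1 = c • y := by
          conv_rhs => rw [← hpe y]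
          rw [Prod.smul_fst, Prod.smul_snd, smul_sub, smul_comm]
        rw [e] at this
        rw [this, Prod.smul_fst, RingHom.id_apply] }
  have hR : ∀ x y, (x, y) ∈ R.graph ↔ (y, x + z • y) ∈ T.graph := by
    intro x y
    rw [LinearMap.mem_graph_iff]
    constructor
    · rintro (rfl : y = (p x).1)
      have : x + z • (p x).1 = (p x).2 := by
        exact (sub_eq_iff_eq_add.1 (hpe x)).symm
      rw [this]
      exact hpm x
    · intro h
      have := huniq _ h
      simp only [add_sub_cancel_right] at this
      change y = (p x).1
      rw [this]
  have hcl : IsClosed (R.graph : Set (H × H)) := by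
    have : (R.graph : Set (H × H)) = (fun q : H × H => (q.2, q.1 + z • q.2)) ⁻¹' T.graph := by
      ext ⟨x, y⟩
      exact hR x y
    rw [this]
    exact hT.isClosed.preimage (by fun_prop)
  refine ⟨⟨R, R.continuous_of_isClosed_graph hcl⟩, fun y => ?_, fun x => ?_⟩
  · have h1 : (p y).1 ∈ T.domain := LinearPMap.mem_domain_of_mem_graph (hpm y)
    refine ⟨h1, ?_⟩
    have h2 : T ⟨(p y).1, h1⟩ = (p y).2 := ((LinearPMap.image_iff h1).2 (hpm y)).symm
    change T ⟨(p y).1, h1⟩ - z • (p y).1 = y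
    rw [h2, hpe]
  · exact congrArg Prod.fst (huniq _ (T.mem_graph x))

end Abstract

/-! ### Self-adjoint extensions -/

section Extensions

variable {H : Type*} [NormedAddCommGroup H] [InnerProductSpace ℂ H]

theorem IsSymmRel.sup {G N : Submodule ℂ (H × H)} (hG : IsSymmRel G) (hN : IsSymmRel N)
    (hGN : ∀ p ∈ G, ∀ q ∈ N, inner ℂ p.2 q.1 = inner ℂ p.1 q.2) : IsSymmRel (G ⊔ N) := by
  have hNG : ∀ p ∈ N, ∀ q ∈ G, inner ℂ p.2 q.1 = inner ℂ p.1 q.2 := fun p hp q hq => by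
    rw [← inner_conj_symm, ← hGN q hq p hp, inner_conj_symm]
  intro p hp q hq
  obtain ⟨a, ha, b, hb, rfl⟩ := Submodule.mem_sup.1 hp
  obtain ⟨c, hc, d, hd, rfl⟩ := Submodule.mem_sup.1 hq
  simp only [Prod.fst_add, Prod.snd_add, inner_add_left, inner_add_right]
  rw [hG a ha c hc, hNG b hb c hc, hGN a ha d hd, hN b hb d hd]

/-- A symmetric relation has no eigenvectors for the nonreal eigenvalue `iτ`. -/
theorem IsSymmRel.eq_zero_of_mem {G : Submodule ℂ (H × H)} (hG : IsSymmRel G) {τ : ℝ}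
    (hτ : τ ≠ 0) {x : H} (hx : (x, ((τ : ℂ) * Complex.I) • x) ∈ G) : x = 0 := by
  have h := hG.norm_sub_sq τ hx
  simp only [sub_self, norm_zero] at h
  have : 0 < τ ^ 2 := by positivity
  rw [← norm_eq_zero, ← sq_eq_zero_iff]
  nlinarith [sq_nonneg ‖x‖, sq_nonneg ‖((τ : ℂ) * Complex.I) • x‖]

/-- Von Neumann's extension: a unitary map `e` between the defect spaces of `T` at `i` and at `-i`
gives the self-adjoint extension whose graph is spanned by the closure of the graph of `T` and the
pairs `(x + e x, i x - i e x)`. -/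
theorem exists_isSelfAdjoint_extension [CompleteSpace H] {T : H →ₗ.[ℂ] H}
    (hT : Dense (T.domain : Set H)) (hs : IsSymmRel T.graph)
    (e : defectRel T.graph Complex.I ≃ₗᵢ[ℂ] defectRel T.graph (-Complex.I)) :
    ∃ T' : H →ₗ.[ℂ] H, T ≤ T' ∧ IsSelfAdjoint T' := by
  set G := T.graph.topologicalClosure with hG
  have hGs : IsSymmRel G := hs.topologicalClosure
  have hGc : IsClosed (G : Set (H × H)) := Submodule.isClosed_topologicalClosure _
  set K := defectRel T.graph Complex.I with hK
  let x₁ : K →ₗ[ℂ] H := K.subtype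
  let x₂ : K →ₗ[ℂ] H := (defectRel T.graph (-Complex.I)).subtype.comp e.toLinearEquiv.toLinearMap
  let n : K →ₗ[ℂ] H × H :=
    (x₁ + x₂).prod (Complex.I • x₁ - Complex.I • x₂)
  have hn : ∀ x, n x = ((x : H) + (e x : H), Complex.I • (x : H) - Complex.I • (e x : H)) :=
    fun x => rfl
  have hmem : ∀ z, ∀ p ∈ G, ∀ v ∈ defectRel T.graph z, inner ℂ p.2 v = inner ℂ p.1 (z • v) := by
    intro z p hp v hv
    rw [← defectRel_topologicalClosure] at hv
    rw [← inner_conj_symm, hv p hp, inner_conj_symm]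
  have hNs : IsSymmRel (LinearMap.range n) := by
    rintro _ ⟨x, rfl⟩ _ ⟨y, rfl⟩
    have hxy : inner ℂ (e x : H) (e y : H) = inner ℂ (x : H) (y : H) := by
      rw [← Submodule.coe_inner, e.inner_map_map, Submodule.coe_inner]
    simp only [hn, inner_sub_left, inner_sub_right, inner_add_left, inner_add_right,
      inner_smul_left, inner_smul_right, Complex.conj_I, hxy]
    ring
  have hGN : ∀ p ∈ G, ∀ q ∈ LinearMap.range n, inner ℂ p.2 q.1 = inner ℂ p.1 q.2 := by
    rintro p hp _ ⟨x, rfl⟩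
    rw [hn, inner_add_right, inner_sub_right, hmem _ p hp _ x.2, hmem _ p hp _ (e x).2, neg_smul,
      inner_neg_right, sub_eq_add_neg]
  set G' := G ⊔ LinearMap.range n with hG'
  have hGs' : IsSymmRel G' := hGs.sup hNs hGN
  have hTG : T.graph ≤ G' := T.graph.le_topologicalClosure.trans le_sup_left
  have hsv : ∀ p ∈ G', p.1 = 0 → p.2 = 0 := by
    intro p hp h0
    refine hT.eq_zero_of_inner_left ℂ fun q hq => ?_
    rw [hGs' p hp _ (hTG (T.mem_graph ⟨q, hq⟩)), h0, inner_zero_left]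
  have hgr : G'.toLinearPMap.graph = G' := Submodule.toLinearPMap_graph_eq _ hsv
  refine ⟨G'.toLinearPMap, LinearPMap.le_of_le_graph (by rwa [hgr]), ?_⟩
  refine isSelfAdjoint_of_surjective (by rwa [hgr]) (fun y => ?_) (fun y => ?_)
  · obtain ⟨p, hp, v, hv, rfl⟩ := hGs.exists_add_defectRel hGc one_ne_zero y
    rw [defectRel_topologicalClosure, Complex.ofReal_one, one_mul] at hv
    set x : K := e.symm ((-2 * Complex.I)⁻¹ • ⟨v, hv⟩) with hx
    refine ⟨p + n x, ?_, ?_⟩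
    · rw [hgr]
      exact Submodule.add_mem_sup hp ⟨x, rfl⟩
    · have hex : (e x : H) = (-2 * Complex.I)⁻¹ • v := by
        rw [hx, LinearIsometryEquiv.apply_symm_apply]
        rfl
      have hv' : v = (-2 * Complex.I) • (e x : H) := by
        rw [hex, smul_smul, mul_inv_cancel₀ (by simp), one_smul]
      rw [hn, Prod.fst_add, Prod.snd_add, hv']
      module
  · obtain ⟨p, hp, v, hv, rfl⟩ := hGs.exists_add_defectRel hGc (neg_ne_zero.2 one_ne_zero) y
    rw [defectRel_topologicalClosure, Complex.ofReal_neg, Complex.ofReal_one, neg_mul, one_mul,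
      neg_neg] at hv
    set x : K := (2 * Complex.I)⁻¹ • ⟨v, hv⟩ with hx
    refine ⟨p + n x, ?_, ?_⟩
    · rw [hgr]
      exact Submodule.add_mem_sup hp ⟨x, rfl⟩
    · have hv' : v = (2 * Complex.I) • (x : H) := by
        change v = (2 * Complex.I) • ((2 * Complex.I)⁻¹ • v)
        rw [smul_smul, mul_inv_cancel₀ (by simp), one_smul]
      rw [hn, Prod.fst_add, Prod.snd_add, hv']
      push_cast
      module

/-! ### A spectral gap of `U` excludes self-adjoint strong time operators -/

theorem _root_.IsSelfAdjoint.exists_resolvent [CompleteSpace H] {T : H →ₗ.[ℂ] H}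
    (hT : IsSelfAdjoint T) {τ : ℝ} (hτ : τ ≠ 0) : ∃ R : H →L[ℂ] H,
      ∀ y, (R y, y + ((τ : ℂ) * Complex.I) • R y) ∈ T.graph := by
  obtain ⟨R, h1, -⟩ := hT.mem_resolventSet (hT.surjective_sub hτ)
  refine ⟨R, fun y => ?_⟩
  obtain ⟨h, hy⟩ := h1 y
  exact (LinearPMap.image_iff h).1 (sub_eq_iff_eq_add.1 hy).symm

/-- If `U* T U` extends `T + 1`, then the domain of the self-adjoint operator `T` is invariant
under the bounded inverse `B` of `U - μ₀`.  For `z` far from the real axis, `w = B y` solves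
`w = (T - z)⁻¹ (B (T - z) y - B U w)`, and this fixed point equation has a solution in `D(T)`. -/
theorem exists_mem_graph_of_gap [CompleteSpace H] {U : H ≃ₗᵢ[ℂ] H} {T : H →ₗ.[ℂ] H}
    (hT : IsSelfAdjoint T) {μ₀ : ℂ} (B : H →L[ℂ] H) (hB : ∀ x, U (B x) - μ₀ • B x = x)
    (hU : ∀ p ∈ T.graph, (U p.1, U p.2 + U p.1) ∈ T.graph) {p : H × H} (hp : p ∈ T.graph) :
    ∃ q ∈ T.graph, U q.1 - μ₀ • q.1 = p.1 ∧ p.2 = U q.2 + U q.1 - μ₀ • q.2 := by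
  -- at distance `‖B‖ + 1` from the real axis the map `w ↦ (T - z)⁻¹ B U w` is a contraction
  have hτ : ‖B‖ + 1 ≠ 0 := by positivity
  obtain ⟨R, hR1⟩ := hT.exists_resolvent hτ
  set z : ℂ := ((‖B‖ + 1 : ℝ) : ℂ) * Complex.I with hz
  have hs := hT.isSymmRel
  have hRn : ∀ y, (‖B‖ + 1) * ‖R y‖ ≤ ‖y‖ := fun y => by
    have h := hs.norm_sub_sq (‖B‖ + 1) (hR1 y)
    rw [add_sub_cancel_right] at h
    refine abs_le_of_sq_le_sq' ?_ (norm_nonneg _) |>.2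
    rw [mul_pow]
    linarith [sq_nonneg ‖y + ((‖B‖ + 1 : ℝ) * Complex.I) • R y‖]
  let Uc : H →L[ℂ] H := U.toContinuousLinearEquiv.toContinuousLinearMap
  have hUc : ∀ x, Uc x = U x := fun x => rfl
  set L : H →L[ℂ] H := -(R ∘L B ∘L Uc) with hL
  have hLn : ‖L‖ < 1 := by
    have h1 : ‖L‖ ≤ ‖B‖ / (‖B‖ + 1) := by
      refine ContinuousLinearMap.opNorm_le_bound _ (by positivity) fun x => ?_
      have h2 := hRn (B (U x))
      have h3 : ‖L x‖ = ‖R (B (U x))‖ := norm_neg _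
      have h4 : ‖B (U x)‖ ≤ ‖B‖ * ‖x‖ := by simpa using B.le_opNorm (U x)
      rw [h3, div_mul_eq_mul_div, le_div_iff₀ (by positivity), mul_comm]
      exact h2.trans h4
    exact h1.trans_lt ((div_lt_one (by positivity)).2 (lt_add_one _))
  obtain ⟨v, hv⟩ := isUnit_one_sub_of_norm_lt_one hLn
  set c := B (p.2 - z • p.1) with hc
  set w := (↑v⁻¹ : H →L[ℂ] H) (R c) with hw
  have hw1 : w + R (B (U w)) = R c := by
    have h1 : ((v : H →L[ℂ] H) * (↑v⁻¹ : H →L[ℂ] H)) (R c) = R c := by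
      rw [Units.mul_inv]; rfl
    rw [hv] at h1
    change w - L w = R c at h1
    rw [← h1, hL]
    change _ = w - -(R (B (U w)))
    rw [sub_neg_eq_add]
  set u := c - B (U w) with hu
  have hw2 : R u = w := by rw [hu, map_sub, ← hw1, add_sub_cancel_right]
  have hwg := hR1 u
  rw [hw2] at hwg
  have h1 := hU _ hwg
  have h2 := Submodule.sub_mem _ h1 (Submodule.smul_mem _ μ₀ hwg)
  have h3 := Submodule.sub_mem _ h2 hp
  have hBu : U u - μ₀ • u = p.2 - z • p.1 - U w := by
    rw [hu, map_sub, smul_sub, sub_sub_sub_comm, hB, hB]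
  have h5 : U w - μ₀ • w - p.1 = 0 := by
    refine hs.eq_zero_of_mem hτ ?_
    convert h3 using 1
    refine Prod.ext rfl ?_
    simp only [Prod.snd_sub, Prod.smul_snd, map_add, map_smul]
    rw [← hz]
    have : U u = p.2 - z • p.1 - U w + μ₀ • u := by rw [← hBu]; abel
    rw [this]
    module
  have h6 := T.graph_fst_eq_zero_snd h3 h5
  exact ⟨_, hwg, sub_eq_zero.1 h5, (sub_eq_zero.1 h6).symm⟩

/-- The virial identity behind the absence of self-adjoint strong time operators.  With
`A = i (1 + 2 μ₀ B) = i (U + μ₀) (U - μ₀)⁻¹`, the expectation of `A` grows by `4 ‖B y‖²` under the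
Cayley transform `(T + i) y ↦ (T - i) y`. -/
theorem cayley_expectation {U : H ≃ₗᵢ[ℂ] H} {G : Submodule ℂ (H × H)} (hs : IsSymmRel G)
    {μ₀ : ℂ} (hμ : ‖μ₀‖ = 1) (B : H →L[ℂ] H) (hB : ∀ x, U (B x) - μ₀ • B x = x)
    (hB' : ∀ x, B (U x - μ₀ • x) = x) {A : H → H}
    (hA : ∀ x, A x = Complex.I • (x + (2 * μ₀) • B x)) {p q : H × H} (hp : p ∈ G) (hq : q ∈ G)
    (h1 : U q.1 - μ₀ • q.1 = p.1) (h2 : p.2 = U q.2 + U q.1 - μ₀ • q.2) :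
    inner ℂ (p.2 - Complex.I • p.1) (A (p.2 - Complex.I • p.1)) -
      inner ℂ (p.2 + Complex.I • p.1) (A (p.2 + Complex.I • p.1)) = 4 * (‖q.1‖ : ℂ) ^ 2 := by
  have hμ' : (starRingEnd ℂ) μ₀ * μ₀ = 1 := by
    rw [mul_comm, Complex.mul_conj, Complex.normSq_eq_norm_sq, hμ]; simp
  have hBp1 : B p.1 = q.1 := by rw [← h1, hB']
  have hBp2 : B p.2 = q.2 + B (U q.1) := by
    have : p.2 = (U q.2 - μ₀ • q.2) + U q.1 := by rw [h2]; abel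
    rw [this, map_add, hB']
  have hps := hs p hp p hp
  have hpq := hs p hp q hq
  have hkey : inner ℂ p.1 (B (U q.1)) = -(starRingEnd ℂ) μ₀ * (‖q.1‖ : ℂ) ^ 2 := by
    set s := B (U q.1) with hsdef
    have hsU : U s - μ₀ • s = U q.1 := hB _
    have e1 : μ₀ * inner ℂ (U q.1) s = inner ℂ q.1 s - (‖q.1‖ : ℂ) ^ 2 := by
      have e2 : μ₀ • s = U s - U q.1 := by rw [← hsU]; abel
      rw [← inner_smul_right, e2, inner_sub_right, U.inner_map_map, U.inner_map_map,
        inner_self_eq_norm_sq_to_K]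
      rfl
    rw [← h1, inner_sub_left, inner_smul_left]
    linear_combination (starRingEnd ℂ μ₀) * e1 - inner ℂ (U q.1) s * hμ'
  simp only [hA, map_add, map_sub, map_smul, hBp1, hBp2, inner_add_left, inner_sub_left,
    inner_add_right, inner_sub_right, inner_smul_left, inner_smul_right, smul_add, smul_sub,
    Complex.conj_I]
  linear_combination 2 * hps + 4 * μ₀ * hpq - 4 * μ₀ * hkey + 4 * (‖q.1‖ : ℂ) ^ 2 * hμ' -
    2 * (inner ℂ p.2 p.1 + 2 * μ₀ * inner ℂ p.2 q.1 - inner ℂ p.1 p.2 -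
      2 * μ₀ * inner ℂ p.1 q.2 - 2 * μ₀ * inner ℂ p.1 (B (U q.1))) * Complex.I_mul_I

/-- If a unitary `U` has a spectral gap, here a point `μ₀` of the unit circle at which `U - μ₀` has
the bounded inverse `B`, then no self-adjoint `T` satisfies `U* T U ⊇ T + 1`: iterating the Cayley
transform makes the expectation of a bounded operator grow linearly. -/
theorem not_isSelfAdjoint_of_gap [CompleteSpace H] [Nontrivial H] {U : H ≃ₗᵢ[ℂ] H}
    {T : H →ₗ.[ℂ] H} {μ₀ : ℂ} (hμ : ‖μ₀‖ = 1) (B : H →L[ℂ] H)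
    (hB : ∀ x, U (B x) - μ₀ • B x = x) (hB' : ∀ x, B (U x - μ₀ • x) = x)
    (hU : ∀ p ∈ T.graph, (U p.1, U p.2 + U p.1) ∈ T.graph) : ¬ IsSelfAdjoint T := by
  intro hT
  obtain ⟨R, hR1⟩ := hT.exists_resolvent (neg_ne_zero.2 one_ne_zero)
  simp only [Complex.ofReal_neg, Complex.ofReal_one, neg_mul, one_mul] at hR1
  have hs := hT.isSymmRel
  let A : H →L[ℂ] H := Complex.I • (ContinuousLinearMap.id ℂ H + (2 * μ₀) • B)
  -- the Cayley transform `(T - i) (T + i)⁻¹`, where `R = (T + i)⁻¹`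
  let W : H →L[ℂ] H := ContinuousLinearMap.id ℂ H - (2 * Complex.I) • R
  have hWx : ∀ x, W x = x - (2 * Complex.I) • R x := fun x => rfl
  have hWn : ∀ x, ‖W x‖ = ‖x‖ := by
    intro x
    have e1 := hs.norm_sub_sq 1 (hR1 x)
    have e2 := hs.norm_sub_sq (-1) (hR1 x)
    have e3 : x + -Complex.I • R x - ((1 : ℝ) * Complex.I) • R x = W x := by
      rw [hWx]; push_cast; module
    have e4 : x + -Complex.I • R x - (((-1 : ℝ) : ℂ) * Complex.I) • R x = x := by
      push_cast; module
    simp only [e3] at e1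
    simp only [e4] at e2
    have : ‖W x‖ ^ 2 = ‖x‖ ^ 2 := by rw [e1, e2]; ring
    exact (pow_left_inj₀ (norm_nonneg _) (norm_nonneg _) two_ne_zero).1 this
  have hstep : ∀ x, (inner ℂ x (A x)).re + ‖R x‖ ^ 2 ≤ (inner ℂ (W x) (A (W x))).re := by
    intro x
    obtain ⟨q, hq, h1, h2⟩ := exists_mem_graph_of_gap hT B hB hU (hR1 x)
    have h3 := cayley_expectation hs hμ B hB hB' (A := A) (fun _ => rfl) (hR1 x) hq h1 h2
    have e3 : x + -Complex.I • R x - Complex.I • R x = W x := by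
      rw [hWx]; module
    have e4 : x + -Complex.I • R x + Complex.I • R x = x := by module
    simp only [e3, e4] at h3
    have h4 := congrArg Complex.re h3
    rw [Complex.sub_re] at h4
    have h5 : (4 * (‖q.1‖ : ℂ) ^ 2).re = 4 * ‖q.1‖ ^ 2 := by
      rw [← Complex.ofReal_pow, ← Complex.ofReal_ofNat, ← Complex.ofReal_mul, Complex.ofReal_re]
    have h6 : ‖R x‖ ≤ 2 * ‖q.1‖ := by
      change U q.1 - μ₀ • q.1 = R x at h1
      rw [← h1, two_mul]
      refine (norm_sub_le _ _).trans ?_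
      rw [norm_smul, hμ, one_mul, LinearIsometryEquiv.norm_map]
    nlinarith [norm_nonneg (R x)]
  have hRW : ∀ x, R (W x) = W (R x) := fun x => by
    rw [hWx, hWx, map_sub, map_smul]
  obtain ⟨x, hx⟩ := exists_ne (0 : H)
  have hRx : R x ≠ 0 := by
    intro h
    have := hR1 x
    rw [h, smul_zero, add_zero] at this
    exact hx (T.graph_fst_eq_zero_snd this rfl)
  have hiter : ∀ n : ℕ, (inner ℂ x (A x)).re + n * ‖R x‖ ^ 2 ≤
      (inner ℂ (W^[n] x) (A (W^[n] x))).re ∧ ‖W^[n] x‖ = ‖x‖ ∧ ‖R (W^[n] x)‖ = ‖R x‖ := by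
    intro n
    induction n with
    | zero => simp
    | succ n ih =>
      obtain ⟨i1, i2, i3⟩ := ih
      rw [Function.iterate_succ_apply']
      refine ⟨?_, by rw [hWn, i2], by rw [hRW, hWn, i3]⟩
      refine le_trans ?_ (hstep _)
      rw [i3]
      push_cast
      linarith
  have hbd : ∀ y, |(inner ℂ y (A y)).re| ≤ ‖A‖ * ‖y‖ ^ 2 := by
    intro y
    refine (Complex.abs_re_le_norm _).trans ((norm_inner_le_norm _ _).trans ?_)
    nlinarith [A.le_opNorm y, norm_nonneg y]
  obtain ⟨n, hn⟩ := exists_nat_gt (2 * (‖A‖ * ‖x‖ ^ 2) / ‖R x‖ ^ 2)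
  obtain ⟨i1, i2, -⟩ := hiter n
  have hpos : 0 < ‖R x‖ ^ 2 := by positivity
  rw [div_lt_iff₀ hpos] at hn
  have b1 := abs_le.1 (hbd x)
  have b2 := abs_le.1 (hbd (W^[n] x))
  rw [i2] at b2
  linarith [b1.1, b2.2]

end Extensions

/-! ### Absolutely continuous functions -/

section AbsolutelyContinuous

variable {E F : Type*} [NormedAddCommGroup E] [NormedAddCommGroup F]

theorem _root_.AbsolutelyContinuousOnInterval.of_dist_le {f : ℝ → E} {g : ℝ → F} {a b : ℝ}
    (hg : AbsolutelyContinuousOnInterval g a b)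
    (h : ∀ x ∈ Set.uIcc a b, ∀ y ∈ Set.uIcc a b, dist (f x) (f y) ≤ dist (g x) (g y)) :
    AbsolutelyContinuousOnInterval f a b := by
  rw [absolutelyContinuousOnInterval_iff] at hg ⊢
  intro ε hε
  obtain ⟨δ, hδ, H⟩ := hg ε hε
  refine ⟨δ, hδ, fun E hE hl => (Finset.sum_le_sum fun i hi => ?_).trans_lt (H E hE hl)⟩
  exact h _ (hE.1 i hi).1 _ (hE.1 i hi).2

variable [NormedSpace ℝ E]

theorem absolutelyContinuousOnInterval_integral {h : ℝ → E} {a b : ℝ}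
    (hi : IntervalIntegrable h volume a b) :
    AbsolutelyContinuousOnInterval (fun x => ∫ v in a..x, h v) a b := by
  refine (hi.norm.absolutelyContinuousOnInterval_intervalIntegral
    (c := a) Set.left_mem_uIcc).of_dist_le fun x hx y hy => ?_
  have hax : IntervalIntegrable h volume a x :=
    hi.mono_set (Set.uIcc_subset_uIcc Set.left_mem_uIcc hx)
  have hay : IntervalIntegrable h volume a y :=
    hi.mono_set (Set.uIcc_subset_uIcc Set.left_mem_uIcc hy)
  rw [dist_eq_norm, Real.dist_eq, intervalIntegral.integral_interval_sub_left hax hay,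
    intervalIntegral.integral_interval_sub_left hax.norm hay.norm]
  exact intervalIntegral.norm_integral_le_abs_integral_norm

theorem _root_.AbsolutelyContinuousOnInterval.integral_eq_sub [CompleteSpace E] {f D : ℝ → E}
    {a b : ℝ} (hf : AbsolutelyContinuousOnInterval f a b) (hi : IntervalIntegrable D volume a b)
    (hd : ∀ᵐ x, x ∈ Set.uIcc a b → HasDerivAt f (D x) x) :
    ∫ x in a..b, D x = f b - f a := by
  have hac := hf.sub (absolutelyContinuousOnInterval_integral hi)
  obtain ⟨C, hC⟩ := hac.const_of_ae_hasDerivAt_zero (by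
    filter_upwards [hd, hi.ae_hasDerivAt_integral] with x hx₁ hx₂ hx₃
    have := (hx₁ hx₃).sub (hx₂ hx₃ a Set.left_mem_uIcc)
    rwa [sub_self] at this)
  have h1 := hC a Set.left_mem_uIcc
  have h2 := hC b Set.right_mem_uIcc
  simp only [Pi.sub_apply, intervalIntegral.integral_same, sub_zero] at h1 h2
  rw [h1, ← h2]
  abel

/-- The fundamental theorem of calculus for a continuous function that is absolutely continuous
away from the endpoints. -/
theorem integral_eq_sub_of_absolutelyContinuousOnInterval_Ioo [CompleteSpace E] {f D : ℝ → E}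
    {a b : ℝ} (hab : a ≤ b) (hc : ContinuousOn f (Set.Icc a b))
    (hf : ∀ c ∈ Set.Ioo a b, ∀ d ∈ Set.Ioo a b, AbsolutelyContinuousOnInterval f c d)
    (hi : IntervalIntegrable D volume a b)
    (hd : ∀ᵐ x, x ∈ Set.uIcc a b → HasDerivAt f (D x) x) :
    ∫ x in a..b, D x = f b - f a := by
  rcases hab.eq_or_lt with rfl | hab
  · simp
  set m := (a + b) / 2 with hm
  have hm' : m ∈ Set.Ioo a b := ⟨by rw [hm]; linarith, by rw [hm]; linarith⟩
  have hsub : ∀ c ∈ Set.Icc a b, ∀ d ∈ Set.Icc a b, Set.uIcc c d ⊆ Set.uIcc a b := by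
    intro c hc d hd
    rw [← Set.uIcc_of_le hab.le] at hc hd
    exact Set.uIcc_subset_uIcc hc hd
  have hamb : ∀ x ∈ Set.Ioo a b, ∫ t in m..x, D t = f x - f m := by
    intro x hx
    have hs := hsub m (Set.Ioo_subset_Icc_self hm') x (Set.Ioo_subset_Icc_self hx)
    refine (hf m hm' x hx).integral_eq_sub (hi.mono_set hs) ?_
    filter_upwards [hd] with y hy hy'
    exact hy (hs hy')
  have hprim : ContinuousOn (fun x => ∫ t in m..x, D t) (Set.Icc a b) := by
    have := intervalIntegral.continuousOn_primitive_interval' hi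
      (by rw [Set.uIcc_of_le hab.le]; exact Set.Ioo_subset_Icc_self hm')
    rwa [Set.uIcc_of_le hab.le] at this
  have hall : Set.EqOn (fun x => ∫ t in m..x, D t) (fun x => f x - f m) (Set.Icc a b) := by
    refine Set.EqOn.of_subset_closure (s := Set.Ioo a b) (fun x hx => hamb x hx) hprim
      (hc.sub continuousOn_const) Set.Ioo_subset_Icc_self ?_
    rw [closure_Ioo hab.ne]
  have h1 := hall (Set.left_mem_Icc.2 hab.le)
  have h2 := hall (Set.right_mem_Icc.2 hab.le)
  simp only at h1 h2
  have hma := hi.mono_set (hsub m (Set.Ioo_subset_Icc_self hm') a (Set.left_mem_Icc.2 hab.le))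
  have hmb := hi.mono_set (hsub m (Set.Ioo_subset_Icc_self hm') b (Set.right_mem_Icc.2 hab.le))
  rw [← intervalIntegral.integral_interval_sub_left hmb hma, h1, h2]
  abel

end AbsolutelyContinuous

/-! ### Square integrable functions on `[0, 2π]` -/

theorem two_pi_pos : (0 : ℝ) < 2 * Real.pi := by positivity

theorem ae_μ_iff {p : ℝ → Prop} :
    (∀ᵐ k ∂μ, p k) ↔ ∀ᵐ k : ℝ, k ∈ Set.uIcc 0 (2 * Real.pi) → p k := by
  rw [ae_restrict_of_ae_μ, ae_restrict_iff' measurableSet_Icc, Set.uIcc_of_le two_pi_pos.le]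

theorem ae_μ_Ioo : ∀ᵐ k ∂μ, k ∈ Set.Ioo 0 (2 * Real.pi) := by
  rw [ae_restrict_of_ae_μ, restrict_Ioo_eq_restrict_Icc.symm]
  exact ae_restrict_mem measurableSet_Ioo

theorem intervalIntegrable_of_integrable_μ {f : ℝ → ℂ} (hf : Integrable f μ) :
    IntervalIntegrable f volume 0 (2 * Real.pi) := by
  rw [intervalIntegrable_iff_integrableOn_Ioc_of_le two_pi_pos.le, IntegrableOn,
    volume_restrict_eq]
  exact hf.smul_measure ENNReal.ofReal_ne_top

theorem integrable_mom (f : MomSpace1) : Integrable f μ :=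
  (Lp.memLp f).integrable one_le_two

theorem memLp_of_continuousOn {f : ℝ → ℂ} (hf : ContinuousOn f (Set.Icc 0 (2 * Real.pi))) :
    MemLp f 2 μ := by
  obtain ⟨C, hC⟩ := isCompact_Icc.exists_bound_of_continuousOn hf
  have hm : AEStronglyMeasurable f μ :=
    (hf.aestronglyMeasurable measurableSet_Icc).smul_measure _
  refine MemLp.of_bound hm C ?_
  filter_upwards [ae_μ_Ioo] with k hk
  exact hC k (Set.Ioo_subset_Icc_self hk)

theorem memLp_continuous_mul (m : C(ℝ, ℂ)) (f : MomSpace1) : MemLp (fun k => m k * f k) 2 μ := by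
  obtain ⟨C, hC⟩ := isCompact_Icc.exists_bound_of_continuousOn
    (s := Set.Icc 0 (2 * Real.pi)) m.continuous.continuousOn
  refine MemLp.of_le_mul (c := C) (Lp.memLp f)
    (m.continuous.aestronglyMeasurable.mul (Lp.aestronglyMeasurable f)) ?_
  filter_upwards [ae_μ_Ioo] with k hk
  rw [norm_mul]
  gcongr
  exact hC k (Set.Ioo_subset_Icc_self hk)

/-- Multiplication by a continuous function, a bounded operator on `L²([0, 2π], dk/2π)`. -/
def mulC (m : C(ℝ, ℂ)) : MomSpace1 →L[ℂ] MomSpace1 :=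
  LinearMap.mkContinuousOfExistsBound
    { toFun := fun f => (memLp_continuous_mul m f).toLp
      map_add' := fun f g => by
        rw [← MemLp.toLp_add]
        refine MemLp.toLp_congr _ _ ?_
        filter_upwards [Lp.coeFn_add f g] with k hk
        simp only [hk, Pi.add_apply, mul_add]
      map_smul' := fun c f => by
        rw [RingHom.id_apply, ← MemLp.toLp_const_smul]
        refine MemLp.toLp_congr _ _ ?_
        filter_upwards [Lp.coeFn_smul c f] with k hk
        simp [hk, mul_left_comm] } (by
    obtain ⟨C, hC⟩ := isCompact_Icc.exists_bound_of_continuousOn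
      (s := Set.Icc 0 (2 * Real.pi)) m.continuous.continuousOn
    refine ⟨C, fun f => Lp.norm_le_mul_norm_of_ae_le_mul ?_⟩
    filter_upwards [(memLp_continuous_mul m f).coeFn_toLp, ae_μ_Ioo] with k hk hk'
    change ‖((memLp_continuous_mul m f).toLp : MomSpace1) k‖ ≤ _
    rw [hk, norm_mul]
    gcongr
    exact hC k (Set.Ioo_subset_Icc_self hk'))

theorem coeFn_mulC (m : C(ℝ, ℂ)) (f : MomSpace1) : mulC m f =ᵐ[μ] fun k => m k * f k :=
  (memLp_continuous_mul m f).coeFn_toLp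

theorem mulC_mulC (m n : C(ℝ, ℂ)) (f : MomSpace1) : mulC m (mulC n f) = mulC (m * n) f := by
  refine Lp.ext ?_
  filter_upwards [coeFn_mulC m (mulC n f), coeFn_mulC n f, coeFn_mulC (m * n) f] with k h1 h2 h3
  rw [h1, h2, h3, ContinuousMap.mul_apply, mul_assoc]

theorem mulC_one (f : MomSpace1) : mulC 1 f = f := by
  refine Lp.ext ?_
  filter_upwards [coeFn_mulC 1 f] with k h1
  rw [h1, ContinuousMap.one_apply, one_mul]

theorem inner_mom (f g : MomSpace1) :
    inner ℂ f g = ∫ k, (starRingEnd ℂ) (f k) * g k ∂μ := by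
  rw [L2.inner_def]
  refine integral_congr_ae (Filter.Eventually.of_forall fun k => ?_)
  simp [mul_comm]

/-- Multiplication by `m` is symmetric when `m` is real. -/
theorem inner_mulC_left {m : C(ℝ, ℂ)} (hm : ∀ k, (starRingEnd ℂ) (m k) = m k) (f g : MomSpace1) :
    inner ℂ (mulC m f) g = inner ℂ f (mulC m g) := by
  rw [inner_mom, inner_mom]
  refine integral_congr_ae ?_
  filter_upwards [coeFn_mulC m f, coeFn_mulC m g] with k h1 h2
  rw [h1, h2, map_mul, hm]
  ring

theorem eq_zero_of_mulC_eq_zero {m : C(ℝ, ℂ)} (hm : ∀ᵐ k ∂μ, m k ≠ 0) {f : MomSpace1}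
    (hf : mulC m f = 0) : f = 0 := by
  refine Lp.ext ?_
  filter_upwards [coeFn_mulC m f, Lp.coeFn_zero ℂ 2 μ, hm] with k h1 h2 h3
  rw [hf, h2] at h1
  rw [h2]
  exact (mul_eq_zero.1 h1.symm).resolve_left h3

/-! ### The operator `P` -/

theorem isSymmRel_graphP : IsSymmRel graphP := by
  rintro ⟨f₁, h₁⟩ ⟨g₁, ha₁, hb₁, hc₁, hd₁⟩ ⟨f₂, h₂⟩ ⟨g₂, ha₂, hb₂, hc₂, hd₂⟩
  simp only at hc₁ hc₂ hd₁ hd₂ ⊢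
  have hac : AbsolutelyContinuousOnInterval (fun k => (starRingEnd ℂ) (g₁ k)) 0 (2 * Real.pi) :=
    ha₁.of_dist_le fun x _ y _ => by
      rw [dist_eq_norm, dist_eq_norm, ← map_sub, Complex.norm_conj]
  have hi₁ : Integrable (fun k => (starRingEnd ℂ) (h₁ k) * f₂ k) μ := by
    refine (L2.integrable_inner (𝕜 := ℂ) h₁ f₂).congr (Filter.Eventually.of_forall fun k => ?_)
    simp [mul_comm]
  have hi₂ : Integrable (fun k => (starRingEnd ℂ) (f₁ k) * h₂ k) μ := by
    refine (L2.integrable_inner (𝕜 := ℂ) f₁ h₂).congr (Filter.Eventually.of_forall fun k => ?_)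
    simp [mul_comm]
  have hI := (hac.smul ha₂).integral_eq_sub
    (intervalIntegrable_of_integrable_μ ((hi₂.sub hi₁).const_mul Complex.I)) (by
      rw [← ae_μ_iff]
      filter_upwards [hc₁, hc₂, hd₁, hd₂] with k k1 k2 k3 k4
      have h := (k3.star).mul k4
      convert! h using 1
      simp only [Pi.sub_apply, k1, k2, Complex.star_def, map_mul, Complex.conj_I]
      ring)
  simp only [Pi.smul_apply', smul_eq_mul, ← hb₁, ← hb₂, sub_self] at hI
  rw [inner_mom, inner_mom, ← sub_eq_zero, ← integral_sub hi₁ hi₂]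
  rw [intervalIntegral.integral_const_mul, mul_eq_zero] at hI
  have h0 := hI.resolve_left Complex.I_ne_zero
  rw [integral_μ, ← neg_eq_zero, ← smul_neg, ← intervalIntegral.integral_neg]
  simp only [Pi.sub_apply] at h0
  simp only [neg_sub, h0, smul_zero]

/-- `P - z` is onto unless `z` is an integer: the solution of `-i g' - z g = y` given by variation
of constants is periodic for a suitable initial value. -/
theorem exists_mem_graphP_sub {z : ℂ} (hz : Complex.exp (Complex.I * z * (2 * Real.pi : ℝ)) ≠ 1)
    (y : MomSpace1) : ∃ p ∈ graphP, p.2 - z • p.1 = y := by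
  set e : ℝ → ℂ := fun k => Complex.exp (Complex.I * z * k) with he
  have hed : ∀ k : ℝ, HasDerivAt e (Complex.I * z * e k) k := by
    intro k
    have h1 : HasDerivAt (fun k : ℝ => Complex.I * z * (k : ℂ)) (Complex.I * z) k := by
      simpa using (Complex.ofRealCLM.hasDerivAt (x := k)).const_mul (Complex.I * z)
    rw [mul_comm]
    exact h1.cexp
  have hec : ContDiff ℝ 1 e :=
    (contDiff_const.mul Complex.ofRealCLM.contDiff).cexp
  have he0 : ∀ k, e k ≠ 0 := fun k => Complex.exp_ne_zero _
  have hyi : IntervalIntegrable (fun k => (e k)⁻¹ * y k) volume 0 (2 * Real.pi) :=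
    (intervalIntegrable_of_integrable_μ (integrable_mom y)).continuousOn_mul
      (hec.continuous.inv₀ he0).continuousOn
  set h : ℝ → ℂ := fun k => ∫ v in (0 : ℝ)..k, (e v)⁻¹ * y v with hh
  -- the initial value that makes the solution `g` below periodic
  set c : ℂ := e (2 * Real.pi) * (Complex.I * h (2 * Real.pi)) / (1 - e (2 * Real.pi)) with hc
  have hhac : AbsolutelyContinuousOnInterval h 0 (2 * Real.pi) :=
    absolutelyContinuousOnInterval_integral hyi
  have hconst : AbsolutelyContinuousOnInterval (fun _ : ℝ => c) 0 (2 * Real.pi) :=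
    (contDiffOn_const (n := 1) (𝕜 := ℝ)).absolutelyContinuousOnInterval
  set g : ℝ → ℂ := fun k => e k * (c + Complex.I * h k) with hg
  have hgac : AbsolutelyContinuousOnInterval g 0 (2 * Real.pi) :=
    hec.contDiffOn.absolutelyContinuousOnInterval.smul (hconst.add (hhac.const_smul Complex.I))
  have hgL : MemLp g 2 μ := memLp_of_continuousOn (by
    rw [← Set.uIcc_of_le two_pi_pos.le]
    exact hgac.continuousOn)
  refine ⟨(hgL.toLp, y + z • hgL.toLp), ⟨g, hgac, ?_, hgL.coeFn_toLp, ?_⟩, by simp⟩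
  · have e0 : e 0 = 1 := by simp [he]
    have h0 : h 0 = 0 := by simp [hh]
    have hne : 1 - e (2 * Real.pi) ≠ 0 := sub_ne_zero.2 (Ne.symm hz)
    simp only [hg, e0, h0]
    rw [hc]
    field_simp
    ring
  · filter_upwards [hgL.coeFn_toLp, Lp.coeFn_add y (z • hgL.toLp), Lp.coeFn_smul z hgL.toLp,
      ae_μ_iff.2 hyi.ae_hasDerivAt_integral] with k k1 k2 k3 k4
    have h1 := (hed k).mul (((k4 0 Set.left_mem_uIcc).const_mul Complex.I).const_add c)
    convert! h1 using 1
    rw [k2, Pi.add_apply, k3, Pi.smul_apply, k1]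
    simp only [hg, smul_eq_mul]
    change Complex.I * (y k + z * (e k * (c + Complex.I * h k))) =
      Complex.I * z * e k * (c + Complex.I * h k) + e k * (Complex.I * ((e k)⁻¹ * y k))
    field_simp [he0 k]
    ring

theorem graph_opP : opP.graph = graphP := Submodule.toLinearPMap_graph_eq _ graphP_single_valued

theorem exp_I_mul_two_pi_ne_one {z : ℂ} (hz : ∀ n : ℤ, z ≠ n) :
    Complex.exp (Complex.I * z * (2 * Real.pi : ℝ)) ≠ 1 := by
  rw [Ne, Complex.exp_eq_one_iff]
  rintro ⟨n, hn⟩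
  refine hz n ?_
  have hpi : (Real.pi : ℂ) ≠ 0 := by exact_mod_cast Real.pi_ne_zero
  have h2 : (2 * Real.pi * Complex.I : ℂ) ≠ 0 := by simp [hpi]
  refine mul_right_cancel₀ h2 ?_
  rw [← hn]
  push_cast
  ring

theorem isSelfAdjoint_opP : IsSelfAdjoint opP := by
  refine isSelfAdjoint_of_surjective (by rw [graph_opP]; exact isSymmRel_graphP) ?_ ?_
  · rw [graph_opP]
    refine exists_mem_graphP_sub (exp_I_mul_two_pi_ne_one fun n h => ?_)
    simpa using congrArg Complex.im h
  · rw [graph_opP]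
    intro y
    obtain ⟨p, hp, h⟩ := exists_mem_graphP_sub
      (exp_I_mul_two_pi_ne_one (z := -Complex.I) fun n h => by simpa using congrArg Complex.im h) y
    exact ⟨p, hp, by rw [← h]; simp⟩

/-- The self-adjointness of `P`, for pairs given by a weak derivative. -/
theorem mem_graphP_of_forall_inner {u v : MomSpace1}
    (h : ∀ p ∈ graphP, inner ℂ u p.2 = inner ℂ v p.1) : (u, v) ∈ graphP := by
  rw [← graph_opP, ← LinearPMap.isSelfAdjoint_def.1 isSelfAdjoint_opP,
    LinearPMap.adjoint_graph_eq_graph_adjoint isSelfAdjoint_opP.dense_domain,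
    Submodule.mem_adjoint_iff, graph_opP]
  intro a b hab
  rw [← inner_conj_symm, h _ hab, inner_conj_symm, sub_self]

/-- Elements orthogonal to the domain of `P` vanish. -/
theorem eq_zero_of_forall_inner_graphP {v : MomSpace1}
    (h : ∀ p ∈ graphP, inner ℂ v p.1 = 0) : v = 0 := by
  refine isSelfAdjoint_opP.dense_domain.eq_zero_of_inner_left ℂ fun f hf => ?_
  have := opP.mem_graph ⟨f, hf⟩
  rw [graph_opP] at this
  exact h _ this

/-- The product rule `P (m f) = m P f - i m' f`. -/
theorem mulC_mem_graphP {m m' : C(ℝ, ℂ)} (hm : ∀ k, HasDerivAt (m : ℝ → ℂ) (m' k) k)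
    (hper : m 0 = m (2 * Real.pi)) {f h : MomSpace1} (hfh : (f, h) ∈ graphP) :
    (mulC m f, mulC m h - Complex.I • mulC m' f) ∈ graphP := by
  obtain ⟨g, ha, hb, hc, hd⟩ := hfh
  simp only at hc hd
  have hmC : ContDiff ℝ 1 (m : ℝ → ℂ) := by
    rw [contDiff_one_iff_deriv]
    refine ⟨fun k => (hm k).differentiableAt, ?_⟩
    have : deriv (m : ℝ → ℂ) = m' := funext fun k => (hm k).deriv
    rw [this]
    exact m'.continuous
  refine ⟨(m : ℝ → ℂ) • g, hmC.contDiffOn.absolutelyContinuousOnInterval.smul ha, ?_, ?_, ?_⟩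
  · simp [hb, hper]
  · filter_upwards [coeFn_mulC m f, hc] with k k1 k2
    rw [k1, k2]
    rfl
  · filter_upwards [coeFn_mulC m h, coeFn_mulC m' f, hc, hd, Lp.coeFn_smul Complex.I (mulC m' f),
      Lp.coeFn_sub (mulC m h) (Complex.I • mulC m' f)] with k k1 k2 k3 k4 k5 k6
    have h1 := (hm k).mul k4
    convert! h1 using 1
    rw [k6, Pi.sub_apply, k5, Pi.smul_apply, k1, k2, k3, smul_eq_mul]
    linear_combination (-m' k * g k) * Complex.I_mul_I

/-! ### The time operator of a single eigenvalue -/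

section Graphs

variable {H : Type*} [NormedAddCommGroup H] [InnerProductSpace ℂ H]

theorem mem_graph_natComp {A B : H →ₗ.[ℂ] H} {f g : H} :
    (f, g) ∈ (natComp A B).graph ↔ ∃ h, (f, h) ∈ B.graph ∧ (h, g) ∈ A.graph := by
  constructor
  · intro h
    obtain ⟨⟨x, hx⟩, rfl, rfl⟩ := (LinearPMap.mem_graph_iff _).1 h
    obtain ⟨y, hy, rfl⟩ := hx
    exact ⟨B y, B.mem_graph y, A.mem_graph ⟨B y, hy⟩⟩
  · rintro ⟨h, h1, h2⟩
    obtain ⟨y, rfl, rfl⟩ := (LinearPMap.mem_graph_iff _).1 h1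
    obtain ⟨w, hw, rfl⟩ := (LinearPMap.mem_graph_iff _).1 h2
    obtain ⟨w, hw'⟩ := w
    change w = B y at hw
    subst hw
    exact (natComp A B).mem_graph ⟨y, ⟨y, hw', rfl⟩⟩

theorem mem_graph_add {A B : H →ₗ.[ℂ] H} {f g : H} :
    (f, g) ∈ (A + B).graph ↔ ∃ a b, (f, a) ∈ A.graph ∧ (f, b) ∈ B.graph ∧ g = a + b := by
  constructor
  · intro h
    obtain ⟨⟨x, hx⟩, rfl, rfl⟩ := (LinearPMap.mem_graph_iff _).1 h
    exact ⟨_, _, A.mem_graph ⟨x, hx.1⟩, B.mem_graph ⟨x, hx.2⟩, rfl⟩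
  · rintro ⟨a, b, h1, h2, rfl⟩
    obtain ⟨⟨x, hx⟩, rfl, rfl⟩ := (LinearPMap.mem_graph_iff _).1 h1
    obtain ⟨⟨y, hy⟩, hyx, rfl⟩ := (LinearPMap.mem_graph_iff _).1 h2
    change y = x at hyx
    subst hyx
    exact (A + B).mem_graph ⟨y, hx, hy⟩

theorem mem_graph_smul {A : H →ₗ.[ℂ] H} {c : ℂ} {f g : H} :
    (f, g) ∈ (c • A).graph ↔ ∃ a, (f, a) ∈ A.graph ∧ g = c • a := by
  constructor
  · intro h
    obtain ⟨x, rfl, rfl⟩ := (LinearPMap.mem_graph_iff _).1 h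
    exact ⟨_, A.mem_graph x, rfl⟩
  · rintro ⟨a, h1, rfl⟩
    obtain ⟨x, rfl, rfl⟩ := (LinearPMap.mem_graph_iff _).1 h1
    exact (c • A).mem_graph x

end Graphs

theorem mem_graph_mulOp {φ : ℝ → ℂ} {f g : MomSpace1} :
    (f, g) ∈ (mulOp φ).graph ↔ g =ᵐ[μ] fun k => φ k * f k := by
  constructor
  · intro h
    obtain ⟨x, rfl, rfl⟩ := (LinearPMap.mem_graph_iff _).1 h
    exact MemLp.coeFn_toLp x.2
  · intro h
    have hf : MemLp (fun k => φ k * f k) 2 μ := (Lp.memLp g).ae_eq h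
    have e : (mulOp φ) ⟨f, hf⟩ = g := Lp.ext ((MemLp.coeFn_toLp hf).trans h.symm)
    rw [← e]
    exact (mulOp φ).mem_graph ⟨f, hf⟩

theorem mem_graph_timeOp1 {l : ℝ → ℂ} {f g : MomSpace1} :
    (f, g) ∈ (timeOp1 l).graph ↔ ∃ p r t s : MomSpace1, (f, p) ∈ graphP ∧
      (r =ᵐ[μ] fun k => l k / deriv l k * p k) ∧ (t =ᵐ[μ] fun k => l k / deriv l k * f k) ∧
      (t, s) ∈ graphP ∧ g = (Complex.I / 2) • (r + s) := by
  rw [timeOp1, mem_graph_smul]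
  simp only [mem_graph_add, mem_graph_natComp, mem_graph_mulOp, graph_opP]
  constructor
  · rintro ⟨a, ⟨r, s, ⟨p, h1, h2⟩, ⟨t, h3, h4⟩, rfl⟩, rfl⟩
    exact ⟨p, r, t, s, h1, h2, h3, h4, rfl⟩
  · rintro ⟨p, r, t, s, h1, h2, h3, h4, rfl⟩
    exact ⟨_, ⟨r, s, ⟨p, h1, h2⟩, ⟨t, h3, h4⟩, rfl⟩, rfl⟩

/-- A real periodic `C¹` function `w`, with derivative `w'`, that vanishes almost nowhere. -/
structure IsSpeed (w w' : C(ℝ, ℂ)) : Prop where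
  conj_eq : ∀ k, (starRingEnd ℂ) (w k) = w k
  hasDerivAt : ∀ k, HasDerivAt (w : ℝ → ℂ) (w' k) k
  periodic : w 0 = w (2 * Real.pi)
  ae_ne : ∀ᵐ k ∂μ, w k ≠ 0

/-- A periodic function `l` of modulus one with `l' = i w l`; then `w` is the group velocity of the
eigenvalue `l`. -/
structure IsPhase (l w : C(ℝ, ℂ)) : Prop where
  norm_eq : ∀ k, ‖l k‖ = 1
  hasDerivAt : ∀ k, HasDerivAt (l : ℝ → ℂ) (Complex.I * w k * l k) k
  periodic : l 0 = l (2 * Real.pi)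

/-- The graph of `(i/2) ((l/l') P + P (l/l'))` for `l' = i w l`, in terms of `q = f / w`: it
consists of the pairs `(w q, P q - (i/2) (w'/w) q)`. -/
def channelGraph (w w' : C(ℝ, ℂ)) : Submodule ℂ (MomSpace1 × MomSpace1) where
  carrier := {p | ∃ q s r, (q, s) ∈ graphP ∧ p.1 = mulC w q ∧ mulC w r = mulC w' q ∧
    p.2 = s - (Complex.I / 2) • r}
  zero_mem' := ⟨0, 0, 0, graphP.zero_mem, by simp, by simp, by simp⟩
  add_mem' := by
    rintro p p' ⟨q, s, r, h1, h2, h3, h4⟩ ⟨q', s', r', h1', h2', h3', h4'⟩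
    refine ⟨q + q', s + s', r + r', graphP.add_mem h1 h1', ?_, ?_, ?_⟩
    · rw [Prod.fst_add, h2, h2', map_add]
    · rw [map_add, map_add, h3, h3']
    · rw [Prod.snd_add, h4, h4', smul_add]
      abel
  smul_mem' := by
    rintro c p ⟨q, s, r, h1, h2, h3, h4⟩
    refine ⟨c • q, c • s, c • r, graphP.smul_mem c h1, ?_, ?_, ?_⟩
    · rw [Prod.smul_fst, h2, map_smul]
    · rw [map_smul, map_smul, h3]
    · rw [Prod.smul_snd, h4, smul_sub, smul_comm]

theorem graphP_unique {f h h' : MomSpace1} (h1 : (f, h) ∈ graphP) (h2 : (f, h') ∈ graphP) :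
    h = h' :=
  sub_eq_zero.1 (graphP_single_valued _ (graphP.sub_mem h1 h2) (sub_self f))

variable {l w w' : C(ℝ, ℂ)}

theorem IsSpeed.conj_deriv (hw : IsSpeed w w') (k : ℝ) : (starRingEnd ℂ) (w' k) = w' k := by
  have h := (hw.hasDerivAt k).star
  have e : (fun k => star (w k)) = w := funext hw.conj_eq
  rw [e] at h
  exact h.unique (hw.hasDerivAt k)

/-- Wherever `w` vanishes so does `l'`, and both sides of `l / l' = -i / w` are then `0` by the
convention for division by zero. -/
theorem IsPhase.div_deriv (hl : IsPhase l w) (k : ℝ) :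
    l k / deriv l k = -Complex.I / w k := by
  have hl0 : l k ≠ 0 := by
    rw [← norm_ne_zero_iff, hl.norm_eq]
    exact one_ne_zero
  rw [(hl.hasDerivAt k).deriv]
  rcases eq_or_ne (w k) 0 with h | h
  · simp [h]
  · field_simp
    simp

/-- The natural domain of `timeOp1 l` requires both `f` and `q = f / w` to be in the domain of `P`;
the first condition follows from the second, by the product rule for `f = w q`. -/
theorem graph_timeOp1 (hl : IsPhase l w) (hw : IsSpeed w w') :
    (timeOp1 l).graph = channelGraph w w' := by
  ext ⟨f, g⟩
  rw [mem_graph_timeOp1]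
  simp only [hl.div_deriv]
  constructor
  · rintro ⟨p, r, t, s, h1, h2, h3, h4, rfl⟩
    have hq : (Complex.I • t, Complex.I • s) ∈ graphP := graphP.smul_mem _ h4
    have hf : f = mulC w (Complex.I • t) := by
      refine Lp.ext ?_
      filter_upwards [coeFn_mulC w (Complex.I • t), Lp.coeFn_smul Complex.I t, h3, hw.ae_ne]
        with k k1 k2 k3 k4
      rw [k1, k2, Pi.smul_apply, k3, smul_eq_mul]
      field_simp
      rw [Complex.I_sq]
      ring
    have hp := graphP_unique (hf ▸ h1) (mulC_mem_graphP hw.hasDerivAt hw.periodic hq)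
    refine ⟨_, _, s - r, hq, hf, ?_, ?_⟩
    · have hr : mulC w r = -Complex.I • p := by
        refine Lp.ext ?_
        filter_upwards [coeFn_mulC w r, Lp.coeFn_smul (-Complex.I) p, h2, hw.ae_ne]
          with k k1 k2 k3 k4
        rw [k1, k2, Pi.smul_apply, k3, smul_eq_mul]
        field_simp
      rw [map_sub, hr, hp]
      simp only [map_smul, smul_sub, smul_smul, neg_mul, Complex.I_mul_I, neg_neg, neg_smul]
      module
    · simp only
      module
  · rintro ⟨q, s, r, h1, h2, h3, h4⟩
    simp only at h2 h4
    have hp := mulC_mem_graphP hw.hasDerivAt hw.periodic h1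
    have hp' : mulC w s - Complex.I • mulC w' q = mulC w (s - Complex.I • r) := by
      rw [map_sub, map_smul, h3]
    rw [hp', ← h2] at hp
    refine ⟨_, -Complex.I • s - r, -Complex.I • q, -Complex.I • s, hp, ?_, ?_,
      graphP.smul_mem _ h1, ?_⟩
    · have e : -Complex.I • s - r = -Complex.I • (s - Complex.I • r) := by
        rw [smul_sub, smul_smul, neg_mul, Complex.I_mul_I, neg_neg, one_smul]
      rw [e]
      filter_upwards [coeFn_mulC w (s - Complex.I • r), hw.ae_ne,
        Lp.coeFn_smul (-Complex.I) (s - Complex.I • r)] with k k1 k2 k3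
      rw [k1, k3, Pi.smul_apply, smul_eq_mul]
      field_simp
    · rw [h2]
      filter_upwards [coeFn_mulC w q, hw.ae_ne, Lp.coeFn_smul (-Complex.I) q] with k k1 k2 k3
      rw [k1, k3, Pi.smul_apply, smul_eq_mul]
      field_simp
    · rw [h4]
      have : (Complex.I / 2) • (-Complex.I • s - r + -Complex.I • s) =
          (-(Complex.I * Complex.I)) • s - (Complex.I / 2) • r := by module
      rw [this, Complex.I_mul_I, neg_neg, one_smul]

theorem isSymmRel_channelGraph (hw : IsSpeed w w') : IsSymmRel (channelGraph w w') := by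
  rintro p ⟨q₁, s₁, r₁, a1, a2, a3, a4⟩ q ⟨q₂, s₂, r₂, b1, b2, b3, b4⟩
  have h := isSymmRel_graphP _ (mulC_mem_graphP hw.hasDerivAt hw.periodic a1) _ b1
  have e1 : inner ℂ r₁ (mulC w q₂) = inner ℂ q₁ (mulC w' q₂) := by
    rw [← inner_mulC_left hw.conj_eq, a3, inner_mulC_left hw.conj_deriv]
  have e2 : inner ℂ (mulC w q₁) r₂ = inner ℂ q₁ (mulC w' q₂) := by
    rw [inner_mulC_left hw.conj_eq, b3]
  simp only [inner_sub_left, inner_smul_left, inner_mulC_left hw.conj_eq s₁,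
    inner_mulC_left hw.conj_deriv q₁] at h
  rw [a2, a4, b2, b4, inner_sub_left, inner_sub_right, inner_smul_left, inner_smul_right, e1, e2]
  rw [Complex.conj_I] at h
  have hc : (starRingEnd ℂ) (Complex.I / 2) = -Complex.I / 2 := by
    rw [map_div₀, Complex.conj_I, Complex.conj_ofNat]
  rw [hc]
  linear_combination h

/-- The elements `w² h` of the domain, on which the operator is `-i (w h' + (3/2) w' h)`. -/
theorem mem_channelGraph_of_graphP (hw : IsSpeed w w') {h p : MomSpace1} (hp : (h, p) ∈ graphP) :
    (mulC w (mulC w h), mulC w p - (3 * Complex.I / 2) • mulC w' h) ∈ channelGraph w w' := by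
  refine ⟨mulC w h, _, mulC w' h, mulC_mem_graphP hw.hasDerivAt hw.periodic hp, rfl, ?_, ?_⟩
  · rw [mulC_mulC, mulC_mulC, mul_comm]
  · simp only
    module

/-- The domain of the channel operator is dense, since it contains `w² D(P)`. -/
theorem eq_zero_of_forall_inner_channelGraph (hw : IsSpeed w w') {v : MomSpace1}
    (h : ∀ p ∈ channelGraph w w', inner ℂ v p.1 = 0) : v = 0 := by
  refine eq_zero_of_mulC_eq_zero hw.ae_ne (eq_zero_of_mulC_eq_zero hw.ae_ne ?_)
  refine eq_zero_of_forall_inner_graphP fun p hp => ?_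
  rw [inner_mulC_left hw.conj_eq, inner_mulC_left hw.conj_eq]
  exact h _ (mem_channelGraph_of_graphP hw hp)

/-- The canonical commutation relation in the form `T̂ (m f) = m T̂ f + c m f` for a multiplier with
`m' = i c w m`. -/
theorem mulC_mem_channelGraph {m : C(ℝ, ℂ)} {c : ℂ}
    (hm : ∀ k, HasDerivAt (m : ℝ → ℂ) (Complex.I * c * w k * m k) k)
    (hper : m 0 = m (2 * Real.pi)) {f g : MomSpace1} (hfg : (f, g) ∈ channelGraph w w') :
    (mulC m f, mulC m g + c • mulC m f) ∈ channelGraph w w' := by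
  obtain ⟨q, s, r, h1, h2, h3, h4⟩ := hfg
  simp only at h2 h4
  let m' : C(ℝ, ℂ) := ⟨fun k => Complex.I * c * w k * m k, by fun_prop⟩
  have hm' : ∀ f, mulC m' f = (Complex.I * c) • mulC m (mulC w f) := by
    intro f
    refine Lp.ext ?_
    filter_upwards [coeFn_mulC m' f, coeFn_mulC m (mulC w f), coeFn_mulC w f,
      Lp.coeFn_smul (Complex.I * c) (mulC m (mulC w f))] with k k1 k2 k3 k4
    rw [k1, k4, Pi.smul_apply, k2, k3, smul_eq_mul]
    change Complex.I * c * w k * m k * f k = _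
    ring
  refine ⟨mulC m q, _, mulC m r, mulC_mem_graphP (m' := m') hm hper h1, ?_, ?_, ?_⟩
  · simp only
    rw [h2, mulC_mulC, mulC_mulC, mul_comm]
  · rw [mulC_mulC, mul_comm, ← mulC_mulC, h3, mulC_mulC, mulC_mulC, mul_comm]
  · simp only
    rw [hm', h4, h2, map_sub, map_smul, smul_smul, ← mul_assoc, Complex.I_mul_I]
    module

theorem IsPhase.mem_channelGraph (hl : IsPhase l w) {f g : MomSpace1}
    (hfg : (f, g) ∈ channelGraph w w') :
    (mulC l f, mulC l g + mulC l f) ∈ channelGraph w w' := by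
  have := mulC_mem_channelGraph (m := l) (c := 1) (fun k => by simpa using hl.hasDerivAt k)
    hl.periodic hfg
  rwa [one_smul] at this

theorem IsPhase.star_mem_channelGraph (hl : IsPhase l w) (hw : IsSpeed w w') {f g : MomSpace1}
    (hfg : (f, g) ∈ channelGraph w w') :
    (mulC (star l) f, mulC (star l) g - mulC (star l) f) ∈ channelGraph w w' := by
  have := mulC_mem_channelGraph (m := star l) (c := -1) (fun k => by
    have h := (hl.hasDerivAt k).star
    convert! h using 1
    simp only [Complex.star_def, map_mul, Complex.conj_I, hw.conj_eq, ContinuousMap.star_apply]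
    ring) (by simp [hl.periodic]) hfg
  rwa [neg_one_smul, ← sub_eq_add_neg] at this

/-! ### The defect spaces of a channel with two turning points -/

/-- The group velocity `ω = t'` of a phase `t` on the circle `ℝ / 2πℤ`, with exactly two zeros
`k₁ < k₂` per period. -/
structure IsTwoArc (ω ω' t : ℝ → ℝ) (k₁ k₂ : ℝ) : Prop where
  hasDerivAt : ∀ k, HasDerivAt ω (ω' k) k
  continuous' : Continuous ω'
  hasDerivAt_phase : ∀ k, HasDerivAt t (ω k) k
  periodic : ω 0 = ω (2 * Real.pi)
  periodic_phase : t 0 = t (2 * Real.pi)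
  nonneg : 0 ≤ k₁
  lt : k₁ < k₂
  lt_two_pi : k₂ < 2 * Real.pi
  eq_zero₁ : ω k₁ = 0
  eq_zero₂ : ω k₂ = 0
  ne_zero : ∀ k, 0 ≤ k → k < 2 * Real.pi → k ≠ k₁ → k ≠ k₂ → ω k ≠ 0

/-- A real function as a complex valued one. -/
def ofRealC (f : ℝ → ℝ) (hf : Continuous f) : C(ℝ, ℂ) := ⟨fun k => f k, by fun_prop⟩

theorem ofRealC_apply (f : ℝ → ℝ) (hf : Continuous f) (k : ℝ) : ofRealC f hf k = f k := rfl

theorem ae_ne_μ (c : ℝ) : ∀ᵐ k ∂μ, k ≠ c := by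
  rw [ae_μ_iff]
  filter_upwards [Measure.ae_ne volume c] with k hk _ using hk

theorem exists_mem_Ioo_of_ae_μ {p : ℝ → Prop} (h : ∀ᵐ k ∂μ, p k) {α β : ℝ} (h0 : 0 ≤ α)
    (hαβ : α < β) (hβ : β ≤ 2 * Real.pi) : ∃ k ∈ Set.Ioo α β, p k := by
  rw [ae_μ_iff] at h
  by_contra! hn
  have h1 : volume (Set.Ioo α β) = 0 := by
    refine measure_mono_null (fun k hk => ?_) (ae_iff.1 h)
    rw [Set.uIcc_of_le two_pi_pos.le]
    simp only [Set.mem_ofPred_eq, Classical.not_imp]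
    exact ⟨⟨h0.trans hk.1.le, hk.2.le.trans hβ⟩, hn k hk⟩
  rw [Real.volume_Ioo, ENNReal.ofReal_eq_zero] at h1
  linarith

/-- The solution `|ω|^{1/2} e^{izt}` of the eigenvalue equation on an arc. -/
def mode (ω t : ℝ → ℝ) (z : ℂ) (k : ℝ) : ℂ :=
  (Real.sqrt |ω k| : ℂ) * Complex.exp (Complex.I * z * t k)

namespace IsTwoArc

variable {ω ω' t : ℝ → ℝ} {k₁ k₂ : ℝ}

theorem continuous (h : IsTwoArc ω ω' t k₁ k₂) : Continuous ω :=
  continuous_iff_continuousAt.2 fun k => (h.hasDerivAt k).continuousAt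

theorem continuous_phase (h : IsTwoArc ω ω' t k₁ k₂) : Continuous t :=
  continuous_iff_continuousAt.2 fun k => (h.hasDerivAt_phase k).continuousAt

theorem contDiff (h : IsTwoArc ω ω' t k₁ k₂) : ContDiff ℝ 1 ω := by
  rw [contDiff_one_iff_deriv]
  refine ⟨fun k => (h.hasDerivAt k).differentiableAt, ?_⟩
  rw [funext fun k => (h.hasDerivAt k).deriv]
  exact h.continuous'

theorem contDiff_phase (h : IsTwoArc ω ω' t k₁ k₂) : ContDiff ℝ 1 t := by
  rw [contDiff_one_iff_deriv]
  refine ⟨fun k => (h.hasDerivAt_phase k).differentiableAt, ?_⟩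
  rw [funext fun k => (h.hasDerivAt_phase k).deriv]
  exact h.continuous

theorem isSpeed (h : IsTwoArc ω ω' t k₁ k₂) :
    IsSpeed (ofRealC ω h.continuous) (ofRealC ω' h.continuous') where
  conj_eq k := Complex.conj_ofReal _
  hasDerivAt k := (h.hasDerivAt k).ofReal_comp
  periodic := by simp [ofRealC_apply, h.periodic]
  ae_ne := by
    filter_upwards [ae_μ_Ioo, ae_ne_μ k₁, ae_ne_μ k₂] with k hk h1 h2
    rw [ofRealC_apply, Complex.ofReal_ne_zero]
    exact h.ne_zero k hk.1.le hk.2 h1 h2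

theorem continuous_mode (h : IsTwoArc ω ω' t k₁ k₂) (z : ℂ) : Continuous (mode ω t z) := by
  have := h.continuous
  have := h.continuous_phase
  unfold mode
  fun_prop

theorem mode_ne_zero {z : ℂ} {k : ℝ} (hk : ω k ≠ 0) : mode ω t z k ≠ 0 := by
  refine mul_ne_zero ?_ (Complex.exp_ne_zero _)
  rw [Complex.ofReal_ne_zero]
  exact (Real.sqrt_pos.2 (abs_pos.2 hk)).ne'

theorem contDiffAt_mode (h : IsTwoArc ω ω' t k₁ k₂) (z : ℂ) {k : ℝ} (hk : ω k ≠ 0) :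
    ContDiffAt ℝ 1 (mode ω t z) k := by
  refine ContDiffAt.mul ?_ ?_
  · exact Complex.ofRealCLM.contDiff.contDiffAt.comp k
      ((h.contDiff.contDiffAt.abs hk).sqrt (abs_ne_zero.2 hk))
  · exact (contDiffAt_const.mul
      (Complex.ofRealCLM.contDiff.contDiffAt.comp k h.contDiff_phase.contDiffAt)).cexp

theorem hasDerivAt_mode (h : IsTwoArc ω ω' t k₁ k₂) (z : ℂ) {k : ℝ} (hk : ω k ≠ 0) :
    HasDerivAt (mode ω t z) ((ω' k / (2 * ω k) + Complex.I * z * ω k) * mode ω t z k) k := by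
  have h1 : HasDerivAt (fun k => Real.sqrt |ω k|) (ω' k / (2 * ω k) * Real.sqrt |ω k|) k := by
    have h2 := ((hasDerivAt_abs hk).comp k (h.hasDerivAt k)).sqrt (abs_ne_zero.2 hk)
    simp only [Function.comp_def] at h2
    convert! h2 using 1
    have hs : 0 < Real.sqrt |ω k| := Real.sqrt_pos.2 (abs_pos.2 hk)
    have h3 : Real.sqrt |ω k| * Real.sqrt |ω k| = SignType.sign (ω k) * ω k := by
      rw [Real.mul_self_sqrt (abs_nonneg _), sign_mul_self]
    have h4 : ((SignType.sign (ω k) : SignType) : ℝ) *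
        ((SignType.sign (ω k) : SignType) : ℝ) = 1 := by
      rcases lt_or_gt_of_ne hk with h | h <;> simp [h]
    field_simp
    rw [sq, h3]
    ring
  have h2 : HasDerivAt (fun k : ℝ => Complex.exp (Complex.I * z * t k))
      (Complex.exp (Complex.I * z * t k) * (Complex.I * z * ω k)) k :=
    ((h.hasDerivAt_phase k).ofReal_comp.const_mul (Complex.I * z)).cexp
  convert! h1.ofReal_comp.mul h2 using 1
  simp only [mode]
  push_cast
  ring

theorem mode_zero_eq (h : IsTwoArc ω ω' t k₁ k₂) (z : ℂ) :
    mode ω t z 0 = mode ω t z (2 * Real.pi) := by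
  rw [mode, mode, h.periodic, h.periodic_phase]

theorem mode_eq_zero {z : ℂ} {k : ℝ} (hk : ω k = 0) : mode ω t z k = 0 := by
  simp [mode, hk]

theorem memLp_mode (h : IsTwoArc ω ω' t k₁ k₂) (z : ℂ) : MemLp (mode ω t z) 2 μ :=
  memLp_of_continuousOn (h.continuous_mode z).continuousOn

/-- The combination of the two solutions supported on the arcs `(k₁, k₂)` and its complement. -/
def arcModes (h : IsTwoArc ω ω' t k₁ k₂) (z : ℂ) : ℂ × ℂ →ₗ[ℂ] MomSpace1 :=
  (LinearMap.toSpanSingleton ℂ MomSpace1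
    (((h.memLp_mode z).indicator (measurableSet_Ioo (a := k₁) (b := k₂))).toLp)).coprod
  (LinearMap.toSpanSingleton ℂ MomSpace1
    (((h.memLp_mode z).indicator (measurableSet_Ioo (a := k₁) (b := k₂)).compl).toLp))

open Classical in
theorem coeFn_arcModes (h : IsTwoArc ω ω' t k₁ k₂) (z : ℂ) (c : ℂ × ℂ) :
    h.arcModes z c =ᵐ[μ]
      fun k => (if k ∈ Set.Ioo k₁ k₂ then c.1 else c.2) * mode ω t z k := by
  set e₁ : MomSpace1 :=
    ((h.memLp_mode z).indicator (measurableSet_Ioo (a := k₁) (b := k₂))).toLp with he₁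
  set e₂ : MomSpace1 :=
    ((h.memLp_mode z).indicator (measurableSet_Ioo (a := k₁) (b := k₂)).compl).toLp with he₂
  have hc : h.arcModes z c = c.1 • e₁ + c.2 • e₂ := rfl
  rw [hc]
  filter_upwards [Lp.coeFn_add (c.1 • e₁) (c.2 • e₂), Lp.coeFn_smul c.1 e₁, Lp.coeFn_smul c.2 e₂,
    ((h.memLp_mode z).indicator (measurableSet_Ioo (a := k₁) (b := k₂))).coeFn_toLp,
    ((h.memLp_mode z).indicator (measurableSet_Ioo (a := k₁) (b := k₂)).compl).coeFn_toLp]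
    with k h1 h2 h3 h4 h5
  rw [h1, Pi.add_apply, h2, h3, Pi.smul_apply, Pi.smul_apply, he₁, he₂, h4, h5]
  by_cases hk : k ∈ Set.Ioo k₁ k₂
  · simp [hk, -Set.mem_Ioo]
  · simp [hk, -Set.mem_Ioo]

theorem arcModes_injective (h : IsTwoArc ω ω' t k₁ k₂) (z : ℂ) :
    Function.Injective (h.arcModes z) := by
  classical
  rw [injective_iff_map_eq_zero]
  intro c hc
  have h0 := h.coeFn_arcModes z c
  rw [hc] at h0
  have h1 : ∀ᵐ k ∂μ, (if k ∈ Set.Ioo k₁ k₂ then c.1 else c.2) * mode ω t z k = 0 := by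
    filter_upwards [h0, Lp.coeFn_zero ℂ 2 μ] with k e1 e2
    rw [← e1, e2, Pi.zero_apply]
  obtain ⟨a, ha, ha'⟩ := exists_mem_Ioo_of_ae_μ h1 h.nonneg h.lt h.lt_two_pi.le
  obtain ⟨b, hb, hb'⟩ := exists_mem_Ioo_of_ae_μ h1 (h.nonneg.trans h.lt.le) h.lt_two_pi le_rfl
  have hb1 : b ∉ Set.Ioo k₁ k₂ := fun h' => lt_asymm h'.2 hb.1
  rw [if_pos ha] at ha'
  rw [if_neg hb1] at hb'
  refine Prod.ext ((mul_eq_zero.1 ha').resolve_right (mode_ne_zero ?_))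
    ((mul_eq_zero.1 hb').resolve_right (mode_ne_zero ?_))
  · exact h.ne_zero a (h.nonneg.trans ha.1.le) (ha.2.trans h.lt_two_pi) ha.1.ne' ha.2.ne
  · exact h.ne_zero b ((h.nonneg.trans h.lt.le).trans hb.1.le) hb.2 (h.lt.trans hb.1).ne' hb.1.ne'

/-- Integration by parts over an arc on whose interior `ω` does not vanish: the form
`⟪ψ, T̂ f⟫ - ⟪z ψ, f⟫` localized to the arc is a boundary term. -/
theorem integral_arc (h : IsTwoArc ω ω' t k₁ k₂) (z : ℂ) {q s r : MomSpace1} {g : ℝ → ℂ}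
    (hg : AbsolutelyContinuousOnInterval g 0 (2 * Real.pi)) (hqg : q =ᵐ[μ] g)
    (hgs : ∀ᵐ k ∂μ, HasDerivAt g (Complex.I * s k) k)
    (hr : mulC (ofRealC ω h.continuous) r = mulC (ofRealC ω' h.continuous') q)
    {α β : ℝ} (hα : 0 ≤ α) (hαβ : α ≤ β) (hβ : β ≤ 2 * Real.pi)
    (hne : ∀ k ∈ Set.Ioo α β, ω k ≠ 0) :
    ∫ k in α..β, (starRingEnd ℂ) (mode ω t z k) *
        ((s - (Complex.I / 2) • r) k -
          (starRingEnd ℂ) z * mulC (ofRealC ω h.continuous) q k) =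
      -Complex.I * ((starRingEnd ℂ) (mode ω t z β) * g β -
        (starRingEnd ℂ) (mode ω t z α) * g α) := by
  have hsub : Set.uIcc α β ⊆ Set.uIcc 0 (2 * Real.pi) := by
    rw [Set.uIcc_of_le hαβ, Set.uIcc_of_le two_pi_pos.le]
    exact Set.Icc_subset_Icc hα hβ
  have hcm : Continuous fun k => (starRingEnd ℂ) (mode ω t z k) :=
    Complex.continuous_conj.comp (h.continuous_mode z)
  set D : ℝ → ℂ := fun k => (starRingEnd ℂ) (mode ω t z k) *
        ((s - (Complex.I / 2) • r) k -
          (starRingEnd ℂ) z * mulC (ofRealC ω h.continuous) q k) with hD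
  have hDi : IntervalIntegrable D volume α β := by
    refine IntervalIntegrable.mono_set ?_ hsub
    refine (intervalIntegrable_of_integrable_μ ((integrable_mom (s - (Complex.I / 2) • r)).sub
      ((integrable_mom _).const_mul _))).continuousOn_mul hcm.continuousOn
  have key := integral_eq_sub_of_absolutelyContinuousOnInterval_Ioo
    (f := (fun k => (starRingEnd ℂ) (mode ω t z k)) • g) (D := fun k => Complex.I * D k)
    hαβ ?_ ?_ (hDi.const_mul _) ?_
  · rw [intervalIntegral.integral_const_mul] at key
    simp only [Pi.smul_apply', smul_eq_mul] at key
    rw [← key, ← mul_assoc, neg_mul, Complex.I_mul_I, neg_neg, one_mul]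
  · rw [← Set.uIcc_of_le hαβ]
    exact hcm.continuousOn.smul (hg.continuousOn.mono hsub)
  · intro c hc d hd
    have hcd : Set.uIcc c d ⊆ Set.Ioo α β := (convex_Ioo α β).ordConnected.uIcc_subset hc hd
    have hcd' : Set.uIcc c d ⊆ Set.uIcc α β :=
      hcd.trans (by rw [Set.uIcc_of_le hαβ]; exact Set.Ioo_subset_Icc_self)
    refine AbsolutelyContinuousOnInterval.smul ?_ (hg.mono (hcd'.trans hsub))
    have : ContDiffOn ℝ 1 (mode ω t z) (Set.uIcc c d) := fun k hk =>
      (h.contDiffAt_mode z (hne k (hcd hk))).contDiffWithinAt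
    refine this.absolutelyContinuousOnInterval.of_dist_le fun x _ y _ => ?_
    rw [dist_eq_norm, dist_eq_norm, ← map_sub, Complex.norm_conj]
  · have h1 : ∀ᵐ k ∂μ, k ∈ Set.Ioo α β →
        HasDerivAt ((fun k => (starRingEnd ℂ) (mode ω t z k)) • g) (Complex.I * D k) k := by
      have hr' := coeFn_mulC (ofRealC ω h.continuous) r
      rw [hr] at hr'
      filter_upwards [hqg, hgs, hr', coeFn_mulC (ofRealC ω' h.continuous') q,
        coeFn_mulC (ofRealC ω h.continuous) q, Lp.coeFn_sub s ((Complex.I / 2) • r),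
        Lp.coeFn_smul (Complex.I / 2) r] with k e1 e2 e3 e4 e5 e6 e7 hk
      have hωk := hne k hk
      have hωk' : (ω k : ℂ) ≠ 0 := Complex.ofReal_ne_zero.2 hωk
      have h2 := ((h.hasDerivAt_mode z hωk).star).mul e2
      convert! h2 using 1
      rw [hD]
      simp only
      rw [e4, ofRealC_apply, ofRealC_apply] at e3
      have e8 : r k = ω' k / ω k * q k := by
        field_simp
        linear_combination -e3
      rw [e5, e6, Pi.sub_apply, e7, Pi.smul_apply, e8, e1, ofRealC_apply]
      simp only [Complex.star_def, map_mul, map_add, map_div₀, Complex.conj_I,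
        Complex.conj_ofReal, smul_eq_mul, Complex.conj_ofNat]
      field_simp
      linear_combination (-(starRingEnd ℂ (mode ω t z k)) * (ω' k : ℂ) * g k) * Complex.I_sq
    rw [ae_μ_iff] at h1
    filter_upwards [h1, Measure.ae_ne volume α, Measure.ae_ne volume β] with k h2 h3 h4 h5
    refine h2 (hsub h5) ?_
    rw [Set.uIcc_of_le hαβ] at h5
    exact ⟨lt_of_le_of_ne h5.1 (Ne.symm h3), lt_of_le_of_ne h5.2 h4⟩

open Classical in
/-- The arc modes are defect vectors: the boundary terms at the turning points are zero because the
mode vanishes there, and those at `0` and `2π` cancel. -/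
theorem arcModes_mem (h : IsTwoArc ω ω' t k₁ k₂) (z : ℂ) (c : ℂ × ℂ) :
    h.arcModes z c ∈ defectRel (channelGraph (ofRealC ω h.continuous)
      (ofRealC ω' h.continuous')) z := by
  rintro p ⟨q, s, r, ⟨g, ha, hb, hqg, hgs⟩, h2, h3, h4⟩
  simp only at hqg hgs
  set f : MomSpace1 := mulC (ofRealC ω h.continuous) q with hf
  set y : MomSpace1 := s - (Complex.I / 2) • r with hy
  set D : ℝ → ℂ := fun k => (starRingEnd ℂ) (mode ω t z k) *
        (y k - (starRingEnd ℂ) z * f k) with hD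
  have hDi : IntervalIntegrable D volume 0 (2 * Real.pi) :=
    (intervalIntegrable_of_integrable_μ ((integrable_mom y).sub
      ((integrable_mom f).const_mul _))).continuousOn_mul
      (Complex.continuous_conj.comp (h.continuous_mode z)).continuousOn
  have hk1 := h.nonneg
  have hk2 := h.lt
  have hk3 := h.lt_two_pi
  have i1 := h.integral_arc z ha hqg hgs h3 le_rfl hk1 (hk2.trans hk3).le
    fun k hk => h.ne_zero k hk.1.le (hk.2.trans (hk2.trans hk3)) hk.2.ne (hk.2.trans hk2).ne
  have i2 := h.integral_arc z ha hqg hgs h3 hk1 hk2.le hk3.le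
    fun k hk => h.ne_zero k (hk1.trans hk.1.le) (hk.2.trans hk3) hk.1.ne' hk.2.ne
  have i3 := h.integral_arc z ha hqg hgs h3 (hk1.trans hk2.le) hk3.le le_rfl
    fun k hk => h.ne_zero k ((hk1.trans hk2.le).trans hk.1.le) hk.2 (hk2.trans hk.1).ne' hk.1.ne'
  rw [mode_eq_zero h.eq_zero₁, map_zero, zero_mul] at i1 i2
  rw [mode_eq_zero h.eq_zero₂, map_zero, zero_mul] at i2 i3
  rw [← hb, ← h.mode_zero_eq] at i3
  set X : ℝ → ℂ := fun k => (starRingEnd ℂ) (if k ∈ Set.Ioo k₁ k₂ then c.1 else c.2) * D k with hX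
  have hmono : ∀ a b, 0 ≤ a → a ≤ b → b ≤ 2 * Real.pi → IntervalIntegrable D volume a b := by
    intro a b ha hab hb
    refine hDi.mono_set ?_
    rw [Set.uIcc_of_le hab, Set.uIcc_of_le two_pi_pos.le]
    exact Set.Icc_subset_Icc ha hb
  have j : ∀ a b, 0 ≤ a → a ≤ b → b ≤ 2 * Real.pi → ∀ e : ℂ,
      (∀ k ∈ Set.Ioo a b, (if k ∈ Set.Ioo k₁ k₂ then c.1 else c.2) = e) →
      IntervalIntegrable X volume a b ∧
        ∫ k in a..b, X k = (starRingEnd ℂ) e * ∫ k in a..b, D k := by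
    intro a b ha hab hb e he
    have hae : ∀ᵐ k : ℝ, k ∈ Set.uIoc a b → X k = (starRingEnd ℂ) e * D k := by
      filter_upwards [Measure.ae_ne volume b] with k hk hk'
      rw [Set.uIoc_of_le hab] at hk'
      rw [hX]
      simp only
      rw [he k ⟨hk'.1, lt_of_le_of_ne hk'.2 hk⟩]
    have hi : IntervalIntegrable (fun k => (starRingEnd ℂ) e * D k) volume a b :=
      (hmono a b ha hab hb).const_mul _
    refine ⟨hi.congr_ae ?_, ?_⟩
    · rw [Filter.EventuallyEq, ae_restrict_iff' measurableSet_uIoc]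
      filter_upwards [hae] with k hk hk' using (hk hk').symm
    · rw [intervalIntegral.integral_congr_ae hae, intervalIntegral.integral_const_mul]
  obtain ⟨a1, b1⟩ := j 0 k₁ le_rfl hk1 (hk2.trans hk3).le c.2
    fun k hk => if_neg fun h' => lt_asymm h'.1 hk.2
  obtain ⟨a2, b2⟩ := j k₁ k₂ hk1 hk2.le hk3.le c.1 fun k hk => if_pos hk
  obtain ⟨a3, b3⟩ := j k₂ (2 * Real.pi) (hk1.trans hk2.le) hk3.le le_rfl c.2
    fun k hk => if_neg fun h' => lt_asymm h'.2 hk.1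
  have hXI : ∫ k in (0 : ℝ)..(2 * Real.pi), X k = 0 := by
    rw [← intervalIntegral.integral_add_adjacent_intervals (a1.trans a2) a3,
      ← intervalIntegral.integral_add_adjacent_intervals a1 a2, b1, b2, b3, i1, i2, i3]
    ring
  rw [h2, h4, inner_smul_left, ← inner_conj_symm, ← inner_conj_symm _ f]
  rw [inner_conj_symm, inner_conj_symm, ← sub_eq_zero, ← inner_smul_right, ← inner_sub_right,
    inner_mom]
  have hXμ : ∀ᵐ k ∂μ, (starRingEnd ℂ) (h.arcModes z c k) *
      (y - (starRingEnd ℂ) z • f : MomSpace1) k = X k := by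
    filter_upwards [h.coeFn_arcModes z c, Lp.coeFn_sub y ((starRingEnd ℂ) z • f),
      Lp.coeFn_smul ((starRingEnd ℂ) z) f] with k e1 e2 e3
    rw [e1, e2, Pi.sub_apply, e3, Pi.smul_apply, map_mul, smul_eq_mul, mul_assoc]
  rw [integral_congr_ae hXμ, integral_μ, hXI, smul_zero]

/-- On an interval without turning point the weak solutions `u = ω v` are multiples of `ω ψ`. -/
theorem div_mode_eq (h : IsTwoArc ω ω' t k₁ k₂) (z : ℂ) {v : MomSpace1} {g D : ℝ → ℂ}
    (hg : AbsolutelyContinuousOnInterval g 0 (2 * Real.pi))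
    (hgv : ∀ᵐ k ∂μ, g k = ω k * v k) (hgd : ∀ᵐ k ∂μ, HasDerivAt g (D k) k)
    (hD : ∀ᵐ k ∂μ, D k = (Complex.I * z * ω k ^ 2 + 3 / 2 * ω' k) * v k)
    {α β : ℝ} (hα : 0 ≤ α) (hαβ : α ≤ β) (hβ : β ≤ 2 * Real.pi)
    (hne : ∀ k ∈ Set.Icc α β, ω k ≠ 0) :
    g α / (ω α * mode ω t z α) = g β / (ω β * mode ω t z β) := by
  have hsub : Set.uIcc α β ⊆ Set.uIcc 0 (2 * Real.pi) := by
    rw [Set.uIcc_of_le hαβ, Set.uIcc_of_le two_pi_pos.le]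
    exact Set.Icc_subset_Icc hα hβ
  set N : ℝ → ℂ := fun k => (ω k * mode ω t z k)⁻¹ with hN
  have hN0 : ∀ k ∈ Set.uIcc α β, (ω k : ℂ) * mode ω t z k ≠ 0 := fun k hk => by
    rw [Set.uIcc_of_le hαβ] at hk
    exact mul_ne_zero (Complex.ofReal_ne_zero.2 (hne k hk)) (mode_ne_zero (hne k hk))
  have hNc : ContDiffOn ℝ 1 N (Set.uIcc α β) := fun k hk => by
    have hk' := hk
    rw [Set.uIcc_of_le hαβ] at hk'
    refine ContDiffAt.contDiffWithinAt (ContDiffAt.inv (ContDiffAt.mul ?_ ?_) (hN0 k hk))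
    · exact Complex.ofRealCLM.contDiff.contDiffAt.comp k h.contDiff.contDiffAt
    · exact h.contDiffAt_mode z (hne k hk')
  obtain ⟨C, hC⟩ := (hNc.absolutelyContinuousOnInterval.smul
    (hg.mono hsub)).const_of_ae_hasDerivAt_zero (by
      have h1 := hgv.and (hgd.and hD)
      rw [ae_μ_iff] at h1
      filter_upwards [h1] with k hk hk'
      obtain ⟨e1, e2, e3⟩ := hk (hsub hk')
      have hk0 := hN0 k hk'
      rw [Set.uIcc_of_le hαβ] at hk'
      have hωk : (ω k : ℂ) ≠ 0 := Complex.ofReal_ne_zero.2 (hne k hk')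
      have hm0 := mode_ne_zero (t := t) (z := z) (hne k hk')
      have d1 := (((h.hasDerivAt k).ofReal_comp.mul (h.hasDerivAt_mode z (hne k hk'))).inv hk0).mul
        e2
      convert! d1 using 1
      simp only [Pi.mul_apply, Pi.inv_apply]
      rw [e3, e1]
      field_simp
      ring)
  have h1 := hC α Set.left_mem_uIcc
  have h2 := hC β Set.right_mem_uIcc
  simp only [Pi.smul_apply', smul_eq_mul, hN] at h1 h2
  rw [div_eq_inv_mul, div_eq_inv_mul, h1, h2]

/-- Every defect vector is a combination of the arc modes: it solves the differential equation of
the mode weakly on each arc, so its quotient by the mode is constant there. -/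
theorem exists_arcModes_eq (h : IsTwoArc ω ω' t k₁ k₂) (z : ℂ) {v : MomSpace1}
    (hv : v ∈ defectRel (channelGraph (ofRealC ω h.continuous) (ofRealC ω' h.continuous')) z) :
    ∃ c, h.arcModes z c = v := by
  classical
  set w := ofRealC ω h.continuous with hw
  set w' := ofRealC ω' h.continuous' with hw'
  have hs : IsSpeed w w' := h.isSpeed
  -- testing against the elements `w² f` shows that `w v` lies in the domain of `P`
  have hP : (mulC w v, z • mulC w (mulC w v) - (3 * Complex.I / 2) • mulC w' v) ∈ graphP := by
    refine mem_graphP_of_forall_inner fun p hp => ?_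
    have h1 := hv _ (mem_channelGraph_of_graphP hs (h := p.1) (p := p.2) hp)
    simp only [inner_sub_right, inner_smul_right,
      ← inner_mulC_left hs.conj_eq, ← inner_mulC_left hs.conj_deriv] at h1
    rw [map_smul, map_smul, inner_smul_left] at h1
    rw [inner_sub_left, inner_smul_left, inner_smul_left]
    have hc : (starRingEnd ℂ) (3 * Complex.I / 2) = -(3 * Complex.I / 2) := by
      rw [map_div₀, map_mul, Complex.conj_I, Complex.conj_ofNat, Complex.conj_ofNat]
      ring
    rw [hc]
    linear_combination h1
  obtain ⟨g, ha, hb, hc, hd⟩ := hP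
  simp only at hc hd
  have hgv : ∀ᵐ k ∂μ, g k = ω k * v k := by
    filter_upwards [hc, coeFn_mulC w v] with k e1 e2
    rw [← e1, e2]
    rfl
  have hD : ∀ᵐ k ∂μ, Complex.I * (z • mulC w (mulC w v) -
      (3 * Complex.I / 2) • mulC w' v : MomSpace1) k =
      (Complex.I * z * ω k ^ 2 + 3 / 2 * ω' k) * v k := by
    filter_upwards [Lp.coeFn_sub (z • mulC w (mulC w v)) ((3 * Complex.I / 2) • mulC w' v),
      Lp.coeFn_smul z (mulC w (mulC w v)), Lp.coeFn_smul (3 * Complex.I / 2) (mulC w' v),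
      coeFn_mulC w (mulC w v), coeFn_mulC w v, coeFn_mulC w' v] with k e1 e2 e3 e4 e5 e6
    rw [e1, Pi.sub_apply, e2, e3, Pi.smul_apply, Pi.smul_apply, e4, e5, e6, hw, hw',
      ofRealC_apply, ofRealC_apply, smul_eq_mul, smul_eq_mul]
    linear_combination (-3 / 2 * (ω' k : ℂ) * v k) * Complex.I_sq
  have key := fun {α β : ℝ} => h.div_mode_eq z ha hgv hd hD (α := α) (β := β)
  set G : ℝ → ℂ := fun k => g k / (ω k * mode ω t z k) with hG
  have hk1 := h.nonneg
  have hk2 := h.lt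
  have hk3 := h.lt_two_pi
  set m₁ := (k₁ + k₂) / 2 with hm₁
  set m₂ := (k₂ + 2 * Real.pi) / 2 with hm₂
  have hin : ∀ k ∈ Set.Ioo k₁ k₂, G k = G m₁ := by
    intro k hk
    have hne : ∀ x ∈ Set.Ioo k₁ k₂, ω x ≠ 0 := fun x hx =>
      h.ne_zero x (hk1.trans hx.1.le) (hx.2.trans hk3) hx.1.ne' hx.2.ne
    have hm : m₁ ∈ Set.Ioo k₁ k₂ := ⟨by rw [hm₁]; linarith, by rw [hm₁]; linarith⟩
    rcases le_total k m₁ with hle | hle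
    · exact key (hk1.trans hk.1.le) hle (hm.2.trans hk3).le fun x hx =>
        hne x ⟨hk.1.trans_le hx.1, hx.2.trans_lt hm.2⟩
    · exact (key (hk1.trans hm.1.le) hle (hk.2.trans hk3).le fun x hx =>
        hne x ⟨hm.1.trans_le hx.1, hx.2.trans_lt hk.2⟩).symm
  have hm2 : m₂ ∈ Set.Ioo k₂ (2 * Real.pi) := ⟨by rw [hm₂]; linarith, by rw [hm₂]; linarith⟩
  have hne2 : ∀ x ∈ Set.Ioo k₂ (2 * Real.pi), ω x ≠ 0 := fun x hx =>
    h.ne_zero x ((hk1.trans hk2.le).trans hx.1.le) hx.2 (hk2.trans hx.1).ne' hx.1.ne'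
  have hout2 : ∀ k ∈ Set.Ioo k₂ (2 * Real.pi), G k = G m₂ := by
    intro k hk
    rcases le_total k m₂ with hle | hle
    · exact key ((hk1.trans hk2.le).trans hk.1.le) hle hm2.2.le fun x hx =>
        hne2 x ⟨hk.1.trans_le hx.1, hx.2.trans_lt hm2.2⟩
    · exact (key ((hk1.trans hk2.le).trans hm2.1.le) hle hk.2.le fun x hx =>
        hne2 x ⟨hm2.1.trans_le hx.1, hx.2.trans_lt hk.2⟩).symm
  -- the two ends of the outer arc are glued at `0 = 2π` by periodicity
  have hout1 : ∀ k ∈ Set.Ioo 0 k₁, G k = G m₂ := by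
    intro k hk
    have hk1' : 0 < k₁ := hk.1.trans hk.2
    have h0 : ω 0 ≠ 0 := h.ne_zero 0 le_rfl two_pi_pos hk1'.ne (hk1'.trans hk2).ne
    have e1 : G 0 = G k := key le_rfl hk.1.le ((hk.2.trans hk2).trans hk3).le fun x hx =>
      h.ne_zero x hx.1 ((hx.2.trans_lt (hk.2.trans hk2)).trans hk3) (hx.2.trans_lt hk.2).ne
        (hx.2.trans_lt (hk.2.trans hk2)).ne
    have e2 : G m₂ = G (2 * Real.pi) := key ((hk1.trans hk2.le).trans hm2.1.le) hm2.2.le le_rfl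
      fun x hx => by
        rcases hx.2.eq_or_lt with e | e
        · rw [e, ← h.periodic]
          exact h0
        · exact hne2 x ⟨hm2.1.trans_le hx.1, e⟩
    have e3 : G 0 = G (2 * Real.pi) := by
      simp only [hG]
      rw [hb, h.periodic, h.mode_zero_eq]
    rw [← e1, e3, e2]
  refine ⟨(G m₁, G m₂), Lp.ext ?_⟩
  filter_upwards [h.coeFn_arcModes z (G m₁, G m₂), hgv, ae_μ_Ioo, ae_ne_μ k₁, ae_ne_μ k₂]
    with k e1 e2 e3 e4 e5
  have hωk := h.ne_zero k e3.1.le e3.2 e4 e5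
  have hωk' : (ω k : ℂ) ≠ 0 := Complex.ofReal_ne_zero.2 hωk
  have hm0 := mode_ne_zero (t := t) (z := z) hωk
  have hGk : (if k ∈ Set.Ioo k₁ k₂ then G m₁ else G m₂) = G k := by
    split_ifs with hk
    · exact (hin k hk).symm
    · rcases lt_or_gt_of_ne e4 with hlt | hgt
      · exact (hout1 k ⟨e3.1, hlt⟩).symm
      · have : k₂ < k := by
          refine lt_of_le_of_ne (not_lt.1 fun h' => hk ⟨hgt, h'⟩) (Ne.symm e5)
        exact (hout2 k ⟨this, e3.2⟩).symm
  rw [e1, hGk]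
  simp only [hG]
  rw [e2]
  field_simp

/-- The defect spaces of a channel with two turning points are two-dimensional, one dimension for
each arc. -/
def defectEquiv (h : IsTwoArc ω ω' t k₁ k₂) (z : ℂ) :
    (ℂ × ℂ) ≃ₗ[ℂ] defectRel (channelGraph (ofRealC ω h.continuous)
      (ofRealC ω' h.continuous')) z :=
  LinearEquiv.ofBijective ((h.arcModes z).codRestrict _ (h.arcModes_mem z))
    ⟨fun _ _ hab => h.arcModes_injective z (congrArg Subtype.val hab), fun v => by
      obtain ⟨c, hc⟩ := h.exists_arcModes_eq z v.2
      exact ⟨c, Subtype.ext hc⟩⟩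

end IsTwoArc

/-! ### Decomposition of the momentum space into channels -/

theorem coeFn_component (j : Fin 2) (f : MomSpace) : component j f =ᵐ[μ] fun k => f k j :=
  ContinuousLinearMap.coeFn_compLpL _ f

theorem coeFn_inclusion (j : Fin 2) (f : MomSpace1) :
    inclusion j f =ᵐ[μ] fun k => f k • (EuclideanSpace.single j 1 : C2) :=
  ContinuousLinearMap.coeFn_compLpL _ f

theorem component_ext {f g : MomSpace} (h : ∀ j, component j f = component j g) : f = g := by
  refine Lp.ext ?_
  filter_upwards [coeFn_component 0 f, coeFn_component 0 g, coeFn_component 1 f,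
    coeFn_component 1 g] with k h1 h2 h3 h4
  rw [h 0] at h1
  rw [h 1] at h3
  ext j
  fin_cases j
  · exact h1.symm.trans h2
  · exact h3.symm.trans h4

theorem component_inclusion (i j : Fin 2) (f : MomSpace1) :
    component i (inclusion j f) = if i = j then f else 0 := by
  refine Lp.ext ?_
  filter_upwards [coeFn_component i (inclusion j f), coeFn_inclusion j f,
    Lp.coeFn_zero ℂ 2 μ] with k h1 h2 h3
  rw [h1, h2]
  split_ifs with hij
  · simp [hij]
  · rw [h3]
    simp [hij]

theorem component_sum_inclusion (i : Fin 2) (F : Fin 2 → MomSpace1) :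
    component i (∑ j, inclusion j (F j)) = F i := by
  simp only [map_sum, component_inclusion, Finset.sum_ite_eq, Finset.mem_univ, if_true]

theorem inner_eq_sum_component (f g : MomSpace) :
    inner ℂ f g = ∑ j, inner ℂ (component j f) (component j g) := by
  simp only [L2.inner_def]
  rw [← integral_finsetSum _ fun j _ => L2.integrable_inner _ _]
  refine integral_congr_ae ?_
  filter_upwards [coeFn_component 0 f, coeFn_component 0 g, coeFn_component 1 f,
    coeFn_component 1 g] with k h1 h2 h3 h4
  rw [Fin.sum_univ_two, h1, h2, h3, h4, PiLp.inner_apply, Fin.sum_univ_two]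

theorem mem_graph_diagOp {A : Fin 2 → MomSpace1 →ₗ.[ℂ] MomSpace1} {f g : MomSpace} :
    (f, g) ∈ (diagOp A).graph ↔ ∀ j, (component j f, component j g) ∈ (A j).graph := by
  constructor
  · intro h j
    obtain ⟨x, rfl, rfl⟩ := (LinearPMap.mem_graph_iff _).1 h
    have e : component j (diagOp A x) =
        A j ⟨component j x.1, (Submodule.mem_iInf _).1 x.2 j⟩ :=
      component_sum_inclusion j
        (fun j => A j ⟨component j x.1, (Submodule.mem_iInf _).1 x.2 j⟩)
    rw [e]
    exact (A j).mem_graph ⟨component j x.1, _⟩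
  · intro h
    have hf : f ∈ (diagOp A).domain :=
      (Submodule.mem_iInf _).2 fun j => LinearPMap.mem_domain_of_mem_graph (h j)
    have e : diagOp A ⟨f, hf⟩ = g := by
      refine component_ext fun j => ?_
      rw [show component j (diagOp A ⟨f, hf⟩) =
        A j ⟨component j f, (Submodule.mem_iInf _).1 hf j⟩ from component_sum_inclusion j
        (fun j => A j ⟨component j f, (Submodule.mem_iInf _).1 hf j⟩)]
      exact ((LinearPMap.image_iff _).2 (h j)).symm
    rw [← e]
    exact (diagOp A).mem_graph ⟨f, hf⟩

theorem mem_graph_unitaryConj {H K : Type*} [NormedAddCommGroup H] [InnerProductSpace ℂ H]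
    [CompleteSpace H] [NormedAddCommGroup K] [InnerProductSpace ℂ K] [CompleteSpace K]
    {V : H ≃ₗᵢ[ℂ] K} {A : K →ₗ.[ℂ] K} {x y : H} :
    (x, y) ∈ (unitaryConj V A).graph ↔ (V x, V y) ∈ A.graph := by
  constructor
  · intro h
    obtain ⟨x, rfl, rfl⟩ := (LinearPMap.mem_graph_iff _).1 h
    change (V x, V (V.symm (A ⟨V x, x.2⟩))) ∈ A.graph
    rw [LinearIsometryEquiv.apply_symm_apply]
    exact A.mem_graph ⟨V x, x.2⟩
  · intro h
    have hx : V x ∈ A.domain := LinearPMap.mem_domain_of_mem_graph h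
    have e : unitaryConj V A ⟨x, hx⟩ = y := by
      change V.symm (A ⟨V x, hx⟩) = y
      rw [LinearIsometryEquiv.symm_apply_eq]
      exact ((LinearPMap.image_iff hx).2 h).symm
    rw [← e]
    exact (unitaryConj V A).mem_graph ⟨x, hx⟩

/-! ### Operators that decompose into two channels -/

/-- `T` is unitarily equivalent, through `V`, to the orthogonal sum of the relations `G 0` and
`G 1`. -/
def IsChannelSum (V : PosSpace ≃ₗᵢ[ℂ] MomSpace) (G : Fin 2 → Submodule ℂ (MomSpace1 × MomSpace1))
    (T : PosSpace →ₗ.[ℂ] PosSpace) : Prop :=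
  ∀ x y, (x, y) ∈ T.graph ↔ ∀ j, (component j (V x), component j (V y)) ∈ G j

/-- The vector with prescribed channel components. -/
def assemble (V : PosSpace ≃ₗᵢ[ℂ] MomSpace) : (Fin 2 → MomSpace1) →ₗ[ℂ] PosSpace :=
  V.symm.toLinearEquiv.toLinearMap.comp
    (∑ j, (inclusion j).toLinearMap.comp (LinearMap.proj j))

theorem component_assemble (V : PosSpace ≃ₗᵢ[ℂ] MomSpace) (F : Fin 2 → MomSpace1) (i : Fin 2) :
    component i (V (assemble V F)) = F i := by
  have : assemble V F = V.symm (∑ j, inclusion j (F j)) := by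
    change V.symm ((∑ j, (inclusion j).toLinearMap.comp (LinearMap.proj j)) F) = _
    rw [LinearMap.sum_apply]
    rfl
  rw [this, LinearIsometryEquiv.apply_symm_apply, component_sum_inclusion]

theorem component_conj_ext (V : PosSpace ≃ₗᵢ[ℂ] MomSpace) {x y : PosSpace}
    (h : ∀ j, component j (V x) = component j (V y)) : x = y :=
  V.injective (component_ext h)

theorem inner_eq_sum (V : PosSpace ≃ₗᵢ[ℂ] MomSpace) (x y : PosSpace) :
    inner ℂ x y = ∑ j, inner ℂ (component j (V x)) (component j (V y)) := by
  rw [← V.inner_map_map, inner_eq_sum_component]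

namespace IsChannelSum

variable {V : PosSpace ≃ₗᵢ[ℂ] MomSpace} {G : Fin 2 → Submodule ℂ (MomSpace1 × MomSpace1)}
  {T : PosSpace →ₗ.[ℂ] PosSpace}

theorem assemble_mem (h : IsChannelSum V G T) {F F' : Fin 2 → MomSpace1}
    (hF : ∀ j, (F j, F' j) ∈ G j) : (assemble V F, assemble V F') ∈ T.graph := by
  rw [h]
  intro j
  rw [component_assemble, component_assemble]
  exact hF j

theorem single_mem (h : IsChannelSum V G T) {j : Fin 2} {p : MomSpace1 × MomSpace1}
    (hp : p ∈ G j) :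
    (assemble V (Pi.single j p.1), assemble V (Pi.single j p.2)) ∈ T.graph := by
  refine h.assemble_mem fun i => ?_
  rcases eq_or_ne i j with rfl | hij
  · simpa using hp
  · rw [Pi.single_eq_of_ne hij, Pi.single_eq_of_ne hij]
    exact (G i).zero_mem

theorem inner_single (V : PosSpace ≃ₗᵢ[ℂ] MomSpace) (x : PosSpace) (j : Fin 2) (f : MomSpace1) :
    inner ℂ x (assemble V (Pi.single j f)) = inner ℂ (component j (V x)) f := by
  rw [inner_eq_sum V, Finset.sum_eq_single j]
  · rw [component_assemble, Pi.single_eq_same]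
  · intro i _ hij
    rw [component_assemble, Pi.single_eq_of_ne hij, inner_zero_right]
  · simp

theorem isSymmRel (h : IsChannelSum V G T) (hG : ∀ j, IsSymmRel (G j)) : IsSymmRel T.graph := by
  rintro ⟨x, y⟩ hp ⟨x', y'⟩ hq
  rw [inner_eq_sum V, inner_eq_sum V]
  exact Finset.sum_congr rfl fun j _ => hG j _ ((h _ _).1 hp j) _ ((h _ _).1 hq j)

theorem dense_domain (h : IsChannelSum V G T)
    (hG : ∀ j v, (∀ p ∈ G j, inner ℂ v p.1 = 0) → v = 0) : Dense (T.domain : Set PosSpace) := by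
  rw [Submodule.dense_iff_topologicalClosure_eq_top, Submodule.topologicalClosure_eq_top_iff,
    Submodule.eq_bot_iff]
  intro x hx
  refine component_conj_ext V fun j => ?_
  rw [map_zero, map_zero]
  refine hG j _ fun p hp => ?_
  rw [← inner_single]
  exact (Submodule.mem_orthogonal' _ _).1 hx _
    (LinearPMap.mem_domain_of_mem_graph (h.single_mem hp))

theorem surjective_sub (h : IsChannelSum V G T) {z : ℂ}
    (hG : ∀ j y, ∃ p ∈ G j, p.2 - z • p.1 = y) (y : PosSpace) :
    ∃ p ∈ T.graph, p.2 - z • p.1 = y := by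
  choose p hp he using fun j => hG j (component j (V y))
  refine ⟨_, h.assemble_mem hp, ?_⟩
  refine component_conj_ext V fun j => ?_
  simp only [map_sub, map_smul, component_assemble, he]

theorem mem_defectRel_iff (h : IsChannelSum V G T) {z : ℂ} {x : PosSpace} :
    x ∈ defectRel T.graph z ↔ ∀ j, component j (V x) ∈ defectRel (G j) z := by
  constructor
  · intro hx j p hp
    have := hx _ (h.single_mem hp)
    rwa [inner_single, inner_single, map_smul, map_smul] at this
  · rintro hx ⟨y, y'⟩ hp
    rw [inner_eq_sum V, inner_eq_sum V]
    refine Finset.sum_congr rfl fun j _ => ?_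
    rw [map_smul, map_smul]
    exact hx j _ ((h _ _).1 hp j)

/-- The defect space of an orthogonal sum is the product of the defect spaces of the channels. -/
def defectEquiv (h : IsChannelSum V G T) (z : ℂ) :
    defectRel T.graph z ≃ₗ[ℂ] (j : Fin 2) → defectRel (G j) z where
  toFun x := fun j => ⟨component j (V x), h.mem_defectRel_iff.1 x.2 j⟩
  map_add' x y := by
    ext1 j
    exact Subtype.ext (by simp)
  map_smul' c x := by
    ext1 j
    exact Subtype.ext (by simp)
  invFun F := ⟨assemble V fun j => F j, h.mem_defectRel_iff.2 fun j => by
    rw [component_assemble]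
    exact (F j).2⟩
  left_inv x := Subtype.ext (component_conj_ext V fun j => component_assemble V _ j)
  right_inv F := by
    ext1 j
    exact Subtype.ext (component_assemble V _ j)

end IsChannelSum

/-! ### The walk in momentum space -/

variable {C : Matrix.unitaryGroup (Fin 2) ℂ}

theorem symbol_mem_unitaryGroup (C : Matrix.unitaryGroup (Fin 2) ℂ) (k : ℝ) :
    symbol C k ∈ Matrix.unitaryGroup (Fin 2) ℂ := by
  refine mul_mem ?_ C.2
  rw [Matrix.mem_unitaryGroup_iff, Matrix.star_eq_conjTranspose, Matrix.diagonal_conjTranspose,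
    Matrix.diagonal_mul_diagonal, ← Matrix.diagonal_one]
  congr 1
  ext i
  fin_cases i <;> simp [← Complex.exp_conj, ← Complex.exp_add]

/-- The symbol as a field of unitary matrices. -/
def symbolU (C : Matrix.unitaryGroup (Fin 2) ℂ) (k : ℝ) : Matrix.unitaryGroup (Fin 2) ℂ :=
  ⟨symbol C k, symbol_mem_unitaryGroup C k⟩

theorem symbol_apply (C : Matrix.unitaryGroup (Fin 2) ℂ) (k : ℝ) (i j : Fin 2) :
    symbol C k i j =
      ![Complex.exp (Complex.I * k), Complex.exp (-Complex.I * k)] i *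
        (C : Matrix (Fin 2) (Fin 2) ℂ) i j := by
  rw [symbol, Matrix.diagonal_mul]

theorem measurable_symbolU (C : Matrix.unitaryGroup (Fin 2) ℂ) (i j : Fin 2) :
    Measurable fun k => (symbolU C k : Matrix (Fin 2) (Fin 2) ℂ) i j := by
  change Measurable fun k => symbol C k i j
  simp only [symbol_apply]
  refine Measurable.mul_const ?_ _
  fin_cases i
  · change Measurable fun k : ℝ => Complex.exp (Complex.I * k)
    exact Continuous.measurable (by fun_prop)
  · change Measurable fun k : ℝ => Complex.exp (-Complex.I * k)
    exact Continuous.measurable (by fun_prop)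

theorem coeFn_mulMat (M : ℝ → Matrix.unitaryGroup (Fin 2) ℂ)
    (hM : ∀ i j, Measurable fun k => (M k : Matrix (Fin 2) (Fin 2) ℂ) i j) (f : MomSpace) :
    mulMat M hM f =ᵐ[μ] fun k => matIso (M k) (f k) :=
  (memLp_matIso hM f).coeFn_toLp

theorem coeFn_wave (x : ℤ) (v : C2) :
    wave x v =ᵐ[μ] fun k : ℝ => Complex.exp (-Complex.I * x * k) • v :=
  (memLp_wave x v).coeFn_toLp

theorem fourier_single (x : ℤ) (v : C2) : fourier (lp.single 2 x v) = wave x v :=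
  isHilbertSum_wave.linearIsometryEquiv_symm_apply_single v

theorem evolution_single (C : Matrix.unitaryGroup (Fin 2) ℂ) (x : ℤ) (v : C2) :
    evolution C (lp.single 2 x v) =
      lp.single 2 (x - 1) (EuclideanSpace.single 0 (matIso C v 0)) +
        lp.single 2 (x + 1) (EuclideanSpace.single 1 (matIso C v 1)) := by
  have hc : ∀ y, coin C (lp.single 2 x v) y =
      lp.single (E := fun _ : ℤ => C2) 2 x (matIso C v) y := by
    intro y
    change matIso C (lp.single (E := fun _ : ℤ => C2) 2 x v y) = _
    rw [lp.single_apply, lp.single_apply]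
    rcases eq_or_ne y x with rfl | h
    · simp
    · simp [h]
  ext1
  funext y
  change (!₂[coin C (lp.single 2 x v) (y + 1) 0, coin C (lp.single 2 x v) (y - 1) 1] : C2) =
    lp.single (E := fun _ : ℤ => C2) 2 (x - 1) (EuclideanSpace.single 0 (matIso C v 0)) y +
      lp.single (E := fun _ : ℤ => C2) 2 (x + 1) (EuclideanSpace.single 1 (matIso C v 1)) y
  rw [hc, hc]
  have hsa : ∀ (a b : ℤ) (u : C2) (i : Fin 2),
      (lp.single (E := fun _ : ℤ => C2) 2 a u b) i = if b = a then u i else 0 := by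
    intro a b u i
    rw [lp.single_apply, Pi.single_apply]
    split_ifs <;> simp
  ext i
  rw [PiLp.add_apply]
  have e₁ : y + 1 = x ↔ y = x - 1 := eq_sub_iff_add_eq.symm
  simp only [hsa, e₁, sub_eq_iff_eq_add]
  fin_cases i <;> simp

/-- In momentum space the walk is multiplication by its symbol. -/
theorem fourier_evolution (C : Matrix.unitaryGroup (Fin 2) ℂ) (ψ : PosSpace) :
    fourier (evolution C ψ) =
      mulMat (symbolU C) (measurable_symbolU C) (fourier ψ) := by
  let A : PosSpace →L[ℂ] MomSpace :=
    ((evolution C).trans fourier).toContinuousLinearEquiv.toContinuousLinearMap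
  let B : PosSpace →L[ℂ] MomSpace := (fourier.trans
    (mulMat (symbolU C) (measurable_symbolU C))).toContinuousLinearEquiv.toContinuousLinearMap
  have hAB : A = B := by
    refine lp.ext_continuousLinearMap (by norm_num) fun x => ?_
    ext1 v
    change fourier (evolution C (lp.single 2 x v)) =
      mulMat (symbolU C) (measurable_symbolU C) (fourier (lp.single 2 x v))
    rw [evolution_single, map_add, fourier_single, fourier_single, fourier_single]
    refine Lp.ext ?_
    filter_upwards [coeFn_mulMat (symbolU C) (measurable_symbolU C) (wave x v),
      coeFn_wave x v, coeFn_wave (x - 1) (EuclideanSpace.single 0 (matIso C v 0)),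
      coeFn_wave (x + 1) (EuclideanSpace.single 1 (matIso C v 1)),
      Lp.coeFn_add (wave (x - 1) (EuclideanSpace.single 0 (matIso C v 0)))
        (wave (x + 1) (EuclideanSpace.single 1 (matIso C v 1)))] with k h1 h2 h3 h4 h5
    rw [h1, h2, h5, Pi.add_apply, h3, h4]
    have hs : ∀ i, matIso (symbolU C k) v i =
        ![Complex.exp (Complex.I * k), Complex.exp (-Complex.I * k)] i * matIso C v i := by
      intro i
      rw [matIso_apply, matIso_apply, Finset.mul_sum]
      refine Finset.sum_congr rfl fun j _ => ?_
      change symbol C k i j * v j = _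
      rw [symbol_apply, mul_assoc]
    rw [map_smul]
    ext i
    rw [PiLp.smul_apply, hs]
    fin_cases i
    · simp
      rw [← mul_assoc, ← Complex.exp_add]
      congr 2
      ring
    · simp
      rw [← mul_assoc, ← Complex.exp_add]
      congr 2
      ring
  exact congrArg (fun L : PosSpace →L[ℂ] MomSpace => L ψ) hAB

namespace Diagonalization

/-- The unitary map `W⁻¹ ℱ` that diagonalizes the walk. -/
def toMom (Δ : Diagonalization C) : PosSpace ≃ₗᵢ[ℂ] MomSpace :=
  fourier.trans (mulMat Δ.W Δ.measurable).symm

/-- The eigenvalues as bundled continuous functions. -/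
def eigenvalueC (Δ : Diagonalization C) (j : Fin 2) : C(ℝ, ℂ) :=
  ⟨Δ.eigenvalue j, continuous_iff_continuousAt.2 fun k =>
    (Δ.analytic j k (Set.mem_univ k)).continuousAt⟩

theorem symbol_mul_W (Δ : Diagonalization C) (k : ℝ) :
    symbol C k * (Δ.W k : Matrix (Fin 2) (Fin 2) ℂ) =
      (Δ.W k : Matrix (Fin 2) (Fin 2) ℂ) * Matrix.diagonal fun j => Δ.eigenvalue j k := by
  rw [← Δ.diagonalizes k, ← mul_assoc, ← mul_assoc, ← Submonoid.coe_mul, mul_inv_cancel,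
    Submonoid.coe_one, one_mul]

/-- In the channel `j` the walk is multiplication by the eigenvalue `λ_j`. -/
theorem component_toMom_evolution (Δ : Diagonalization C) (ψ : PosSpace) (j : Fin 2) :
    component j (Δ.toMom (evolution C ψ)) = mulC (Δ.eigenvalueC j) (component j (Δ.toMom ψ)) := by
  set f := Δ.toMom ψ with hf
  set g : MomSpace := ∑ j, inclusion j (mulC (Δ.eigenvalueC j) (component j f)) with hg
  have hgj : ∀ j, component j g = mulC (Δ.eigenvalueC j) (component j f) :=
    fun j => component_sum_inclusion j _
  have hψ : fourier ψ = mulMat Δ.W Δ.measurable f := by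
    rw [hf, toMom, LinearIsometryEquiv.trans_apply, LinearIsometryEquiv.apply_symm_apply]
  have key : mulMat (symbolU C) (measurable_symbolU C) (mulMat Δ.W Δ.measurable f) =
      mulMat Δ.W Δ.measurable g := by
    refine Lp.ext ?_
    have hc : ∀ j, ∀ᵐ k ∂μ, g k j = Δ.eigenvalue j k * f k j := by
      intro j
      filter_upwards [coeFn_component j g, coeFn_component j f,
        coeFn_mulC (Δ.eigenvalueC j) (component j f)] with k h1 h2 h3
      rw [← h1, hgj, h3, h2]
      rfl
    filter_upwards [coeFn_mulMat (symbolU C) (measurable_symbolU C) (mulMat Δ.W Δ.measurable f),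
      coeFn_mulMat Δ.W Δ.measurable f, coeFn_mulMat Δ.W Δ.measurable g, hc 0, hc 1]
      with k h1 h2 h3 h4 h5
    rw [h1, h2, h3]
    ext i
    have e0 := congrFun (congrFun (Δ.symbol_mul_W k) i) 0
    have e1 := congrFun (congrFun (Δ.symbol_mul_W k) i) 1
    simp only [Matrix.mul_diagonal] at e0 e1
    simp only [Matrix.mul_apply, Fin.sum_univ_two] at e0 e1
    simp only [matIso_apply, Fin.sum_univ_two]
    change symbol C k i 0 * _ + symbol C k i 1 * _ = _
    rw [h4, h5]
    linear_combination f k 0 * e0 + f k 1 * e1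
  rw [← hgj]
  congr 1
  rw [toMom, LinearIsometryEquiv.trans_apply, fourier_evolution, hψ, key,
    LinearIsometryEquiv.symm_apply_apply]

theorem isChannelSum (Δ : Diagonalization C) :
    IsChannelSum Δ.toMom (fun j => (timeOp1 (Δ.eigenvalue j)).graph) (timeOperator Δ) := by
  intro x y
  rw [timeOperator, mem_graph_unitaryConj, mem_graph_diagOp]
  rfl

end Diagonalization

/-! ### The dispersion relation -/

/-- The entries of a unitary matrix `C` in terms of a square root `m` of `det C`: the diagonal
entries of `C / m` are complex conjugate to each other. -/
theorem exists_coin_phases (C : Matrix.unitaryGroup (Fin 2) ℂ) :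
    ∃ (m : ℂ) (θ : ℝ), ‖m‖ = 1 ∧ m ^ 2 = (C : Matrix (Fin 2) (Fin 2) ℂ).det ∧
      (C : Matrix (Fin 2) (Fin 2) ℂ) 0 0 =
        m * (‖(C : Matrix (Fin 2) (Fin 2) ℂ) 0 0‖ * Complex.exp (Complex.I * θ)) ∧
      (C : Matrix (Fin 2) (Fin 2) ℂ) 1 1 =
        m * (‖(C : Matrix (Fin 2) (Fin 2) ℂ) 0 0‖ * Complex.exp (-(Complex.I * θ))) := by
  set M := (C : Matrix (Fin 2) (Fin 2) ℂ) with hM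
  obtain ⟨m, hm⟩ := IsAlgClosed.exists_pow_nat_eq M.det (n := 2) (by norm_num)
  have hM1 : star M * M = 1 := Matrix.mem_unitaryGroup_iff'.1 C.2
  have hdet : ‖M.det‖ = 1 := by
    have h := congrArg Matrix.det hM1
    rw [Matrix.det_mul, Matrix.det_one, Matrix.star_eq_conjTranspose, Matrix.det_conjTranspose,
      Complex.star_def, ← Complex.normSq_eq_conj_mul_self, Complex.normSq_eq_norm_sq] at h
    have h' : ‖M.det‖ ^ 2 = 1 := by exact_mod_cast h
    exact (pow_eq_one_iff_of_nonneg (norm_nonneg _) two_ne_zero).1 h'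
  have hm1 : ‖m‖ = 1 := by
    rw [← hm, norm_pow] at hdet
    exact (pow_eq_one_iff_of_nonneg (norm_nonneg _) two_ne_zero).1 hdet
  have hm0 : m ≠ 0 := norm_ne_zero_iff.1 (by rw [hm1]; exact one_ne_zero)
  have hmm : m * (starRingEnd ℂ) m = 1 := by
    rw [Complex.mul_conj, Complex.normSq_eq_norm_sq, hm1, one_pow, Complex.ofReal_one]
  -- `C⁻¹ = C*` and Cramer's rule
  have had : M.adjugate = M.det • star M := by
    have h := congrArg (fun N => star M * N) (Matrix.mul_adjugate M)
    rwa [← mul_assoc, hM1, one_mul, mul_smul_comm, mul_one] at h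
  have hd : M 1 1 = M.det * (starRingEnd ℂ) (M 0 0) := by
    have h := congrFun (congrFun had 0) 0
    rwa [Matrix.adjugate_fin_two] at h
  have ha : M 0 0 = m * (‖M 0 0‖ * Complex.exp (Complex.I * (M 0 0 / m).arg)) := by
    have h := Complex.norm_mul_exp_arg_mul_I (M 0 0 / m)
    rw [norm_div, hm1, div_one, mul_comm _ Complex.I] at h
    rw [h]
    field_simp
  refine ⟨m, (M 0 0 / m).arg, hm1, hm, ha, ?_⟩
  rw [hd, ← hm]
  conv_lhs => rw [ha]
  rw [map_mul, map_mul, Complex.conj_ofReal, ← Complex.exp_conj, map_mul, Complex.conj_I,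
    Complex.conj_ofReal, neg_mul]
  linear_combination (m * (‖M 0 0‖ * Complex.exp (-(Complex.I * (M 0 0 / m).arg)))) * hmm

theorem det_symbol (C : Matrix.unitaryGroup (Fin 2) ℂ) (k : ℝ) :
    (symbol C k).det = (C : Matrix (Fin 2) (Fin 2) ℂ).det := by
  rw [symbol, Matrix.det_mul, Matrix.det_diagonal, Fin.prod_univ_two]
  simp [← Complex.exp_add]

theorem trace_symbol {C : Matrix.unitaryGroup (Fin 2) ℂ} {m : ℂ} {θ r : ℝ}
    (h0 : (C : Matrix (Fin 2) (Fin 2) ℂ) 0 0 = m * (r * Complex.exp (Complex.I * θ)))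
    (h1 : (C : Matrix (Fin 2) (Fin 2) ℂ) 1 1 = m * (r * Complex.exp (-(Complex.I * θ)))) (k : ℝ) :
    (symbol C k).trace = m * (2 * (r * Real.cos (k + θ) : ℝ)) := by
  rw [Matrix.trace_fin_two, symbol_apply, symbol_apply, h0, h1]
  simp only [Matrix.cons_val_zero, Matrix.cons_val_one, Complex.ofReal_mul, Complex.ofReal_cos,
    Complex.cos, Complex.ofReal_add]
  have e1 : Complex.exp ((k + θ) * Complex.I) =
      Complex.exp (Complex.I * k) * Complex.exp (Complex.I * θ) := by
    rw [← Complex.exp_add]; ring_nf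
  have e2 : Complex.exp (-(k + θ) * Complex.I) =
      Complex.exp (-Complex.I * k) * Complex.exp (-(Complex.I * θ)) := by
    rw [← Complex.exp_add]; ring_nf
  rw [e1, e2]
  ring

/-- A point of the unit circle is determined by its real part, up to conjugation. -/
theorem re_eq_of_add_of_mul {u v : ℂ} {x : ℝ} (hu : ‖u‖ = 1) (ha : u + v = 2 * x)
    (hm : u * v = 1) : u.re = x ∧ v.re = x := by
  have hv : v = (starRingEnd ℂ) u := by
    have h : u * (starRingEnd ℂ) u = 1 := by
      rw [Complex.mul_conj, Complex.normSq_eq_norm_sq, hu]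
      simp
    have hu0 : u ≠ 0 := norm_ne_zero_iff.1 (by rw [hu]; exact one_ne_zero)
    exact mul_left_cancel₀ hu0 (hm.trans h.symm)
  have h := congrArg Complex.re ha
  rw [hv] at h ⊢
  simp at h ⊢
  linarith

namespace Diagonalization

variable {C : Matrix.unitaryGroup (Fin 2) ℂ}

theorem norm_eigenvalue (Δ : Diagonalization C) (j : Fin 2) (k : ℝ) :
    ‖Δ.eigenvalue j k‖ = 1 := by
  have h : (Matrix.diagonal fun j => Δ.eigenvalue j k) ∈ Matrix.unitaryGroup (Fin 2) ℂ := by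
    rw [← Δ.diagonalizes k]
    exact ((Δ.W k)⁻¹ * symbolU C k * Δ.W k).2
  have h' := congrFun (congrFun (Matrix.mem_unitaryGroup_iff'.1 h) j) j
  rw [Matrix.star_eq_conjTranspose, Matrix.diagonal_conjTranspose, Matrix.diagonal_mul_diagonal,
    Matrix.diagonal_apply_eq, Matrix.one_apply_eq, Pi.star_apply, Complex.star_def,
    ← Complex.normSq_eq_conj_mul_self, Complex.normSq_eq_norm_sq] at h'
  exact (pow_eq_one_iff_of_nonneg (norm_nonneg _) two_ne_zero).1 (by exact_mod_cast h')

theorem add_eigenvalue (Δ : Diagonalization C) (k : ℝ) :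
    Δ.eigenvalue 0 k + Δ.eigenvalue 1 k = (symbol C k).trace := by
  have h := congrArg Matrix.trace (Δ.diagonalizes k)
  rw [Matrix.trace_mul_comm, ← mul_assoc, ← Submonoid.coe_mul, mul_inv_cancel, Submonoid.coe_one,
    one_mul, Matrix.trace_diagonal, Fin.sum_univ_two] at h
  exact h.symm

theorem mul_eigenvalue (Δ : Diagonalization C) (k : ℝ) :
    Δ.eigenvalue 0 k * Δ.eigenvalue 1 k = (C : Matrix (Fin 2) (Fin 2) ℂ).det := by
  have h := congrArg Matrix.det (Δ.diagonalizes k)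
  rw [Matrix.det_mul, Matrix.det_mul, mul_right_comm, ← Matrix.det_mul, ← Submonoid.coe_mul,
    inv_mul_cancel, Submonoid.coe_one, Matrix.det_one, one_mul, Matrix.det_diagonal,
    Fin.prod_univ_two, det_symbol] at h
  exact h.symm

/-- The dispersion relation: relative to a square root `m` of `det C`, the eigenvalues have real
part `r cos (k + θ)` with `r = |a|`. -/
theorem re_eigenvalue (Δ : Diagonalization C) {m : ℂ} {θ r : ℝ} (hm : ‖m‖ = 1)
    (hdet : m ^ 2 = (C : Matrix (Fin 2) (Fin 2) ℂ).det)
    (h0 : (C : Matrix (Fin 2) (Fin 2) ℂ) 0 0 = m * (r * Complex.exp (Complex.I * θ)))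
    (h1 : (C : Matrix (Fin 2) (Fin 2) ℂ) 1 1 = m * (r * Complex.exp (-(Complex.I * θ))))
    (j : Fin 2) (k : ℝ) : (Δ.eigenvalue j k / m).re = r * Real.cos (k + θ) := by
  have hm0 : m ≠ 0 := norm_ne_zero_iff.1 (by rw [hm]; exact one_ne_zero)
  have h := re_eq_of_add_of_mul (u := Δ.eigenvalue 0 k / m) (v := Δ.eigenvalue 1 k / m)
    (x := r * Real.cos (k + θ)) (by rw [norm_div, norm_eigenvalue, hm, div_one])
    (by rw [← add_div, Δ.add_eigenvalue, trace_symbol h0 h1]; field_simp)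
    (by rw [div_mul_div_comm, Δ.mul_eigenvalue, ← hdet]; field_simp)
  fin_cases j
  exacts [h.1, h.2]

end Diagonalization

/-! ### The eigenvalues for `0 < |a| < 1` -/

/-- The phase `± arccos (r cos (k + θ))` of an eigenvalue; the sign is `s`. -/
def bandPhase (r θ s k : ℝ) : ℝ := s * Real.arccos (r * Real.cos (k + θ))

/-- The derivative of `bandPhase`. -/
def bandSpeed (r θ s k : ℝ) : ℝ :=
  s * (r * Real.sin (k + θ) / Real.sqrt (1 - (r * Real.cos (k + θ)) ^ 2))

section Band

variable {r θ s : ℝ}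

theorem abs_mul_cos_lt_one (h0 : 0 < r) (h1 : r < 1) (x : ℝ) : |r * Real.cos x| < 1 := by
  rw [abs_mul, abs_of_pos h0]
  exact (mul_le_of_le_one_right h0.le (Real.abs_cos_le_one x)).trans_lt h1

theorem contDiff_bandPhase (h0 : 0 < r) (h1 : r < 1) (n : WithTop ℕ∞) :
    ContDiff ℝ n (bandPhase r θ s) := by
  refine contDiff_const.mul (contDiff_iff_contDiffAt.2 fun k => ?_)
  have h := abs_lt.1 (abs_mul_cos_lt_one h0 h1 (k + θ))
  have hc : ContDiff ℝ n fun k => r * Real.cos (k + θ) :=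
    contDiff_const.mul (Real.contDiff_cos.comp (contDiff_id.add contDiff_const))
  exact ContDiffAt.comp (g := Real.arccos) k (Real.contDiffAt_arccos h.1.ne' h.2.ne)
    hc.contDiffAt

theorem one_sub_sq_pos (h0 : 0 < r) (h1 : r < 1) (x : ℝ) : 0 < 1 - (r * Real.cos x) ^ 2 := by
  have := (sq_lt_one_iff_abs_lt_one _).2 (abs_mul_cos_lt_one h0 h1 x)
  linarith

theorem hasDerivAt_bandPhase (h0 : 0 < r) (h1 : r < 1) (k : ℝ) :
    HasDerivAt (bandPhase r θ s) (bandSpeed r θ s k) k := by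
  have h := abs_lt.1 (abs_mul_cos_lt_one h0 h1 (k + θ))
  have hc : HasDerivAt (fun k => r * Real.cos (k + θ)) (r * -Real.sin (k + θ)) k := by
    simpa using ((Real.hasDerivAt_cos (k + θ)).comp_add_const k θ).const_mul r
  convert! ((Real.hasDerivAt_arccos h.1.ne' h.2.ne).comp k hc).const_mul s using 1
  rw [bandSpeed]
  ring

theorem deriv_bandPhase (h0 : 0 < r) (h1 : r < 1) :
    deriv (bandPhase r θ s) = bandSpeed r θ s :=
  funext fun k => (hasDerivAt_bandPhase h0 h1 k).deriv

theorem contDiff_bandSpeed (h0 : 0 < r) (h1 : r < 1) : ContDiff ℝ 1 (bandSpeed r θ s) := by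
  rw [← deriv_bandPhase h0 h1]
  exact ((contDiff_succ_iff_deriv (n := 1)).1 (contDiff_bandPhase h0 h1 _)).2.2

theorem bandSpeed_eq_zero_iff (h0 : 0 < r) (h1 : r < 1) (hs : s ≠ 0) {k : ℝ} :
    bandSpeed r θ s k = 0 ↔ Real.sin (k + θ) = 0 := by
  have := (Real.sqrt_pos.2 (one_sub_sq_pos h0 h1 (k + θ))).ne'
  simp [bandSpeed, hs, h0.ne', this]

theorem periodic_bandPhase : Function.Periodic (bandPhase r θ s) (2 * Real.pi) := fun k => by
  rw [bandPhase, bandPhase, add_right_comm, Real.cos_add_two_pi]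

theorem periodic_bandSpeed : Function.Periodic (bandSpeed r θ s) (2 * Real.pi) := fun k => by
  rw [bandSpeed, bandSpeed, add_right_comm, Real.cos_add_two_pi, Real.sin_add_two_pi]

/-- The turning points are the two zeros of `sin (k + θ)` in a period. -/
theorem exists_isTwoArc_bandSpeed (h0 : 0 < r) (h1 : r < 1) (hs : s ≠ 0) :
    ∃ k₁ k₂, IsTwoArc (bandSpeed r θ s) (deriv (bandSpeed r θ s)) (bandPhase r θ s) k₁ k₂ := by
  set k₁ := toIcoMod Real.pi_pos 0 (-θ) with hk₁
  have hmem : k₁ ∈ Set.Ico 0 Real.pi := by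
    simpa using toIcoMod_mem_Ico' Real.pi_pos (-θ)
  have hpi := Real.pi_pos
  obtain ⟨n, hn⟩ : ∃ n : ℤ, k₁ + θ = n * Real.pi := by
    refine ⟨-toIcoDiv Real.pi_pos 0 (-θ), ?_⟩
    have := self_sub_toIcoDiv_zsmul Real.pi_pos 0 (-θ)
    rw [← hk₁, zsmul_eq_mul] at this
    push_cast
    linarith
  refine ⟨k₁, k₁ + Real.pi, ?_, ?_, ?_, ?_, ?_, hmem.1, ?_, ?_, ?_, ?_, ?_⟩
  · exact fun k => ((contDiff_bandSpeed h0 h1).differentiable one_ne_zero k).hasDerivAt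
  · exact (contDiff_bandSpeed h0 h1).continuous_deriv le_rfl
  · exact fun k => hasDerivAt_bandPhase h0 h1 k
  · simpa using (periodic_bandSpeed (r := r) (θ := θ) (s := s) 0).symm
  · simpa using (periodic_bandPhase (r := r) (θ := θ) (s := s) 0).symm
  · linarith
  · linarith [hmem.2]
  · rw [bandSpeed_eq_zero_iff h0 h1 hs, Real.sin_eq_zero_iff]
    exact ⟨n, hn.symm⟩
  · rw [bandSpeed_eq_zero_iff h0 h1 hs, Real.sin_eq_zero_iff]
    exact ⟨n + 1, by push_cast; linarith⟩
  · intro k hk hk' hne hne'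
    rw [Ne, bandSpeed_eq_zero_iff h0 h1 hs, Real.sin_eq_zero_iff]
    rintro ⟨p, hp⟩
    have e : k - k₁ = (p - n : ℤ) * Real.pi := by push_cast; linarith
    have hlt : (p - n : ℤ) < 2 := by
      by_contra! h
      have : (2 : ℝ) ≤ (p - n : ℤ) := by exact_mod_cast h
      nlinarith [hmem.1]
    have hgt : -1 < (p - n : ℤ) := by
      by_contra! h
      have : ((p - n : ℤ) : ℝ) ≤ -1 := by exact_mod_cast h
      nlinarith [hmem.2]
    obtain h | h : p - n = 0 ∨ p - n = 1 := by omega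
    · rw [h] at e
      exact hne (by simpa [sub_eq_zero] using e)
    · rw [h] at e
      exact hne' (by push_cast at e; linarith)

theorem exp_bandPhase (h0 : 0 < r) (h1 : r < 1) (hs : s = 1 ∨ s = -1) (k : ℝ) :
    Complex.exp (Complex.I * bandPhase r θ s k) = (r * Real.cos (k + θ) : ℝ) +
      Complex.I * (s * Real.sqrt (1 - (r * Real.cos (k + θ)) ^ 2) : ℝ) := by
  have h := abs_le.1 (abs_mul_cos_lt_one h0 h1 (k + θ)).le
  rw [mul_comm, Complex.exp_mul_I, ← Complex.ofReal_cos, ← Complex.ofReal_sin, mul_comm Complex.I]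
  have e1 : Real.cos (bandPhase r θ s k) = r * Real.cos (k + θ) := by
    rcases hs with rfl | rfl <;> simp only [bandPhase, one_mul, neg_mul, Real.cos_neg] <;>
      exact Real.cos_arccos h.1 h.2
  have e2 : Real.sin (bandPhase r θ s k) = s * Real.sqrt (1 - (r * Real.cos (k + θ)) ^ 2) := by
    rcases hs with rfl | rfl <;> simp only [bandPhase, one_mul, neg_mul, Real.sin_neg] <;>
      rw [Real.sin_arccos]
  rw [e1, e2]

/-- A continuous unimodular function with real part `r cos (k + θ)` is one of the two bands: its
imaginary part has no zeros, hence constant sign. -/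
theorem exists_eq_exp_bandPhase (h0 : 0 < r) (h1 : r < 1) {ν : ℝ → ℂ} (hc : Continuous ν)
    (hν : ∀ k, ‖ν k‖ = 1) (hre : ∀ k, (ν k).re = r * Real.cos (k + θ)) :
    ∃ s : ℝ, (s = 1 ∨ s = -1) ∧ ∀ k, ν k = Complex.exp (Complex.I * bandPhase r θ s k) := by
  have hsq : ∀ k, (ν k).im ^ 2 = 1 - (r * Real.cos (k + θ)) ^ 2 := by
    intro k
    have h := Complex.sq_norm (ν k)
    rw [hν, Complex.normSq_apply, hre] at h
    linarith
  have hne : ∀ k, (ν k).im ≠ 0 := by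
    intro k hk
    have h := one_sub_sq_pos h0 h1 (k + θ)
    rw [← hsq, hk] at h
    simp at h
  have him : Continuous fun k => (ν k).im := Complex.continuous_im.comp hc
  have hsign : (∀ k, 0 < (ν k).im) ∨ ∀ k, (ν k).im < 0 := by
    by_contra! h
    obtain ⟨⟨a, ha⟩, b, hb⟩ := h
    obtain ⟨c, hc⟩ := mem_range_of_exists_le_of_exists_ge him ⟨a, ha⟩ ⟨b, hb⟩
    exact hne c hc
  rcases hsign with h | h
  · refine ⟨1, Or.inl rfl, fun k => ?_⟩
    rw [exp_bandPhase h0 h1 (Or.inl rfl), ← hsq, Real.sqrt_sq (h k).le, ← hre]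
    apply Complex.ext <;> simp
  · refine ⟨-1, Or.inr rfl, fun k => ?_⟩
    rw [exp_bandPhase h0 h1 (Or.inr rfl), ← hsq, Real.sqrt_sq_eq_abs, abs_of_neg (h k), ← hre]
    apply Complex.ext <;> simp

end Band

namespace Diagonalization

variable {C : Matrix.unitaryGroup (Fin 2) ℂ}

theorem exists_isTwoArc (Δ : Diagonalization C)
    (ha : 0 < ‖(C : Matrix (Fin 2) (Fin 2) ℂ) 0 0‖)
    (ha' : ‖(C : Matrix (Fin 2) (Fin 2) ℂ) 0 0‖ < 1) (j : Fin 2) :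
    ∃ (ω ω' t : ℝ → ℝ) (k₁ k₂ : ℝ) (h : IsTwoArc ω ω' t k₁ k₂),
      IsPhase (Δ.eigenvalueC j) (ofRealC ω h.continuous) := by
  obtain ⟨m, θ, hm, hdet, h0, h1⟩ := exists_coin_phases C
  have hm0 : m ≠ 0 := norm_ne_zero_iff.1 (by rw [hm]; exact one_ne_zero)
  obtain ⟨s, hs, hν⟩ := exists_eq_exp_bandPhase ha ha' (ν := fun k => Δ.eigenvalueC j k / m)
    (by fun_prop) (fun k => by rw [norm_div, hm, div_one]; exact Δ.norm_eigenvalue j k)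
    (Δ.re_eigenvalue hm hdet h0 h1 j)
  have hs0 : s ≠ 0 := by rcases hs with rfl | rfl <;> norm_num
  obtain ⟨k₁, k₂, h⟩ := exists_isTwoArc_bandSpeed (θ := θ) ha ha' hs0
  refine ⟨_, _, _, k₁, k₂, h, fun k => Δ.norm_eigenvalue j k, fun k => ?_, ?_⟩
  · have he : (Δ.eigenvalueC j : ℝ → ℂ) = fun k =>
        m * Complex.exp (Complex.I *
          bandPhase ‖(C : Matrix (Fin 2) (Fin 2) ℂ) 0 0‖ θ s k) := by
      funext k
      rw [← hν k]
      field_simp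
    rw [he]
    convert! (((h.hasDerivAt_phase k).ofReal_comp.const_mul Complex.I).cexp).const_mul m using 1
    rw [ofRealC_apply]
    ring
  · change Δ.eigenvalue j 0 = Δ.eigenvalue j (2 * Real.pi)
    rw [← Δ.periodic j 0, zero_add]

/-- For `|a| < 1` the square roots of `det C` lie in the gap of the spectrum of the walk. -/
theorem exists_eigenvalue_ne (Δ : Diagonalization C)
    (ha' : ‖(C : Matrix (Fin 2) (Fin 2) ℂ) 0 0‖ < 1) :
    ∃ m : ℂ, ‖m‖ = 1 ∧ ∀ j k, Δ.eigenvalue j k ≠ m := by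
  obtain ⟨m, θ, hm, hdet, h0, h1⟩ := exists_coin_phases C
  refine ⟨m, hm, fun j k h => ?_⟩
  have hre := Δ.re_eigenvalue hm hdet h0 h1 j k
  rw [h, div_self (norm_ne_zero_iff.1 (by rw [hm]; exact one_ne_zero)), Complex.one_re] at hre
  have := mul_le_of_le_one_right (norm_nonneg ((C : Matrix (Fin 2) (Fin 2) ℂ) 0 0))
    (Real.cos_le_one (k + θ))
  linarith

/-! ### The eigenvalues for `|a| = 1` -/

/-- For `|a| = 1` the eigenvalues are `m e^{± i (k + θ)}`; analyticity prevents a switch between the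
two signs at a crossing. -/
theorem exists_isPhase_const (Δ : Diagonalization C)
    (ha : ‖(C : Matrix (Fin 2) (Fin 2) ℂ) 0 0‖ = 1) (j : Fin 2) :
    ∃ s : ℝ, (s = 1 ∨ s = -1) ∧ IsPhase (Δ.eigenvalueC j) (ContinuousMap.const ℝ (s : ℂ)) := by
  obtain ⟨m, θ, hm, hdet, h0, h1⟩ := exists_coin_phases C
  have hm0 : m ≠ 0 := norm_ne_zero_iff.1 (by rw [hm]; exact one_ne_zero)
  rw [ha] at h0 h1
  have hre := Δ.re_eigenvalue hm hdet h0 h1 j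
  let e : ℝ → ℝ → ℂ := fun s k => m * Complex.exp (Complex.I * (s * (k + θ)))
  have han : ∀ s, AnalyticOnNhd ℝ (fun k => Δ.eigenvalue j k - e s k) Set.univ := by
    intro s
    refine (Δ.analytic j).sub ?_
    rw [← contDiff_omega_iff_analyticOnNhd]
    refine contDiff_const.mul (ContDiff.cexp (contDiff_const.mul (contDiff_const.mul ?_)))
    exact Complex.ofRealCLM.contDiff.add contDiff_const
  have hmul : ∀ k ∈ (Set.univ : Set ℝ),
      (Δ.eigenvalue j k - e 1 k) * (Δ.eigenvalue j k - e (-1) k) = 0 := by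
    intro k _
    set u := Δ.eigenvalue j k / m with hu
    have hum : Δ.eigenvalue j k = m * u := by rw [hu]; field_simp
    have h2 : u * (starRingEnd ℂ) u = 1 := by
      rw [Complex.mul_conj, Complex.normSq_eq_norm_sq, hu, norm_div, hm, Δ.norm_eigenvalue]
      simp
    have h3 : u + (starRingEnd ℂ) u = Complex.exp (Complex.I * (k + θ)) +
        Complex.exp (-(Complex.I * (k + θ))) := by
      rw [Complex.add_conj, hre k, one_mul, mul_comm Complex.I, ← neg_mul]
      push_cast
      rw [Complex.cos]
      ring
    have h4 : Complex.exp (Complex.I * (k + θ)) * Complex.exp (-(Complex.I * (k + θ))) = 1 := by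
      rw [← Complex.exp_add, add_neg_cancel, Complex.exp_zero]
    have e1 : e 1 k = m * Complex.exp (Complex.I * (k + θ)) := by simp [e]
    have e2 : e (-1) k = m * Complex.exp (-(Complex.I * (k + θ))) := by
      simp only [e]
      congr 2
      push_cast
      ring
    rw [hum, e1, e2]
    linear_combination m ^ 2 * u * h3 - m ^ 2 * h2 + m ^ 2 * h4
  have key : ∀ s : ℝ, (∀ k ∈ (Set.univ : Set ℝ), Δ.eigenvalue j k - e s k = 0) →
      IsPhase (Δ.eigenvalueC j) (ContinuousMap.const ℝ (s : ℂ)) := by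
    intro s h
    refine ⟨fun k => Δ.norm_eigenvalue j k, fun k => ?_, ?_⟩
    · have he : (Δ.eigenvalueC j : ℝ → ℂ) = e s :=
        funext fun k => sub_eq_zero.1 (h k (Set.mem_univ k))
      rw [he]
      have hd : HasDerivAt (fun k : ℝ => Complex.I * (s * ((k : ℂ) + θ))) (Complex.I * (s * 1)) k :=
        (((hasDerivAt_id k).ofReal_comp.add_const _).const_mul _).const_mul _
      convert! hd.cexp.const_mul m using 1
      simp only [ContinuousMap.const_apply, e]
      ring
    · change Δ.eigenvalue j 0 = Δ.eigenvalue j (2 * Real.pi)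
      rw [← Δ.periodic j 0, zero_add]
  rcases (han 1).eq_zero_or_eq_zero_of_mul_eq_zero (han (-1)) hmul isPreconnected_univ with h | h
  · exact ⟨1, Or.inl rfl, key 1 h⟩
  · exact ⟨-1, Or.inr rfl, key (-1) h⟩

end Diagonalization

/-! ### Existence of analytic eigenvalues and measurable eigenvectors -/

/-- The unitary matrix of determinant one with first column `(p, q)`. -/
def unitaryOfColumn (p q : ℂ) (h : ‖p‖ ^ 2 + ‖q‖ ^ 2 = 1) : Matrix.unitaryGroup (Fin 2) ℂ :=
  ⟨!![p, -(starRingEnd ℂ) q; q, (starRingEnd ℂ) p], by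
    have h' : p * (starRingEnd ℂ) p + q * (starRingEnd ℂ) q = 1 := by
      rw [Complex.mul_conj, Complex.mul_conj, Complex.normSq_eq_norm_sq, Complex.normSq_eq_norm_sq]
      exact_mod_cast h
    rw [Matrix.mem_unitaryGroup_iff']
    ext i j
    fin_cases i <;> fin_cases j <;>
      simp [Matrix.mul_apply, Fin.sum_univ_two, Matrix.star_apply] <;>
      first
        | linear_combination h'
        | ring1⟩

theorem norm_sq_add_norm_sq_row (M : Matrix.unitaryGroup (Fin 2) ℂ) (i : Fin 2) :
    ‖(M : Matrix (Fin 2) (Fin 2) ℂ) i 0‖ ^ 2 + ‖(M : Matrix (Fin 2) (Fin 2) ℂ) i 1‖ ^ 2 = 1 := by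
  have h := congrFun (congrFun (Matrix.mem_unitaryGroup_iff.1 M.2) i) i
  rw [Matrix.mul_apply, Fin.sum_univ_two, Matrix.one_apply_eq, Matrix.star_apply,
    Matrix.star_apply, Complex.star_def, Complex.mul_conj, Complex.mul_conj,
    Complex.normSq_eq_norm_sq, Complex.normSq_eq_norm_sq] at h
  exact_mod_cast h

/-- A unitary matrix whose first basis vector is an eigenvector is diagonal. -/
theorem eq_diagonal_of_first_column (N : Matrix.unitaryGroup (Fin 2) ℂ) {x y : ℂ} (hx : ‖x‖ = 1)
    (h0 : (N : Matrix (Fin 2) (Fin 2) ℂ) 0 0 = x) (h1 : (N : Matrix (Fin 2) (Fin 2) ℂ) 1 0 = 0)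
    (hdet : (N : Matrix (Fin 2) (Fin 2) ℂ).det = x * y) :
    (N : Matrix (Fin 2) (Fin 2) ℂ) = Matrix.diagonal ![x, y] := by
  have hrow := norm_sq_add_norm_sq_row N 0
  rw [h0, hx, one_pow, add_eq_left, sq_eq_zero_iff, norm_eq_zero] at hrow
  rw [Matrix.det_fin_two, h0, h1, mul_zero, sub_zero] at hdet
  have hx0 : x ≠ 0 := norm_ne_zero_iff.1 (by rw [hx]; exact one_ne_zero)
  have h11 := mul_left_cancel₀ hx0 hdet
  ext i j
  fin_cases i <;> fin_cases j <;> simp [h0, h1, hrow, h11]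

/-- If `x` and `y` are the roots of the characteristic polynomial of a unitary matrix `M`, then the
normalized vector `(M₀₁, x - M₀₀)` is the first column of a diagonalizing matrix. -/
theorem unitaryOfColumn_diagonalizes (M : Matrix.unitaryGroup (Fin 2) ℂ) {x y : ℂ} (hx : ‖x‖ = 1)
    (htr : (M : Matrix (Fin 2) (Fin 2) ℂ).trace = x + y)
    (hdet : (M : Matrix (Fin 2) (Fin 2) ℂ).det = x * y) {c : ℂ}
    (hc : ‖c * (M : Matrix (Fin 2) (Fin 2) ℂ) 0 1‖ ^ 2 +
      ‖c * (x - (M : Matrix (Fin 2) (Fin 2) ℂ) 0 0)‖ ^ 2 = 1) :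
    ((unitaryOfColumn _ _ hc)⁻¹ * M * unitaryOfColumn _ _ hc : Matrix (Fin 2) (Fin 2) ℂ) =
      Matrix.diagonal ![x, y] := by
  set W := unitaryOfColumn _ _ hc with hW
  have hW0 : (W : Matrix (Fin 2) (Fin 2) ℂ) 0 0 = c * (M : Matrix (Fin 2) (Fin 2) ℂ) 0 1 := rfl
  have hW1 : (W : Matrix (Fin 2) (Fin 2) ℂ) 1 0 = c * (x - (M : Matrix (Fin 2) (Fin 2) ℂ) 0 0) :=
    rfl
  rw [Matrix.trace_fin_two] at htr
  have hdet' := hdet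
  rw [Matrix.det_fin_two] at hdet'
  have hMW : ∀ i, ((M * W : Matrix.unitaryGroup (Fin 2) ℂ) : Matrix (Fin 2) (Fin 2) ℂ) i 0 =
      x * (W : Matrix (Fin 2) (Fin 2) ℂ) i 0 := by
    intro i
    rw [Submonoid.coe_mul, Matrix.mul_apply, Fin.sum_univ_two, hW0, hW1]
    fin_cases i
    · simp only [Fin.zero_eta, Fin.isValue, hW0]
      ring
    · simp only [Fin.mk_one, Fin.isValue, hW1]
      linear_combination c * x * htr - c * hdet'
  have hN : ∀ j, ((W⁻¹ * (M * W) : Matrix.unitaryGroup (Fin 2) ℂ) : Matrix (Fin 2) (Fin 2) ℂ) j 0 =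
      x * (1 : Matrix (Fin 2) (Fin 2) ℂ) j 0 := by
    intro j
    rw [Submonoid.coe_mul, Matrix.mul_apply]
    simp only [hMW, mul_left_comm _ x]
    rw [← Finset.mul_sum, ← Matrix.mul_apply, ← Submonoid.coe_mul, inv_mul_cancel,
      Submonoid.coe_one]
  rw [← Submonoid.coe_mul, ← Submonoid.coe_mul, mul_assoc]
  refine eq_diagonal_of_first_column _ hx (by rw [hN]; simp) (by rw [hN]; simp) ?_
  rw [Submonoid.coe_mul, Matrix.det_mul, Submonoid.coe_mul, Matrix.det_mul, mul_left_comm,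
    ← Matrix.det_mul, ← Submonoid.coe_mul, inv_mul_cancel, Submonoid.coe_one, Matrix.det_one,
    mul_one, hdet]

theorem periodic_symbol (C : Matrix.unitaryGroup (Fin 2) ℂ) :
    Function.Periodic (symbol C) (2 * Real.pi) := fun k => by
  have h1 : Complex.exp (Complex.I * (k + 2 * Real.pi : ℝ)) = Complex.exp (Complex.I * k) := by
    push_cast
    rw [mul_add, mul_comm Complex.I (2 * Real.pi), Complex.exp_add, Complex.exp_two_pi_mul_I,
      mul_one]
  have h2 : Complex.exp (-Complex.I * (k + 2 * Real.pi : ℝ)) = Complex.exp (-Complex.I * k) := by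
    rw [neg_mul, Complex.exp_neg, h1, neg_mul, Complex.exp_neg]
  rw [symbol, symbol, h1, h2]

/-- For `|a| < 1` the off-diagonal entry `b` is nonzero, and `(Û₀₁, λ_0 - Û₀₀)` is an eigenvector
that vanishes nowhere. -/
theorem nonempty_diagonalization_of_lt (C : Matrix.unitaryGroup (Fin 2) ℂ)
    (ha : 0 < ‖(C : Matrix (Fin 2) (Fin 2) ℂ) 0 0‖)
    (ha' : ‖(C : Matrix (Fin 2) (Fin 2) ℂ) 0 0‖ < 1) : Nonempty (Diagonalization C) := by
  obtain ⟨m, θ, hm, hdet, h0, h1⟩ := exists_coin_phases C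
  set r := ‖(C : Matrix (Fin 2) (Fin 2) ℂ) 0 0‖ with hr
  -- the two bands, for `s = 1` and `s = -1`
  let lam : ℝ → ℝ → ℂ := fun s k => m * Complex.exp (Complex.I * bandPhase r θ s k)
  have hlam : ∀ s n, ContDiff ℝ n (lam s) := fun s n => contDiff_const.mul
    (ContDiff.cexp (contDiff_const.mul
      (Complex.ofRealCLM.contDiff.comp (contDiff_bandPhase ha ha' n))))
  have hper : ∀ s, Function.Periodic (lam s) (2 * Real.pi) := fun s k => by
    simp only [lam]
    rw [periodic_bandPhase]
  have hnorm : ∀ s k, ‖lam s k‖ = 1 := fun s k => by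
    simp only [lam]
    rw [norm_mul, hm, mul_comm Complex.I, Complex.norm_exp_ofReal_mul_I, one_mul]
  have htr : ∀ k, (symbol C k).trace = lam 1 k + lam (-1) k := fun k => by
    simp only [lam]
    rw [trace_symbol h0 h1, exp_bandPhase ha ha' (Or.inl rfl), exp_bandPhase ha ha' (Or.inr rfl)]
    push_cast
    ring
  have hdet' : ∀ k, (symbol C k).det = lam 1 k * lam (-1) k := fun k => by
    simp only [lam]
    rw [det_symbol, ← hdet, mul_mul_mul_comm, ← Complex.exp_add, ← mul_add, ← Complex.ofReal_add,
      bandPhase, bandPhase, ← add_mul, add_neg_cancel, zero_mul, Complex.ofReal_zero, mul_zero,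
      Complex.exp_zero, mul_one, sq]
  have hb : ∀ k, symbol C k 0 1 ≠ 0 := fun k hk => by
    have h := norm_sq_add_norm_sq_row C 0
    rw [symbol_apply] at hk
    rw [(mul_eq_zero.1 hk).resolve_left (Complex.exp_ne_zero _), ← hr, norm_zero] at h
    nlinarith
  let p : ℝ → ℂ := fun k => symbol C k 0 1
  let q : ℝ → ℂ := fun k => lam 1 k - symbol C k 0 0
  let c : ℝ → ℂ := fun k => ((Real.sqrt (‖p k‖ ^ 2 + ‖q k‖ ^ 2))⁻¹ : ℝ)
  have hp : Measurable p := measurable_symbolU C 0 1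
  have hq : Measurable q :=
    (hlam 1 0).continuous.measurable.sub (measurable_symbolU C 0 0)
  have hc : Measurable c := Complex.measurable_ofReal.comp
    (((hp.norm.pow_const 2).add (hq.norm.pow_const 2)).sqrt.inv)
  have hone : ∀ k, ‖c k * p k‖ ^ 2 + ‖c k * q k‖ ^ 2 = 1 := fun k => by
    have hpos : 0 < ‖p k‖ ^ 2 + ‖q k‖ ^ 2 := by
      have : 0 < ‖p k‖ := norm_pos_iff.2 (hb k)
      positivity
    rw [norm_mul, norm_mul, mul_pow, mul_pow, ← mul_add, Complex.norm_real, Real.norm_eq_abs,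
      sq_abs, inv_pow, Real.sq_sqrt hpos.le, inv_mul_cancel₀ hpos.ne']
  have hpp : Function.Periodic p (2 * Real.pi) := fun k => by
    simp only [p]
    rw [periodic_symbol]
  have hqp : Function.Periodic q (2 * Real.pi) := fun k => by
    simp only [q]
    rw [periodic_symbol, hper]
  have hcp : Function.Periodic c (2 * Real.pi) := fun k => by
    simp only [c]
    rw [hpp, hqp]
  refine ⟨{
    eigenvalue := ![lam 1, lam (-1)]
    W := fun k => unitaryOfColumn (c k * p k) (c k * q k) (hone k)
    analytic := fun j => ?_
    periodic := fun j => ?_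
    measurable := fun i j => ?_
    periodic_W := fun k => ?_
    diagonalizes := fun k => ?_ }⟩
  · rw [← contDiff_omega_iff_analyticOnNhd]
    fin_cases j
    exacts [hlam _ _, hlam _ _]
  · fin_cases j
    exacts [hper _, hper _]
  · have hconj := Complex.continuous_conj.measurable
    fin_cases i <;> fin_cases j
    exacts [hc.mul hp, (hconj.comp (hc.mul hq)).neg, hc.mul hq, hconj.comp (hc.mul hp)]
  · simp only [hcp k, hpp k, hqp k]
  · refine (unitaryOfColumn_diagonalizes (symbolU C k) (hnorm 1 k) (htr k) (hdet' k)
      (hone k)).trans ?_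
    congr 1
    ext j
    fin_cases j <;> rfl

/-- For `|a| = 1` the coin is diagonal, and so is the symbol. -/
theorem nonempty_diagonalization_of_eq (C : Matrix.unitaryGroup (Fin 2) ℂ)
    (ha : ‖(C : Matrix (Fin 2) (Fin 2) ℂ) 0 0‖ = 1) : Nonempty (Diagonalization C) := by
  obtain ⟨m, θ, hm, hdet, h0, h1⟩ := exists_coin_phases C
  have hb : (C : Matrix (Fin 2) (Fin 2) ℂ) 0 1 = 0 := by
    have h := norm_sq_add_norm_sq_row C 0
    rwa [ha, one_pow, add_eq_left, sq_eq_zero_iff, norm_eq_zero] at h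
  have hc : (C : Matrix (Fin 2) (Fin 2) ℂ) 1 0 = 0 := by
    have h := norm_sq_add_norm_sq_row C 1
    have h11 : ‖(C : Matrix (Fin 2) (Fin 2) ℂ) 1 1‖ = 1 := by
      rw [h1, ha, norm_mul, hm, norm_mul, mul_comm Complex.I, ← neg_mul, ← Complex.ofReal_neg,
        Complex.norm_exp_ofReal_mul_I]
      simp
    rwa [h11, one_pow, add_eq_right, sq_eq_zero_iff, norm_eq_zero] at h
  have hd : ∀ k, symbol C k = Matrix.diagonal fun j => symbol C k j j := by
    intro k
    ext i j
    fin_cases i <;> fin_cases j <;> simp [symbol_apply, hb, hc]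
  refine ⟨{
    eigenvalue := fun j k => symbol C k j j
    W := fun _ => 1
    analytic := fun j => ?_
    periodic := fun j k => congrArg (fun N => N j j) (periodic_symbol C k)
    measurable := fun i j => measurable_const
    periodic_W := fun _ => rfl
    diagonalizes := fun k => by
      rw [inv_one, Submonoid.coe_one, one_mul, mul_one]
      exact hd k }⟩
  rw [← contDiff_omega_iff_analyticOnNhd]
  simp only [symbol_apply]
  refine ContDiff.mul ?_ contDiff_const
  fin_cases j
  all_goals exact (contDiff_const.mul Complex.ofRealCLM.contDiff).cexp

theorem norm_apply_zero_zero_le_one (C : Matrix.unitaryGroup (Fin 2) ℂ) :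
    ‖(C : Matrix (Fin 2) (Fin 2) ℂ) 0 0‖ ≤ 1 := by
  have := norm_sq_add_norm_sq_row C 0
  nlinarith [norm_nonneg ((C : Matrix (Fin 2) (Fin 2) ℂ) 0 0)]

theorem nonempty_diagonalization (C : Matrix.unitaryGroup (Fin 2) ℂ)
    (ha : 0 < ‖(C : Matrix (Fin 2) (Fin 2) ℂ) 0 0‖) : Nonempty (Diagonalization C) := by
  rcases (norm_apply_zero_zero_le_one C).lt_or_eq with h | h
  · exact nonempty_diagonalization_of_lt C ha h
  · exact nonempty_diagonalization_of_eq C h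

/-! ### Time operators and invariance of the graph -/

section Abstract

variable {H : Type*} [NormedAddCommGroup H] [InnerProductSpace ℂ H]
  {U : H ≃ₗᵢ[ℂ] H} {T T' : H →ₗ.[ℂ] H}

theorem mem_spectrum_of_eigenvector {x : H} {z : ℂ} (hx : x ≠ 0) (h : (x, z • x) ∈ T.graph) :
    z ∈ spectrum T := by
  rintro ⟨R, -, hR⟩
  have hd := LinearPMap.mem_domain_of_mem_graph h
  have h1 := hR ⟨x, hd⟩
  rw [← (LinearPMap.image_iff hd).2 h, sub_self, map_zero] at h1
  exact hx h1.symm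

variable [CompleteSpace H]

theorem unitaryConj_eq_add_id_iff :
    unitaryConj U T = T + (LinearMap.id : H →ₗ[ℂ] H).toPMap ⊤ ↔
      ∀ x y, (x, y) ∈ T.graph ↔ (U x, U y + U x) ∈ T.graph := by
  have hid : ∀ x y, (x, y) ∈ (T + (LinearMap.id : H →ₗ[ℂ] H).toPMap ⊤).graph ↔
      (x, y - x) ∈ T.graph := by
    intro x y
    rw [mem_graph_add]
    constructor
    · rintro ⟨a, b, h1, h2, rfl⟩
      obtain ⟨b, rfl, rfl⟩ := (LinearPMap.mem_graph_iff _).1 h2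
      have hb : (LinearMap.id : H →ₗ[ℂ] H).toPMap ⊤ b = b := rfl
      rwa [hb, add_sub_cancel_right]
    · intro h
      exact ⟨_, _, h, (((LinearMap.id : H →ₗ[ℂ] H).toPMap ⊤).mem_graph ⟨x, trivial⟩),
        (sub_add_cancel y x).symm⟩
  constructor
  · intro h x y
    have h1 := hid x (y + x)
    rw [← h, mem_graph_unitaryConj, map_add, add_sub_cancel_right] at h1
    exact h1.symm
  · intro h
    refine LinearPMap.eq_of_eq_graph (Submodule.ext fun p => ?_)
    obtain ⟨x, y⟩ := p
    rw [mem_graph_unitaryConj, hid, h x, map_sub, sub_add_cancel]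

/-- Every self-adjoint extension of a strong time operator is a time operator: the commutation
relation persists on the domain of the strong time operator. -/
theorem IsStrongTimeOperator.isTimeOperator_of_le [Nontrivial H] (hT : IsStrongTimeOperator U T)
    (hle : T ≤ T') (hT' : IsSelfAdjoint T') : IsTimeOperator U T' := by
  have hdense := hT.1.1
  refine ⟨⟨hdense.mono hle.1, ?_⟩, T.domain, ?_, fun x hx => ?_⟩
  · exact (isSelfAdjoint_iff.1 hT').ge
  · intro h
    rw [h] at hdense
    obtain ⟨x, hx⟩ := exists_ne (0 : H)
    have h1 := hdense.closure_eq ▸ Set.mem_univ x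
    rw [Submodule.bot_coe, closure_singleton] at h1
    exact hx h1
  · have h1 := (unitaryConj_eq_add_id_iff.1 hT.2 _ _).1 (T.mem_graph ⟨x, hx⟩)
    have h2 := LinearPMap.le_graph_of_le hle h1
    have h3 := LinearPMap.le_graph_of_le hle (T.mem_graph ⟨x, hx⟩)
    have d2 := LinearPMap.mem_domain_of_mem_graph h2
    have d3 := LinearPMap.mem_domain_of_mem_graph h3
    refine ⟨d2, d3, ?_⟩
    rw [← (LinearPMap.image_iff d2).2 h2, ← (LinearPMap.image_iff d3).2 h3, add_sub_cancel_left]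

theorem IsSymmetric.graph_closure (hT : IsSymmetric T) :
    T.closure.graph = T.graph.topologicalClosure :=
  have hc := (LinearPMap.adjoint_isClosed hT.1).isClosable.leIsClosable hT.2
  hc.graph_closure_eq_closure_graph.symm

theorem defectSpace_eq_defectRel (hT : Dense (T.domain : Set H)) (z : ℂ) :
    defectSpace T z = defectRel T.graph z :=
  Submodule.ext fun _ => mem_defectSpace_iff hT

end Abstract

instance : Nontrivial PosSpace := by
  refine nontrivial_of_ne (lp.single 2 0 (EuclideanSpace.single 0 1)) 0 fun h => ?_
  have h1 := congrArg (fun ψ : PosSpace => ψ 0 0) h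
  simp [lp.single_apply] at h1

/-! ### The channels of the time operator -/

theorem mulC_star_mulC {l : C(ℝ, ℂ)} (hl : ∀ k, ‖l k‖ = 1) (f : MomSpace1) :
    mulC (star l) (mulC l f) = f := by
  rw [mulC_mulC]
  have : star l * l = 1 := by
    ext k
    rw [ContinuousMap.mul_apply, ContinuousMap.star_apply, Complex.star_def,
      ← Complex.normSq_eq_conj_mul_self, Complex.normSq_eq_norm_sq, hl]
    simp
  rw [this, mulC_one]

theorem mulC_const (c : ℂ) (f : MomSpace1) : mulC (ContinuousMap.const ℝ c) f = c • f := by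
  refine Lp.ext ?_
  filter_upwards [coeFn_mulC (ContinuousMap.const ℝ c) f, Lp.coeFn_smul c f] with k h1 h2
  rw [h1, h2]
  rfl

theorem isSpeed_const {s : ℝ} (hs : s ≠ 0) :
    IsSpeed (ContinuousMap.const ℝ (s : ℂ)) (ContinuousMap.const ℝ 0) where
  conj_eq _ := Complex.conj_ofReal s
  hasDerivAt k := hasDerivAt_const k _
  periodic := rfl
  ae_ne := Filter.Eventually.of_forall fun _ => Complex.ofReal_ne_zero.2 hs

/-- For constant velocity `s` the operator of the channel is `P / s`. -/
theorem mem_channelGraph_const {s : ℂ} {p : MomSpace1 × MomSpace1} (hp : p ∈ graphP) :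
    (s • p.1, p.2) ∈ channelGraph (ContinuousMap.const ℝ s) (ContinuousMap.const ℝ 0) :=
  ⟨p.1, p.2, 0, hp, (mulC_const _ _).symm, by
    rw [mulC_const, mulC_const, smul_zero, zero_smul], by simp⟩

theorem exists_mem_channelGraph_const_sub {s : ℝ} (hs : s = 1 ∨ s = -1) {z : ℂ}
    (hz : ∀ n : ℤ, z ≠ n) (y : MomSpace1) :
    ∃ p ∈ channelGraph (ContinuousMap.const ℝ (s : ℂ)) (ContinuousMap.const ℝ 0),
      p.2 - z • p.1 = y := by
  obtain ⟨p, hp, h⟩ := exists_mem_graphP_sub (z := z * s) (exp_I_mul_two_pi_ne_one fun n h => by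
    rcases hs with rfl | rfl
    · exact hz n (by simpa using h)
    · exact hz (-n) (by push_cast at h ⊢; linear_combination -h)) y
  exact ⟨_, mem_channelGraph_const hp, by rw [smul_smul]; exact h⟩

/-- The Fourier modes are eigenfunctions of `P`. -/
theorem exists_eigenvector_graphP (n : ℤ) : ∃ f : MomSpace1, f ≠ 0 ∧ (f, (n : ℂ) • f) ∈ graphP := by
  set g : ℝ → ℂ := fun k => Complex.exp (Complex.I * (n * k)) with hg
  have hcd : ContDiff ℝ 1 g :=
    (contDiff_const.mul (contDiff_const.mul Complex.ofRealCLM.contDiff)).cexp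
  have hm : MemLp g 2 μ := memLp_of_continuousOn hcd.continuous.continuousOn
  refine ⟨hm.toLp, fun h => ?_, g, hcd.contDiffOn.absolutelyContinuousOnInterval, ?_,
    hm.coeFn_toLp, ?_⟩
  · have h1 : ∀ᵐ k ∂μ, g k = 0 := by
      have h2 := hm.coeFn_toLp
      rw [h] at h2
      filter_upwards [h2, Lp.coeFn_zero ℂ 2 μ] with k e1 e2
      rw [← e1, e2, Pi.zero_apply]
    obtain ⟨k, -, hk⟩ := exists_mem_Ioo_of_ae_μ h1 le_rfl two_pi_pos le_rfl
    exact Complex.exp_ne_zero _ hk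
  · simp only [hg]
    rw [Complex.ofReal_zero, mul_zero, mul_zero, Complex.exp_zero, eq_comm, Complex.exp_eq_one_iff]
    exact ⟨n, by push_cast; ring⟩
  · filter_upwards [Lp.coeFn_smul (n : ℂ) hm.toLp, hm.coeFn_toLp] with k e1 e2
    change HasDerivAt g (Complex.I * ((n : ℂ) • hm.toLp : MomSpace1) k) k
    rw [e1, Pi.smul_apply, e2, smul_eq_mul]
    have hd : HasDerivAt (fun k : ℝ => Complex.I * (n * (k : ℂ))) (Complex.I * (n * 1)) k :=
      ((hasDerivAt_id k).ofReal_comp.const_mul _).const_mul _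
    convert! hd.cexp using 1
    simp only [hg]
    ring

namespace Diagonalization

variable {C : Matrix.unitaryGroup (Fin 2) ℂ}

/-- The decomposition of the time operator into channels, for given group velocities. -/
theorem isChannelSum_channelGraph (Δ : Diagonalization C) {w w' : Fin 2 → C(ℝ, ℂ)}
    (hl : ∀ j, IsPhase (Δ.eigenvalueC j) (w j)) (hw : ∀ j, IsSpeed (w j) (w' j)) :
    IsChannelSum Δ.toMom (fun j => channelGraph (w j) (w' j)) (timeOperator Δ) := by
  intro x y
  refine (Δ.isChannelSum x y).trans (forall_congr' fun j => ?_)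
  simp only
  rw [← graph_timeOp1 (hl j) (hw j)]
  rfl

theorem isStrongTimeOperator_timeOperator (Δ : Diagonalization C) {w w' : Fin 2 → C(ℝ, ℂ)}
    (hl : ∀ j, IsPhase (Δ.eigenvalueC j) (w j)) (hw : ∀ j, IsSpeed (w j) (w' j)) :
    IsStrongTimeOperator (evolution C) (timeOperator Δ) := by
  have h := Δ.isChannelSum_channelGraph hl hw
  refine ⟨isSymmetric_of_isSymmRel
    (h.dense_domain fun j v => eq_zero_of_forall_inner_channelGraph (hw j))
    (h.isSymmRel fun j => isSymmRel_channelGraph (hw j)), ?_⟩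
  rw [unitaryConj_eq_add_id_iff]
  intro x y
  rw [h, h]
  simp only [map_add, Δ.component_toMom_evolution]
  refine forall_congr' fun j => ⟨(hl j).mem_channelGraph, fun hj => ?_⟩
  have h1 := (hl j).star_mem_channelGraph (hw j) hj
  rwa [map_add, add_sub_cancel_right, mulC_star_mulC (hl j).norm_eq,
    mulC_star_mulC (hl j).norm_eq] at h1

theorem exists_isPhase_isSpeed (Δ : Diagonalization C)
    (ha : 0 < ‖(C : Matrix (Fin 2) (Fin 2) ℂ) 0 0‖) (j : Fin 2) :
    ∃ w w', IsPhase (Δ.eigenvalueC j) w ∧ IsSpeed w w' := by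
  rcases (norm_apply_zero_zero_le_one C).lt_or_eq with h | h
  · obtain ⟨ω, ω', t, k₁, k₂, h, hl⟩ := Δ.exists_isTwoArc ha h j
    exact ⟨_, _, hl, h.isSpeed⟩
  · obtain ⟨s, hs, hl⟩ := Δ.exists_isPhase_const h j
    exact ⟨_, _, hl, isSpeed_const (by rcases hs with rfl | rfl <;> norm_num)⟩

/-- Each of the two channels contributes two dimensions to every defect space. -/
theorem nonempty_defectEquiv (Δ : Diagonalization C) (ha : 0 < ‖(C : Matrix (Fin 2) (Fin 2) ℂ) 0 0‖)
    (ha' : ‖(C : Matrix (Fin 2) (Fin 2) ℂ) 0 0‖ < 1) (z : ℂ) :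
    Nonempty (defectRel (timeOperator Δ).graph z ≃ₗ[ℂ] (Fin 2 → ℂ × ℂ)) := by
  choose ω ω' t k₁ k₂ h hl using Δ.exists_isTwoArc ha ha'
  exact ⟨((Δ.isChannelSum_channelGraph hl fun j => (h j).isSpeed).defectEquiv z).trans
    (LinearEquiv.piCongrRight fun j => ((h j).defectEquiv z).symm)⟩

/-- At a point that is not a value of the eigenvalues, the resolvent of the walk is multiplication
by `1 / (λ_j - m)` in momentum space. -/
theorem exists_resolvent_evolution (Δ : Diagonalization C) {m : ℂ}
    (hm : ∀ j k, Δ.eigenvalue j k ≠ m) :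
    ∃ B : PosSpace →L[ℂ] PosSpace, (∀ x, evolution C (B x) - m • B x = x) ∧
      ∀ x, B (evolution C x - m • x) = x := by
  let r : Fin 2 → C(ℝ, ℂ) := fun j => ⟨fun k => (Δ.eigenvalueC j k - m)⁻¹,
    ((Δ.eigenvalueC j).continuous.sub continuous_const).inv₀ fun k => sub_ne_zero.2 (hm j k)⟩
  let B : PosSpace →L[ℂ] PosSpace :=
    (Δ.toMom.symm.toContinuousLinearEquiv.toContinuousLinearMap).comp
      ((∑ j, (inclusion j).comp ((mulC (r j)).comp (component j))).comp
        Δ.toMom.toContinuousLinearEquiv.toContinuousLinearMap)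
  have hBc : ∀ x j, component j (Δ.toMom (B x)) = mulC (r j) (component j (Δ.toMom x)) := by
    intro x j
    have : B x = Δ.toMom.symm (∑ j, inclusion j (mulC (r j) (component j (Δ.toMom x)))) := by
      change Δ.toMom.symm
        ((∑ j, (inclusion j).comp ((mulC (r j)).comp (component j))) (Δ.toMom x)) = _
      rw [_root_.sum_apply]
      rfl
    rw [this, LinearIsometryEquiv.apply_symm_apply, component_sum_inclusion]
  have hr : ∀ j f, mulC (r j) (mulC (Δ.eigenvalueC j) f) - m • mulC (r j) f = f := by
    intro j f
    rw [← mulC_const, mulC_mulC, mulC_mulC]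
    refine Lp.ext ?_
    filter_upwards [Lp.coeFn_sub (mulC (r j * Δ.eigenvalueC j) f)
      (mulC (ContinuousMap.const ℝ m * r j) f), coeFn_mulC (r j * Δ.eigenvalueC j) f,
      coeFn_mulC (ContinuousMap.const ℝ m * r j) f] with k h1 h2 h3
    rw [h1, Pi.sub_apply, h2, h3]
    have h4 : (Δ.eigenvalueC j k - m) ≠ 0 := sub_ne_zero.2 (hm j k)
    change (Δ.eigenvalueC j k - m)⁻¹ * Δ.eigenvalueC j k * f k -
      m * (Δ.eigenvalueC j k - m)⁻¹ * f k = f k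
    field_simp
  refine ⟨B, fun x => component_conj_ext Δ.toMom fun j => ?_,
    fun x => component_conj_ext Δ.toMom fun j => ?_⟩
  · rw [map_sub, map_sub, map_smul, map_smul, Δ.component_toMom_evolution, hBc, mulC_mulC,
      mul_comm, ← mulC_mulC, hr]
  · rw [hBc, map_sub, map_sub, map_smul, map_smul, Δ.component_toMom_evolution, map_sub, map_smul,
      hr]

/-- No self-adjoint operator at all is a strong time operator when `|a| < 1`. -/
theorem not_isStrongTimeOperator_of_isSelfAdjoint (Δ : Diagonalization C)
    (ha' : ‖(C : Matrix (Fin 2) (Fin 2) ℂ) 0 0‖ < 1) {T' : PosSpace →ₗ.[ℂ] PosSpace}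
    (hT' : IsSelfAdjoint T') : ¬ IsStrongTimeOperator (evolution C) T' := by
  intro hs
  obtain ⟨m, hm, hne⟩ := Δ.exists_eigenvalue_ne ha'
  obtain ⟨B, hB, hB'⟩ := Δ.exists_resolvent_evolution hne
  exact not_isSelfAdjoint_of_gap hm B hB hB'
    (fun p hp => (unitaryConj_eq_add_id_iff.1 hs.2 p.1 p.2).1 hp) hT'

theorem exists_isSelfAdjoint_extension (Δ : Diagonalization C)
    (ha : 0 < ‖(C : Matrix (Fin 2) (Fin 2) ℂ) 0 0‖)
    (ha' : ‖(C : Matrix (Fin 2) (Fin 2) ℂ) 0 0‖ < 1) :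
    ∃ T' : PosSpace →ₗ.[ℂ] PosSpace, timeOperator Δ ≤ T' ∧ IsSelfAdjoint T' := by
  choose w w' hl hw using Δ.exists_isPhase_isSpeed ha
  have h := Δ.isChannelSum_channelGraph hl hw
  obtain ⟨e₁⟩ := Δ.nonempty_defectEquiv ha ha' Complex.I
  obtain ⟨e₂⟩ := Δ.nonempty_defectEquiv ha ha' (-Complex.I)
  have := Module.Finite.equiv e₁.symm
  have := Module.Finite.equiv e₂.symm
  refine QuantumWalk.exists_isSelfAdjoint_extension
    (h.dense_domain fun j v => eq_zero_of_forall_inner_channelGraph (hw j))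
    (h.isSymmRel fun j => isSymmRel_channelGraph (hw j))
    ((stdOrthonormalBasis ℂ _).equiv (stdOrthonormalBasis ℂ _)
      (finCongr (e₁.trans e₂.symm).finrank_eq))

theorem rank_defectSpace (Δ : Diagonalization C) (ha : 0 < ‖(C : Matrix (Fin 2) (Fin 2) ℂ) 0 0‖)
    (ha' : ‖(C : Matrix (Fin 2) (Fin 2) ℂ) 0 0‖ < 1) (z : ℂ) :
    Module.rank ℂ (defectSpace (timeOperator Δ) z) = 4 := by
  choose w w' hl hw using Δ.exists_isPhase_isSpeed ha
  obtain ⟨e⟩ := Δ.nonempty_defectEquiv ha ha' z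
  rw [defectSpace_eq_defectRel (Δ.isStrongTimeOperator_timeOperator hl hw).1.1, e.rank_eq]
  simp
  norm_num

theorem defectRel_ne_bot (Δ : Diagonalization C) (ha : 0 < ‖(C : Matrix (Fin 2) (Fin 2) ℂ) 0 0‖)
    (ha' : ‖(C : Matrix (Fin 2) (Fin 2) ℂ) 0 0‖ < 1) (z : ℂ) :
    defectRel (timeOperator Δ).graph z ≠ ⊥ := by
  obtain ⟨e⟩ := Δ.nonempty_defectEquiv ha ha' z
  have := e.symm.injective.nontrivial
  exact Submodule.nontrivial_iff_ne_bot.1 this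

theorem spectrum_eq_univ (Δ : Diagonalization C) (ha : 0 < ‖(C : Matrix (Fin 2) (Fin 2) ℂ) 0 0‖)
    (ha' : ‖(C : Matrix (Fin 2) (Fin 2) ℂ) 0 0‖ < 1) :
    spectrum (timeOperator Δ) = Set.univ :=
  Set.eq_univ_of_forall fun _ => mem_spectrum_of_defectRel_ne_bot (Δ.defectRel_ne_bot ha ha' _)

theorem spectrum_closure_eq_univ (Δ : Diagonalization C)
    (ha : 0 < ‖(C : Matrix (Fin 2) (Fin 2) ℂ) 0 0‖)
    (ha' : ‖(C : Matrix (Fin 2) (Fin 2) ℂ) 0 0‖ < 1) :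
    spectrum (timeOperator Δ).closure = Set.univ := by
  choose w w' hl hw using Δ.exists_isPhase_isSpeed ha
  refine Set.eq_univ_of_forall fun z => mem_spectrum_of_defectRel_ne_bot ?_
  rw [(Δ.isStrongTimeOperator_timeOperator hl hw).1.graph_closure, defectRel_topologicalClosure]
  exact Δ.defectRel_ne_bot ha ha' _

/-- For `|a| = 1` both channels are `± P`, self-adjoint with eigenvectors the Fourier modes and
`T - z` onto for every other `z`. -/
theorem isSelfAdjoint_and_spectrum (Δ : Diagonalization C)
    (ha : ‖(C : Matrix (Fin 2) (Fin 2) ℂ) 0 0‖ = 1) :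
    IsSelfAdjoint (timeOperator Δ) ∧
      spectrum (timeOperator Δ) = Set.range (fun n : ℤ => (n : ℂ)) := by
  choose s hs hl using Δ.exists_isPhase_const ha
  have hs0 : ∀ j, s j ≠ 0 := fun j => by rcases hs j with h | h <;> rw [h] <;> norm_num
  have hw := fun j => isSpeed_const (hs0 j)
  have h := Δ.isChannelSum_channelGraph hl hw
  have hsurj : ∀ z : ℂ, (∀ n : ℤ, z ≠ n) →
      ∀ y, ∃ p ∈ (timeOperator Δ).graph, p.2 - z • p.1 = y := fun z hz =>
    h.surjective_sub fun j => exists_mem_channelGraph_const_sub (hs j) hz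
  have hsa : IsSelfAdjoint (timeOperator Δ) := by
    refine isSelfAdjoint_of_surjective (h.isSymmRel fun j => isSymmRel_channelGraph (hw j))
      (hsurj _ fun n hn => ?_) fun y => ?_
    · simpa using congrArg Complex.im hn
    · obtain ⟨p, hp, he⟩ := hsurj (-Complex.I) (fun n hn => by simpa using congrArg Complex.im hn) y
      exact ⟨p, hp, by rwa [neg_smul, sub_neg_eq_add] at he⟩
  refine ⟨hsa, Set.Subset.antisymm (fun z hz => ?_) ?_⟩
  · by_contra hn
    exact hz (hsa.mem_resolventSet (hsurj z fun n hzn => hn ⟨n, hzn.symm⟩))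
  · rintro _ ⟨n, rfl⟩
    -- the Fourier mode of index `n s` in the first channel
    obtain ⟨N, hN⟩ : ∃ N : ℤ, (N : ℂ) = n * s 0 := by
      rcases hs 0 with h | h <;> rw [h]
      exacts [⟨n, by simp⟩, ⟨-n, by simp⟩]
    obtain ⟨f, hf, hfP⟩ := exists_eigenvector_graphP N
    have hp := h.single_mem (j := 0) (mem_channelGraph_const (s := (s 0 : ℂ)) hfP)
    refine mem_spectrum_of_eigenvector (x := assemble Δ.toMom (Pi.single 0 ((s 0 : ℂ) • f)))
      (fun h0 => ?_) ?_
    · have h1 := component_assemble Δ.toMom (Pi.single 0 ((s 0 : ℂ) • f)) 0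
      rw [h0, Pi.single_eq_same, map_zero, map_zero] at h1
      exact smul_ne_zero (Complex.ofReal_ne_zero.2 (hs0 0)) hf h1.symm
    · rw [← map_smul, ← Pi.single_smul, smul_smul, ← hN]
      exact hp

end Diagonalization

end QuantumWalk

end

theorem mainTheorem4 (C : Matrix.unitaryGroup (Fin 2) ℂ)
    (ha : 0 < ‖(C : Matrix (Fin 2) (Fin 2) ℂ) 0 0‖) :
    Nonempty (QuantumWalk.Diagonalization C) ∧
    ∀ Δ : QuantumWalk.Diagonalization C,
      QuantumWalk.IsStrongTimeOperator (QuantumWalk.evolution C) (QuantumWalk.timeOperator Δ) ∧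
      (‖(C : Matrix (Fin 2) (Fin 2) ℂ) 0 0‖ < 1 →
        QuantumWalk.deficiencyPlus (QuantumWalk.timeOperator Δ) = 4 ∧
        QuantumWalk.deficiencyMinus (QuantumWalk.timeOperator Δ) = 4 ∧
        QuantumWalk.spectrum (QuantumWalk.timeOperator Δ) = Set.univ ∧
        QuantumWalk.spectrum (QuantumWalk.timeOperator Δ).closure = Set.univ ∧
        (∃ T' : QuantumWalk.PosSpace →ₗ.[ℂ] QuantumWalk.PosSpace,
          QuantumWalk.timeOperator Δ ≤ T' ∧ IsSelfAdjoint T') ∧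
        ∀ T' : QuantumWalk.PosSpace →ₗ.[ℂ] QuantumWalk.PosSpace,
          QuantumWalk.timeOperator Δ ≤ T' → IsSelfAdjoint T' →
            QuantumWalk.IsTimeOperator (QuantumWalk.evolution C) T' ∧
            ¬ QuantumWalk.IsStrongTimeOperator (QuantumWalk.evolution C) T') ∧
      (‖(C : Matrix (Fin 2) (Fin 2) ℂ) 0 0‖ = 1 →
        IsSelfAdjoint (QuantumWalk.timeOperator Δ) ∧
        QuantumWalk.spectrum (QuantumWalk.timeOperator Δ) = Set.range (fun n : ℤ => (n : ℂ))) := by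
  refine ⟨QuantumWalk.nonempty_diagonalization C ha, fun Δ => ?_⟩
  choose w w' hl hw using Δ.exists_isPhase_isSpeed ha
  have hT := Δ.isStrongTimeOperator_timeOperator hl hw
  refine ⟨hT, fun ha' => ⟨Δ.rank_defectSpace ha ha' _, Δ.rank_defectSpace ha ha' _,
    Δ.spectrum_eq_univ ha ha', Δ.spectrum_closure_eq_univ ha ha',
    Δ.exists_isSelfAdjoint_extension ha ha', fun T' hle hT' =>
      ⟨hT.isTimeOperator_of_le hle hT', Δ.not_isStrongTimeOperator_of_isSelfAdjoint ha' hT'⟩⟩,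
    Δ.isSelfAdjoint_and_spectrum⟩
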